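/- Let $N$ and $\Lambda$ be lattices of rank $2$, $M=N^*$, let $S:\Lambda\to N_{\mathbb R}=N\otimes\mathbb R$ be an injection whose image is a lattice, and let $\mathbb{T}A=N_{\mathbb R}/\Lambda$ be the associated tropical torus. A parametrized tropical curve $h:\Gamma\to\mathbb{T}A$ is a finite metric graph $\Gamma$ without bivalent vertices, with a continuous map $h$ that is affine on each edge $e$ with slope $w_eu_e$ ($w_e\geq 1$ an integer, $u_e\in N$ primitive), such that at every vertex the outgoing slopes add up to $0$. Its class is the push-forward of the $N$-valued cycle $\sum_e e\otimes w_eu_e$ in $H_1(\mathbb{T}A,N)=\Lambda\otimes N$, and its genus is $b_1(\Gamma)$. It is *irreducible* if $\Gamma$ is connected and is not a union of two tropical curves glued at a single point (that is, $\Gamma$ and all $\Gamma\setminus\{x\}$, $x\in\Gamma$, are connected). It is *simple* if $\Gamma$ is trivalent and $h$ is an immersion (locally injective). The lift of a curve to $N_{\mathbb R}$ is the weighted corner locus of a convex, quasi-periodic, piecewise affine function $\Theta$ with integer slopes; two curves $\Gamma,\Gamma_0$, with functions $\Theta,\Theta_0$, are *linearly equivalent* if the homomorphism $K:\Lambda\to\mathbb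 R$, $K_\lambda=(\Theta-\Theta_0)(x+\lambda)-(\Theta-\Theta_0)(x)$, is well-defined (independent of $x$) and zero in $\Lambda^*_{\mathbb R}/M$. Let $g\geq 2$, let $C\in\Lambda\otimes N$ be a nondegenerate class, and let $h_0:\Gamma_0\to\mathbb{T}A$ be a connected tropical curve of genus $2$ in the class $C$. Then there is a dense open subset of $(\mathbb{T}A)^{g-2}$ with complement of measure zero such that the following holds for every configuration $\mathcal P=(p_1,\dots,p_{g-2})$ in it. Let $h:\Gamma\to\mathbb{T}A$ be an irreducible tropical curve of genus $g$ in the class $C$ that passes through $\mathcal P$ and is linearly equivalent to $\Gamma_0$. Then: - $\Gamma$ is simple, and it is rigid: it is isolated among its deformations (same graph and slopes, varying edge lengths and vertex positions) that pass through $\mathcal P$ and are linearly equivalent to $\Gamma_0$; - for all marked points $x_1,\dots,x_{g-2}\in\Gamma$ with $h(x_i)=p_i$, the complement $\Gamma\setminus\{x_1,\dots,x_{g-2}\}$ is connected of genus $2$, and the map $H_1(\Gamma\setminus\{x_1,\dots,x_{g-2}\},\mathbb Z)\to H_1(\mathbb{T}A,\mathbb Z)=\Lambda$ induced by $h$ is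 injective. -/

import Mathlib

open Filter Topology MeasureTheory Set

/-- `det(a, b)` for two vectors of the plane `N_ℝ = ℝ²`. -/
def planeDet (a b : Fin 2 → ℝ) : ℝ := a 0 * b 1 - a 1 * b 0

/-- A vector of the lattice `N = ℤ²` (or of `Λ = ℤ²`, or of the dual lattice `M`),
seen as a real vector. -/
def toReal (n : Fin 2 → ℤ) : Fin 2 → ℝ := fun i => (n i : ℝ)

/-- The image in `N_ℝ` of the rank two lattice `Λ = ℤ²` under the inclusion `S : Λ → N_ℝ`
(a matrix with `det S ≠ 0`). As `S` is injective we identify `Λ` with its image. -/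
def periodLattice (S : Matrix (Fin 2) (Fin 2) ℝ) : AddSubgroup (Fin 2 → ℝ) where
  carrier := {x | ∃ l : Fin 2 → ℤ, S.mulVec (toReal l) = x}
  zero_mem' := ⟨0, by
    have : toReal 0 = 0 := by ext i; simp [toReal]
    rw [this, Matrix.mulVec_zero]⟩
  add_mem' := by
    rintro _ _ ⟨a, rfl⟩ ⟨b, rfl⟩
    refine ⟨a + b, ?_⟩
    rw [← Matrix.mulVec_add]
    congr 1
    ext i
    simp [toReal]
  neg_mem' := by
    rintro _ ⟨a, rfl⟩
    refine ⟨-a, ?_⟩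
    rw [← Matrix.mulVec_neg]
    congr 1
    ext i
    simp [toReal]

/-- The tropical torus `𝕋A = N_ℝ / Λ`. Its first homology group is `Λ`. -/
abbrev TropTorus (S : Matrix (Fin 2) (Fin 2) ℝ) : Type :=
  (Fin 2 → ℝ) ⧸ periodLattice S

/-- The projection `N_ℝ → 𝕋A`. -/
def torusMk (S : Matrix (Fin 2) (Fin 2) ℝ) (x : Fin 2 → ℝ) : TropTorus S :=
  QuotientAddGroup.mk x

theorem sum_boundary_eq_zero {A V E : Type} [AddCommGroup A] [Fintype V] [DecidableEq V]
    [Fintype E] (s t : E → V) (c : E → ℤ) (p : V → A)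
    (hc : ∀ v, (∑ e, if s e = v then c e else 0) - (∑ e, if t e = v then c e else 0) = 0) :
    ∑ e, c e • (p (t e) - p (s e)) = 0 := by
  have e1 : ∀ f : E → V, ∑ e, c e • p (f e) = ∑ v, (∑ e, if f e = v then c e else 0) • p v := by
    intro f
    simp_rw [Finset.sum_smul]
    rw [Finset.sum_comm]
    refine Finset.sum_congr rfl fun e _ => ?_
    simp [ite_smul]
  simp_rw [smul_sub]
  rw [Finset.sum_sub_distrib, e1, e1, ← Finset.sum_sub_distrib]
  refine Finset.sum_eq_zero fun v _ => ?_
  have := hc v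
  rw [← sub_smul, show (∑ e, if t e = v then c e else 0) - (∑ e, if s e = v then c e else 0) = 0
    by linarith, zero_smul]

/-- A parametrized tropical curve `h : Γ → 𝕋A`, where `Γ` is the finite metric graph with
vertex set `V`, edge set `E` (loops and multiple edges are allowed; each edge carries a
reference orientation) and edge lengths `length`. On the edge `e`, oriented from `src e` to
`tgt e`, the map `h` is affine with slope `slope e = w_e u_e ∈ N`, where `w_e ≥ 1` and `u_e` is
primitive: this says that the slope is a nonzero vector of `N`. The vertices are the genuine
vertices of the metric graph, i.e. there are no bivalent ones; balancing with nonzero slopes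
excludes univalent ones. -/
structure TropCurve (S : Matrix (Fin 2) (Fin 2) ℝ) (V E : Type)
    [Fintype V] [DecidableEq V] [Fintype E] where
  src : E → V
  tgt : E → V
  length : E → ℝ
  slope : E → Fin 2 → ℤ
  /-- the image of the vertices under `h` -/
  pos : V → TropTorus S
  length_pos : ∀ e, 0 < length e
  slope_ne : ∀ e, slope e ≠ 0
  valence_ge : ∀ v, 3 ≤ (Finset.univ.filter fun e => src e = v).card +
    (Finset.univ.filter fun e => tgt e = v).card
  /-- the balancing condition -/
  balanced : ∀ v, (∑ e, if src e = v then slope e else 0) -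
    (∑ e, if tgt e = v then slope e else 0) = 0
  /-- `h` has slope `slope e` on the edge `e` -/
  pos_tgt : ∀ e, pos (tgt e) = pos (src e) + torusMk S (length e • toReal (slope e))

namespace TropCurve

variable {S : Matrix (Fin 2) (Fin 2) ℝ} {V E : Type} [Fintype V] [DecidableEq V] [Fintype E]

/-! ### The underlying space of the graph and the map `h` -/

/-- The disjoint union of the closed edges. -/
abbrev PreSpace (Γ : TropCurve S V E) : Type := Σ e : E, Icc (0 : ℝ) (Γ.length e)

/-- The initial point of an edge. -/
def start (Γ : TropCurve S V E) (e : E) : Γ.PreSpace :=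
  ⟨e, 0, left_mem_Icc.2 (Γ.length_pos e).le⟩

/-- The final point of an edge. -/
def finish (Γ : TropCurve S V E) (e : E) : Γ.PreSpace :=
  ⟨e, Γ.length e, right_mem_Icc.2 (Γ.length_pos e).le⟩

/-- End points of edges are glued when they are the same vertex. -/
inductive Glue (Γ : TropCurve S V E) : Γ.PreSpace → Γ.PreSpace → Prop
  | start_start (e f : E) : Γ.src e = Γ.src f → Glue Γ (Γ.start e) (Γ.start f)
  | start_finish (e f : E) : Γ.src e = Γ.tgt f → Glue Γ (Γ.start e) (Γ.finish f)
  | finish_finish (e f : E) : Γ.tgt e = Γ.tgt f → Glue Γ (Γ.finish e) (Γ.finish f)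

/-- The topological space underlying the metric graph `Γ` (with the quotient topology). -/
abbrev Space (Γ : TropCurve S V E) : Type := Quot Γ.Glue

/-- The point at distance `t` from the origin of the edge `e`. -/
def point (Γ : TropCurve S V E) (e : E) (t : Icc (0 : ℝ) (Γ.length e)) : Γ.Space :=
  Quot.mk _ ⟨e, t⟩

/-- The point `h(e, t)` of `𝕋A`, for the parameter `t` on the edge `e`. -/
def edgeMap (Γ : TropCurve S V E) (e : E) (t : ℝ) : TropTorus S :=
  Γ.pos (Γ.src e) + torusMk S (t • toReal (Γ.slope e))

theorem edgeMap_zero (Γ : TropCurve S V E) (e : E) : Γ.edgeMap e 0 = Γ.pos (Γ.src e) := by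
  simp [edgeMap, torusMk]

theorem edgeMap_length (Γ : TropCurve S V E) (e : E) :
    Γ.edgeMap e (Γ.length e) = Γ.pos (Γ.tgt e) := (Γ.pos_tgt e).symm

/-- The map `h : Γ → 𝕋A`. -/
def map (Γ : TropCurve S V E) : Γ.Space → TropTorus S :=
  Quot.lift (fun x => Γ.edgeMap x.1 x.2) (by
    rintro _ _ (⟨e, f, h⟩ | ⟨e, f, h⟩ | ⟨e, f, h⟩) <;>
      simp only [start, finish, edgeMap_zero, edgeMap_length, h])

/-- `h : Γ → 𝕋A` passes through the points `P i`. -/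
def PassesThrough (Γ : TropCurve S V E) {n : ℕ} (P : Fin n → TropTorus S) : Prop :=
  ∀ i, P i ∈ range Γ.map

/-! ### Homology, genus, degree -/

/-- `H₁(Γ, ℤ)`: the integral cellular `1`-cycles of the graph. -/
def H1 (Γ : TropCurve S V E) : AddSubgroup (E → ℤ) where
  carrier := {c | ∀ v, (∑ e, if Γ.src e = v then c e else 0) -
    (∑ e, if Γ.tgt e = v then c e else 0) = 0}
  zero_mem' := by intro v; simp
  add_mem' := by
    intro a b ha hb v
    have h1 := ha v
    have h2 := hb v
    have e1 : ∀ p : E → Prop, ∀ _ : DecidablePred p,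
        (∑ e, if p e then (a + b) e else 0) =
          (∑ e, if p e then a e else 0) + ∑ e, if p e then b e else 0 := by
      intro p _
      rw [← Finset.sum_add_distrib]
      refine Finset.sum_congr rfl fun e _ => ?_
      split_ifs <;> simp
    rw [e1, e1]
    linarith
  neg_mem' := by
    intro a ha v
    have h1 := ha v
    have e1 : ∀ p : E → Prop, ∀ _ : DecidablePred p,
        (∑ e, if p e then (-a) e else 0) = -(∑ e, if p e then a e else 0) := by
      intro p _
      rw [← Finset.sum_neg_distrib]
      refine Finset.sum_congr rfl fun e _ => ?_
      split_ifs <;> simp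
    rw [e1, e1]
    linarith

/-- The genus (first Betti number) of `Γ`. -/
noncomputable def genus (Γ : TropCurve S V E) : ℕ := Module.finrank ℤ Γ.H1

/-- The total displacement in `N_ℝ` of a lift of the image under `h` of a `1`-chain. -/
def displacement (Γ : TropCurve S V E) : (E → ℤ) →+ (Fin 2 → ℝ) where
  toFun c := ∑ e, (c e : ℝ) • (Γ.length e • toReal (Γ.slope e))
  map_zero' := by simp
  map_add' a b := by
    rw [← Finset.sum_add_distrib]
    refine Finset.sum_congr rfl fun e _ => ?_
    rw [← add_smul]
    simp

theorem displacement_mem (Γ : TropCurve S V E) {c : E → ℤ} (hc : c ∈ Γ.H1) :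
    Γ.displacement c ∈ periodLattice S := by
  have key : torusMk S (Γ.displacement c) = ∑ e, c e • (Γ.pos (Γ.tgt e) - Γ.pos (Γ.src e)) := by
    have h1 : Γ.displacement c = ∑ e, c e • (Γ.length e • toReal (Γ.slope e)) := by
      change ∑ e, (c e : ℝ) • (Γ.length e • toReal (Γ.slope e)) = _
      exact Finset.sum_congr rfl fun e _ => Int.cast_smul_eq_zsmul ℝ _ _
    rw [h1]
    change QuotientAddGroup.mk' (periodLattice S) _ = _
    rw [map_sum]
    refine Finset.sum_congr rfl fun e _ => ?_
    rw [map_zsmul, Γ.pos_tgt e, add_sub_cancel_left]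
    rfl
  have hz : ∑ e, c e • (Γ.pos (Γ.tgt e) - Γ.pos (Γ.src e)) = 0 :=
    sum_boundary_eq_zero Γ.src Γ.tgt c Γ.pos hc
  rw [hz] at key
  exact (QuotientAddGroup.eq_zero_iff _).1 key

/-- The map `h_* : H₁(Γ, ℤ) → H₁(𝕋A, ℤ) = Λ`: the class of a cycle is the displacement of a
lift to `N_ℝ` of its image. -/
def homologyMap (Γ : TropCurve S V E) : Γ.H1 →+ periodLattice S :=
  (Γ.displacement.comp Γ.H1.subtype).codRestrict (periodLattice S)
    fun c => Γ.displacement_mem c.2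

/-- `H₁(Γ ∖ Q, ℤ)` as a subgroup of `H₁(Γ, ℤ)`: the cycles that use only closed edges disjoint
from `Q` (for a finite set `Q` the complement retracts onto the union of the vertices and closed
edges disjoint from `Q`, together with some isolated points). -/
def H1Compl (Γ : TropCurve S V E) (Q : Set Γ.Space) : AddSubgroup (E → ℤ) where
  carrier := {c | c ∈ Γ.H1 ∧ ∀ e, (∃ t, Γ.point e t ∈ Q) → c e = 0}
  zero_mem' := ⟨Γ.H1.zero_mem, fun _ _ => rfl⟩
  add_mem' := by
    intro a b ha hb
    refine ⟨Γ.H1.add_mem ha.1 hb.1, fun e he => ?_⟩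
    rw [Pi.add_apply, ha.2 e he, hb.2 e he, add_zero]
  neg_mem' := by
    intro a ha
    refine ⟨Γ.H1.neg_mem ha.1, fun e he => ?_⟩
    rw [Pi.neg_apply, ha.2 e he, neg_zero]

/-- The map `H₁(Γ ∖ Q, ℤ) → H₁(𝕋A, ℤ) = Λ` induced by `h`. -/
def homologyMapCompl (Γ : TropCurve S V E) (Q : Set Γ.Space) :
    Γ.H1Compl Q →+ periodLattice S :=
  Γ.homologyMap.comp (AddSubgroup.inclusion fun _ hc => hc.1)

/-- The `j`-th coordinate of the `N`-valued cycle `∑ e ⊗ slope e` (a cycle by balancing). -/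
def slopeCycle (Γ : TropCurve S V E) (j : Fin 2) : Γ.H1 :=
  ⟨fun e => Γ.slope e j, fun v => by
    have h := congrFun (Γ.balanced v) j
    simpa [Finset.sum_apply, ite_apply] using h⟩

/-- The curve realizes the class `C ∈ H_{1,1}(𝕋A) = H₁(𝕋A, N) = Λ ⊗ N`, i.e. the push-forward
under `h` of the `N`-valued cycle `∑ e ⊗ slope e` is `C`. Rows of `C` are indexed by the
coordinates of `N` and columns by those of `Λ`. -/
def HasDegree (Γ : TropCurve S V E) (C : Matrix (Fin 2) (Fin 2) ℤ) : Prop :=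
  ∀ j, (Γ.homologyMap (Γ.slopeCycle j) : Fin 2 → ℝ) = S.mulVec (toReal (C j))

/-! ### Irreducible and simple curves -/

/-- `Γ` is connected and is not the union of two curves glued at one point. (If a point
disconnects `Γ`, it is a vertex, and by the balancing condition `Γ` is a union of tropical
curves that are attached to each other at this vertex only.) -/
def IsIrreducible (Γ : TropCurve S V E) : Prop :=
  ConnectedSpace Γ.Space ∧ ∀ x : Γ.Space, IsConnected ({x}ᶜ : Set Γ.Space)

/-- All the vertices are trivalent. -/
def IsTrivalent (Γ : TropCurve S V E) : Prop :=
  ∀ v, (Finset.univ.filter fun e => Γ.src e = v).card +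
    (Finset.univ.filter fun e => Γ.tgt e = v).card = 3

/-- `h` is an immersion, i.e. locally injective. -/
def IsImmersed (Γ : TropCurve S V E) : Prop :=
  ∀ x : Γ.Space, ∃ U ∈ 𝓝 x, InjOn Γ.map U

/-- Simple curves. -/
def IsSimple (Γ : TropCurve S V E) : Prop := Γ.IsTrivalent ∧ Γ.IsImmersed

/-! ### Theta functions and linear equivalence -/

/-- `Θ` is a convex piecewise affine function on `N_ℝ` with integer slopes whose corner locus,
with its weights, is the lift of the curve `Γ` to `N_ℝ`, and which is quasi-periodic.
At a point `x` of `N_ℝ` that does not lie over a vertex, the sum of the directional derivatives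
of `Θ` in the directions `v` and `-v` is the sum of `|det(w_e u_e, v)|` over the points of `Γ`
that lie over `x`, `w_e u_e` being the slope of `h` at that point. -/
structure IsThetaOf (Γ : TropCurve S V E) (Θ : (Fin 2 → ℝ) → ℝ) : Prop where
  convex : ConvexOn ℝ univ Θ
  piecewise_affine : ∀ x, ∃ F : Finset ((Fin 2 → ℤ) × ℝ), ∀ᶠ y in 𝓝 x,
    IsGreatest ((fun p : (Fin 2 → ℤ) × ℝ => dotProduct (toReal p.1) y + p.2) '' (F : Set _)) (Θ y)
  quasi_periodic : ∀ l ∈ periodLattice S, ∃ (m : Fin 2 → ℤ) (b : ℝ), ∀ x,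
    Θ (x + l) = Θ x + dotProduct (toReal m) x + b
  corner_locus : ∀ x, torusMk S x ∉ range Γ.pos → ∀ v, ∀ᶠ t in 𝓝[>] (0 : ℝ),
    Θ (x + t • v) + Θ (x - t • v) - 2 * Θ x =
      t * ∑ e, ({s : ℝ | s ∈ Ioo 0 (Γ.length e) ∧ Γ.edgeMap e s = torusMk S x}.ncard : ℝ) *
        |planeDet (toReal (Γ.slope e)) v|

/-- Linear equivalence `𝒪(Γ) = 𝒪(Γ₀)`: if `Θ` and `Θ₀` are theta functions of `Γ` and `Γ₀`, then
`f = Θ - Θ₀` satisfies `f (x + λ) = f x + K_λ` with `K ∈ Λ_ℝ^*`, and the class of `K` in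
`Λ_ℝ^* / M` is zero. -/
def LinearlyEquivalent {V₀ E₀ : Type} [Fintype V₀] [DecidableEq V₀] [Fintype E₀]
    (Γ : TropCurve S V E) (Γ₀ : TropCurve S V₀ E₀) : Prop :=
  ∃ Θ Θ₀ : (Fin 2 → ℝ) → ℝ, Γ.IsThetaOf Θ ∧ Γ₀.IsThetaOf Θ₀ ∧
    ∃ m : Fin 2 → ℤ, ∀ l ∈ periodLattice S, ∀ x,
      Θ (x + l) - Θ₀ (x + l) = Θ x - Θ₀ x + dotProduct (toReal m) l

/-! ### Rigidity -/

/-- `Γ` is rigid: it is isolated among the deformations of `Γ` (other lengths and other positions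
of the vertices, same graph and same slopes; these are all the small deformations of a simple
curve) that pass through `P` and are linearly equivalent to `Γ₀`. -/
def IsRigid {V₀ E₀ : Type} [Fintype V₀] [DecidableEq V₀] [Fintype E₀]
    (Γ : TropCurve S V E) (Γ₀ : TropCurve S V₀ E₀) {n : ℕ} (P : Fin n → TropTorus S) : Prop :=
  ∃ U ∈ 𝓝 (Γ.length, Γ.pos), ∀ Γ' : TropCurve S V E,
    Γ'.src = Γ.src → Γ'.tgt = Γ.tgt → Γ'.slope = Γ.slope → (Γ'.length, Γ'.pos) ∈ U →
    Γ'.PassesThrough P → Γ'.LinearlyEquivalent Γ₀ →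
    Γ'.length = Γ.length ∧ Γ'.pos = Γ.pos

end TropCurve

/-- A property of `n`-point configurations in `𝕋A` holds for generic configurations: it holds on a
dense open subset of `𝕋A^n` whose complement has measure zero (measured upstairs, in
`N_ℝ^n`). -/
def HoldsGenerically (S : Matrix (Fin 2) (Fin 2) ℝ) (n : ℕ)
    (Q : (Fin n → TropTorus S) → Prop) : Prop :=
  ∃ U : Set (Fin n → TropTorus S), IsOpen U ∧ Dense U ∧
    volume {p : Fin n → Fin 2 → ℝ | (fun i => torusMk S (p i)) ∉ U} = 0 ∧ ∀ P ∈ U, Q P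

/-! Put `n = g - 2`. After a choice of lifts of the vertices to the plane, every edge has a lattice
shift, and the class `C` is a bilinear expression in slopes and shifts. For fixed class and genus,
lifts with bounded vertices have bounded slopes, lengths and shifts and a bounded number of edges,
so only finitely many combinatorial types occur.

Integrating the second differences of a theta function along the two generating periods expresses
its quasi-periods through `C`, the moment `∑ det(p (src e), slope e) * shift e` and bounded integral
corrections. Comparison with the same formula for `Γ₀` shows that linear equivalence leaves only
finitely many moments (`exists_finite_moment`). The marked curves in question therefore lie in
bounded parts of finitely many affine spaces, whose directions are the deformations preserving
slopes and moment, and the marked points depend linearly on them. Whenever the directions do not map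
onto `(ℝ²)^n`, the image is compact and null. Off these images every marking is regular: its points
move independently in all directions (`holdsGenerically_isRegularMarking`).

The rest is linear algebra. For a variation `δ` of the vertices that keeps the edge directions, the
flux `e ↦ det(δ, slope e)` is a real cycle, by balancing. Regularity, together with translations
(which produce every change of moment because `det C ≠ 0`), shows that the map sending a cycle to
its values on the marked edges and its class in `Λ_ℝ` is onto `ℝ^n × ℝ²`. Cycles have dimension at
most `g = n + 2`, so this map is an isomorphism (`cycle_eq_zero`) and every cycle is a flux
(`exists_variation_eq`).

By irreducibility, two edges at a vertex `v` lie on a cycle that avoids the other edges at `v`. It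
is the flux of some `δ`, and `δ v` is parallel to all the other edges but not to these two. Hence
edges at a vertex are pairwise independent and four of them cannot meet, so the curve is simple. A
deformation that fixes marks and moment has zero flux and is trivial, which gives rigidity. The
isomorphism also makes the cycles avoiding the marks inject into `Λ`, with rank two. Finally, a cut
made of marked edges would impose a linear relation on the values of cycles there, so the complement
of the marks is connected. -/

section Lattice

/-! ### Plane determinants, the period lattice and the torus -/

theorem toReal_add (a b : Fin 2 → ℤ) : toReal (a + b) = toReal a + toReal b := by
  ext i; simp [toReal]

theorem toReal_sub (a b : Fin 2 → ℤ) : toReal (a - b) = toReal a - toReal b := by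
  ext i; simp [toReal]

theorem toReal_zero : toReal 0 = 0 := by
  ext i; simp [toReal]

theorem toReal_injective : Function.Injective toReal := by
  intro a b h
  ext i
  exact Int.cast_injective (α := ℝ) (congrFun h i)

theorem toReal_ne_zero {a : Fin 2 → ℤ} (h : a ≠ 0) : toReal a ≠ 0 := by
  rw [← toReal_zero]
  exact toReal_injective.ne h

theorem planeDet_add_left (a b c : Fin 2 → ℝ) :
    planeDet (a + b) c = planeDet a c + planeDet b c := by
  simp only [planeDet, Pi.add_apply]; ring

theorem planeDet_sub_left (a b c : Fin 2 → ℝ) :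
    planeDet (a - b) c = planeDet a c - planeDet b c := by
  simp only [planeDet, Pi.sub_apply]; ring

theorem planeDet_smul_left (r : ℝ) (a c : Fin 2 → ℝ) :
    planeDet (r • a) c = r * planeDet a c := by
  simp only [planeDet, Pi.smul_apply, smul_eq_mul]; ring

theorem planeDet_self (a : Fin 2 → ℝ) : planeDet a a = 0 := by
  simp only [planeDet]; ring

theorem planeDet_mulVec (A : Matrix (Fin 2) (Fin 2) ℝ) (x y : Fin 2 → ℝ) :
    planeDet (A.mulVec x) (A.mulVec y) = A.det * planeDet x y := by
  simp only [planeDet, Matrix.mulVec, dotProduct, Fin.sum_univ_two, Matrix.det_fin_two]; ring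

/-- Two vectors with vanishing determinant are proportional. -/
theorem exists_smul_of_planeDet_eq_zero {a b : Fin 2 → ℝ} (hb : b ≠ 0) (h : planeDet a b = 0) :
    ∃ r : ℝ, a = r • b := by
  have h' : a 0 * b 1 = a 1 * b 0 := by unfold planeDet at h; linarith
  by_cases h0 : b 0 = 0
  · have h1 : b 1 ≠ 0 := fun h1 => hb (by ext i; fin_cases i <;> simp [h0, h1])
    refine ⟨a 1 / b 1, ?_⟩
    have ha : a 0 = 0 := by
      rw [h0, mul_zero] at h'
      exact (mul_eq_zero.1 h').resolve_right h1
    ext i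
    fin_cases i
    · simp [h0, ha]
    · simp [h1]
  · refine ⟨a 0 / b 0, ?_⟩
    ext i
    fin_cases i
    · simp [h0]
    · simp only [Fin.mk_one, Pi.smul_apply, smul_eq_mul]
      field_simp
      linarith

theorem eq_zero_of_planeDet_eq_zero {x a b : Fin 2 → ℝ} (hab : planeDet a b ≠ 0)
    (ha : planeDet x a = 0) (hb : planeDet x b = 0) : x = 0 := by
  unfold planeDet at *
  have h0 : x 0 * (a 0 * b 1 - a 1 * b 0) = 0 := by linear_combination (a 0) * hb - (b 0) * ha
  have h1 : x 1 * (a 0 * b 1 - a 1 * b 0) = 0 := by linear_combination (a 1) * hb - (b 1) * ha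
  ext i
  fin_cases i
  · exact (mul_eq_zero.1 h0).resolve_right hab
  · exact (mul_eq_zero.1 h1).resolve_right hab

variable {S : Matrix (Fin 2) (Fin 2) ℝ}

theorem mulVec_inv_mulVec (hS : S.det ≠ 0) (x : Fin 2 → ℝ) :
    S.mulVec (S⁻¹.mulVec x) = x := by
  rw [Matrix.mulVec_mulVec, Matrix.mul_nonsing_inv _ (isUnit_iff_ne_zero.2 hS), Matrix.one_mulVec]

theorem inv_mulVec_mulVec (hS : S.det ≠ 0) (x : Fin 2 → ℝ) :
    S⁻¹.mulVec (S.mulVec x) = x := by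
  rw [Matrix.mulVec_mulVec, Matrix.nonsing_inv_mul _ (isUnit_iff_ne_zero.2 hS), Matrix.one_mulVec]

theorem exists_norm_mulVec_le (A : Matrix (Fin 2) (Fin 2) ℝ) :
    ∃ K > 0, ∀ x : Fin 2 → ℝ, ‖A.mulVec x‖ ≤ K * ‖x‖ := by
  let f := LinearMap.toContinuousLinearMap A.mulVecLin
  refine ⟨‖f‖ + 1, by positivity, fun x => ?_⟩
  calc ‖A.mulVec x‖ = ‖f x‖ := rfl
    _ ≤ ‖f‖ * ‖x‖ := f.le_opNorm x
    _ ≤ (‖f‖ + 1) * ‖x‖ := by gcongr; linarith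

theorem exists_abs_le_of_norm_mulVec_le (hS : S.det ≠ 0) (R : ℝ) :
    ∃ M : ℤ, ∀ z : Fin 2 → ℤ, ‖S.mulVec (toReal z)‖ ≤ R → ∀ i, |z i| ≤ M := by
  obtain ⟨K, hK, h⟩ := exists_norm_mulVec_le S⁻¹
  refine ⟨⌈K * R⌉, fun z hz i => ?_⟩
  have h1 := h (S.mulVec (toReal z))
  rw [inv_mulVec_mulVec hS] at h1
  have h2 : |(z i : ℝ)| ≤ K * R := calc
    |(z i : ℝ)| = ‖toReal z i‖ := rfl
    _ ≤ ‖toReal z‖ := norm_le_pi_norm _ i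
    _ ≤ K * ‖S.mulVec (toReal z)‖ := h1
    _ ≤ K * R := by gcongr
  have h3 : |(z i : ℝ)| ≤ ⌈K * R⌉ := h2.trans (Int.le_ceil _)
  exact_mod_cast h3

theorem exists_lattice_gap (hS : S.det ≠ 0) :
    ∃ ρ > 0, ∀ z : Fin 2 → ℤ, ‖S.mulVec (toReal z)‖ < ρ → z = 0 := by
  obtain ⟨K, hK, h⟩ := exists_norm_mulVec_le S⁻¹
  refine ⟨1 / K, by positivity, fun z hz => ?_⟩
  have h1 := h (S.mulVec (toReal z))
  rw [inv_mulVec_mulVec hS] at h1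
  ext i
  have h2 : |(z i : ℝ)| < 1 := calc
    |(z i : ℝ)| = ‖toReal z i‖ := rfl
    _ ≤ ‖toReal z‖ := norm_le_pi_norm _ i
    _ ≤ K * ‖S.mulVec (toReal z)‖ := h1
    _ < K * (1 / K) := by gcongr
    _ = 1 := by field_simp
  have h3 : |z i| < 1 := by exact_mod_cast h2
  exact Int.abs_lt_one_iff.1 h3

theorem torusMk_eq_iff {x y : Fin 2 → ℝ} :
    torusMk S x = torusMk S y ↔ ∃ l : Fin 2 → ℤ, x = y + S.mulVec (toReal l) := by
  rw [eq_comm]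
  unfold torusMk
  rw [QuotientAddGroup.eq]
  refine exists_congr fun l => ?_
  constructor
  · intro h; rw [h]; abel
  · intro h; rw [h]; abel

theorem torusMk_add (x y : Fin 2 → ℝ) : torusMk S (x + y) = torusMk S x + torusMk S y := rfl

theorem torusMk_surjective : Function.Surjective (torusMk S) := QuotientAddGroup.mk_surjective

theorem continuous_torusMk : Continuous (torusMk S) := continuous_quotient_mk'

theorem isOpenQuotientMap_torusMk : IsOpenQuotientMap (torusMk S) :=
  QuotientAddGroup.isOpenQuotientMap_mk

theorem exists_lift_norm_le (hS : S.det ≠ 0) :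
    ∃ K > 0, ∀ y : TropTorus S, ∃ x, torusMk S x = y ∧ ‖x‖ ≤ K := by
  obtain ⟨K, hK, h⟩ := exists_norm_mulVec_le S
  refine ⟨K, hK, fun y => ?_⟩
  obtain ⟨x, rfl⟩ := torusMk_surjective y
  let z : Fin 2 → ℤ := fun i => ⌊S⁻¹.mulVec x i⌋
  refine ⟨S.mulVec (fun i => Int.fract (S⁻¹.mulVec x i)), ?_, ?_⟩
  · symm
    rw [torusMk_eq_iff]
    refine ⟨z, ?_⟩
    rw [← Matrix.mulVec_add]
    conv_lhs => rw [← mulVec_inv_mulVec hS x]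
    congr 1
    ext i
    simp [z, toReal, Int.fract_add_floor]
  · refine (h _).trans (mul_le_of_le_one_right hK.le ?_)
    rw [pi_norm_le_iff_of_nonneg zero_le_one]
    intro i
    rw [Real.norm_eq_abs, abs_of_nonneg (Int.fract_nonneg _)]
    exact (Int.fract_lt_one _).le

end Lattice

/-! ### Chains and cycles on a directed graph -/

section Boundary

variable {V E : Type} [DecidableEq V] [Fintype E]

/-- The boundary of a chain on a directed graph, with the sign that counts the outgoing edges
positively. -/
def graphBoundary (R : Type) [CommRing R] (src tgt : E → V) : (E → R) →ₗ[R] (V → R) where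
  toFun c v := (∑ e, if src e = v then c e else 0) - (∑ e, if tgt e = v then c e else 0)
  map_add' a b := by
    ext v
    simp only [Pi.add_apply, ← Finset.sum_filter, Finset.sum_add_distrib]
    ring
  map_smul' r a := by
    ext v
    simp only [Pi.smul_apply, smul_eq_mul, RingHom.id_apply, mul_sub, Finset.mul_sum, mul_ite,
      mul_zero]

theorem graphBoundary_apply (R : Type) [CommRing R] (src tgt : E → V) (c : E → R) (v : V) :
    graphBoundary R src tgt c v =
      (∑ e, if src e = v then c e else 0) - (∑ e, if tgt e = v then c e else 0) := rfl

/-- Summation by parts. Against a cycle, every function of the vertices cancels; positions, floors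
and indicators of vertex sets are used in this role below. -/
theorem sum_graphBoundary_smul [Fintype V] {R : Type} [CommRing R] {M : Type} [AddCommGroup M]
    [Module R M] (src tgt : E → V) (c : E → R) (f : V → M) :
    ∑ v, graphBoundary R src tgt c v • f v = ∑ e, c e • (f (src e) - f (tgt e)) := by
  have e1 : ∀ k : E → V, ∑ v, (∑ e, if k e = v then c e else 0) • f v = ∑ e, c e • f (k e) := by
    intro k
    simp_rw [Finset.sum_smul]
    rw [Finset.sum_comm]
    refine Finset.sum_congr rfl fun e _ => ?_
    simp [ite_smul]
  simp_rw [graphBoundary_apply, sub_smul, smul_sub]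
  rw [Finset.sum_sub_distrib, Finset.sum_sub_distrib, e1, e1]

theorem graphBoundary_single [DecidableEq E] {R : Type} [CommRing R] (src tgt : E → V) (e : E) :
    graphBoundary R src tgt (Pi.single e 1) = Pi.single (src e) 1 - Pi.single (tgt e) 1 := by
  ext v
  rw [graphBoundary_apply, Pi.sub_apply]
  congr 1
  · rw [Finset.sum_eq_single e]
    · simp [Pi.single_apply, eq_comm]
    · intro b _ hb; simp [hb]
    · simp
  · rw [Finset.sum_eq_single e]
    · simp [Pi.single_apply, eq_comm]
    · intro b _ hb; simp [hb]
    · simp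

theorem sum_cycle_smul [Fintype V] {R : Type} [CommRing R] {M : Type} [AddCommGroup M]
    [Module R M] {src tgt : E → V} {c : E → R} (hc : graphBoundary R src tgt c = 0) (f : V → M) :
    ∑ e, c e • f (src e) = ∑ e, c e • f (tgt e) := by
  have h := sum_graphBoundary_smul src tgt c f
  rw [hc] at h
  simp only [Pi.zero_apply, zero_smul, Finset.sum_const_zero, smul_sub,
    Finset.sum_sub_distrib] at h
  exact (sub_eq_zero.1 h.symm)

theorem graphBoundary_intCast {src tgt : E → V} (c : E → ℤ) :
    graphBoundary ℝ src tgt (fun e => (c e : ℝ)) =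
      fun v => ((graphBoundary ℤ src tgt c v : ℤ) : ℝ) := by
  ext v
  simp [graphBoundary_apply]

end Boundary

/-! ### Lifts of a curve; bounds on lengths and slopes -/

namespace TropCurve

variable {S : Matrix (Fin 2) (Fin 2) ℝ} {V E : Type} [Fintype V] [DecidableEq V] [Fintype E]

theorem mem_H1_iff {Γ : TropCurve S V E} {c : E → ℤ} :
    c ∈ Γ.H1 ↔ graphBoundary ℤ Γ.src Γ.tgt c = 0 :=
  ⟨fun h => funext h, fun h v => congrFun h v⟩

theorem graphBoundary_slope (Γ : TropCurve S V E) (j : Fin 2) :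
    graphBoundary ℝ Γ.src Γ.tgt (fun e => (Γ.slope e j : ℝ)) = 0 := by
  rw [graphBoundary_intCast, show graphBoundary ℤ Γ.src Γ.tgt (fun e => Γ.slope e j) = 0 from
    mem_H1_iff.1 (Γ.slopeCycle j).2]
  ext v
  simp

/-- A choice of lifts to `N_ℝ` of the images of the vertices; `shift e` is then the lattice vector
that separates the end point of the lift of the edge `e` from the lift of its target. -/
structure Lift (Γ : TropCurve S V E) where
  pos : V → Fin 2 → ℝ
  shift : E → Fin 2 → ℤ
  torusMk_pos : ∀ v, torusMk S (pos v) = Γ.pos v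
  pos_src_add : ∀ e, pos (Γ.src e) + Γ.length e • toReal (Γ.slope e) =
    pos (Γ.tgt e) + S.mulVec (toReal (shift e))

theorem exists_lift_of_pos (Γ : TropCurve S V E) (p : V → Fin 2 → ℝ)
    (hp : ∀ v, torusMk S (p v) = Γ.pos v) : ∃ L : Γ.Lift, L.pos = p := by
  have h : ∀ e, ∃ l : Fin 2 → ℤ, p (Γ.src e) + Γ.length e • toReal (Γ.slope e) =
      p (Γ.tgt e) + S.mulVec (toReal l) := by
    intro e
    rw [← torusMk_eq_iff, torusMk_add, hp, hp, Γ.pos_tgt]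
  choose a ha using h
  exact ⟨⟨p, a, hp, ha⟩, rfl⟩

theorem exists_bounded_lift (hS : S.det ≠ 0) :
    ∃ K > 0, ∀ {V E : Type} [Fintype V] [DecidableEq V] [Fintype E] (Γ : TropCurve S V E),
      ∃ L : Γ.Lift, ∀ v, ‖L.pos v‖ ≤ K := by
  obtain ⟨K, hK, h⟩ := exists_lift_norm_le hS
  refine ⟨K, hK, fun Γ => ?_⟩
  choose p hp hpK using fun v => h (Γ.pos v)
  obtain ⟨L, rfl⟩ := Γ.exists_lift_of_pos p hp
  exact ⟨L, hpK⟩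

/-- The differences of vertex positions cancel along a cycle, so homology classes are computed by
the shifts alone. -/
theorem Lift.sum_displacement {Γ : TropCurve S V E} (L : Γ.Lift) {c : E → ℝ}
    (hc : graphBoundary ℝ Γ.src Γ.tgt c = 0) :
    ∑ e, c e • (Γ.length e • toReal (Γ.slope e)) =
      S.mulVec (∑ e, c e • toReal (L.shift e)) := by
  have h1 : ∀ e, Γ.length e • toReal (Γ.slope e) =
      L.pos (Γ.tgt e) - L.pos (Γ.src e) + S.mulVec (toReal (L.shift e)) := by
    intro e
    have := L.pos_src_add e
    rw [sub_add_eq_add_sub, ← this]; abel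
  have h2 : S.mulVec (∑ e, c e • toReal (L.shift e)) =
      ∑ e, c e • S.mulVec (toReal (L.shift e)) := by
    change S.mulVecLin _ = _
    rw [map_sum]
    exact Finset.sum_congr rfl fun e _ => map_smul S.mulVecLin _ _
  simp_rw [h1, smul_add, smul_sub]
  rw [Finset.sum_add_distrib, Finset.sum_sub_distrib, sum_cycle_smul hc L.pos, sub_self, zero_add,
    h2]

theorem Lift.sum_slope_mul_shift {Γ : TropCurve S V E} (L : Γ.Lift) (hS : S.det ≠ 0)
    {C : Matrix (Fin 2) (Fin 2) ℤ} (hC : Γ.HasDegree C) (j i : Fin 2) :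
    ∑ e, (Γ.slope e j : ℝ) * L.shift e i = C j i := by
  have h1 := hC j
  have h2 := L.sum_displacement (Γ.graphBoundary_slope j)
  have h3 : (Γ.homologyMap (Γ.slopeCycle j) : Fin 2 → ℝ) =
    ∑ e, (Γ.slope e j : ℝ) • (Γ.length e • toReal (Γ.slope e)) := rfl
  rw [← h3, h1] at h2
  have h4 := congrArg (S⁻¹.mulVec) h2
  rw [inv_mulVec_mulVec hS, inv_mulVec_mulVec hS] at h4
  have h5 := congrFun h4 i
  simp only [toReal, Finset.sum_apply, Pi.smul_apply, smul_eq_mul] at h5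
  exact h5.symm

/-- The right-hand side is the sum over all edges of length times squared Euclidean norm of the
slope. All terms are nonnegative, and a nonzero integral slope has squared norm at least `1`. -/
theorem length_le (Γ : TropCurve S V E)
    {C : Matrix (Fin 2) (Fin 2) ℤ} (hC : Γ.HasDegree C) (e : E) :
    Γ.length e ≤ ∑ j, S.mulVec (toReal (C j)) j := by
  have h3 : ∀ j, S.mulVec (toReal (C j)) j =
      ∑ e, (Γ.slope e j : ℝ) * (Γ.length e * Γ.slope e j) := by
    intro j
    rw [← hC j]
    change (∑ e, (Γ.slope e j : ℝ) • (Γ.length e • toReal (Γ.slope e))) j = _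
    simp [toReal]
  simp_rw [h3]
  rw [Finset.sum_comm]
  have h4 : ∀ f ∈ Finset.univ, 0 ≤ ∑ j, (Γ.slope f j : ℝ) * (Γ.length f * Γ.slope f j) := by
    intro f _
    refine Finset.sum_nonneg fun j _ => ?_
    nlinarith [mul_nonneg (Γ.length_pos f).le (mul_self_nonneg (Γ.slope f j : ℝ))]
  refine le_trans ?_ (Finset.single_le_sum h4 (Finset.mem_univ e))
  have h5 : (1 : ℝ) ≤ ∑ j, (Γ.slope e j : ℝ) * Γ.slope e j := by
    have h6 : (1 : ℤ) ≤ ∑ j, Γ.slope e j * Γ.slope e j := by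
      obtain ⟨j, hj⟩ := Function.ne_iff.1 (Γ.slope_ne e)
      have : 0 < Γ.slope e j * Γ.slope e j := mul_self_pos.2 hj
      exact this.trans_le (Finset.single_le_sum (f := fun j => Γ.slope e j * Γ.slope e j)
        (fun k _ => mul_self_nonneg (Γ.slope e k)) (Finset.mem_univ j))
    exact_mod_cast h6
  calc Γ.length e = Γ.length e * 1 := (mul_one _).symm
    _ ≤ Γ.length e * ∑ j, (Γ.slope e j : ℝ) * Γ.slope e j := by
      gcongr; exact (Γ.length_pos e).le
    _ = _ := by rw [Finset.mul_sum]; exact Finset.sum_congr rfl fun j _ => by ring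

/-- The slope of an edge, in the basis of `N_ℝ` given by the columns of `S`. -/
noncomputable def coordSlope (Γ : TropCurve S V E) (e : E) : Fin 2 → ℝ :=
  S⁻¹.mulVec (toReal (Γ.slope e))

/-- The lifts of the vertices, in the basis of `N_ℝ` given by the columns of `S`. -/
noncomputable def Lift.coord {Γ : TropCurve S V E} (L : Γ.Lift) (v : V) : Fin 2 → ℝ :=
  S⁻¹.mulVec (L.pos v)

theorem Lift.coord_src_add {Γ : TropCurve S V E} (L : Γ.Lift) (hS : S.det ≠ 0) (e : E)
    (i : Fin 2) : L.coord (Γ.src e) i + Γ.length e * Γ.coordSlope e i =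
      L.coord (Γ.tgt e) i + L.shift e i := by
  have h := congrArg S⁻¹.mulVec (L.pos_src_add e)
  rw [Matrix.mulVec_add, Matrix.mulVec_add, inv_mulVec_mulVec hS, Matrix.mulVec_smul] at h
  exact congrFun h i

/-- The number of times that the lift of an edge crosses the lines `x j ∈ ξ + ℤ`, counted with
sign. -/
noncomputable def Lift.crossing {Γ : TropCurve S V E} (L : Γ.Lift) (j : Fin 2) (ξ : ℝ) (e : E) :
    ℤ :=
  ⌊L.coord (Γ.src e) j + Γ.length e * Γ.coordSlope e j - ξ⌋ - ⌊L.coord (Γ.src e) j - ξ⌋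

/-- Crossing numbers and shifts differ by the coboundary of the floors at the vertices, so both give
the intersection number of a cycle with a coordinate line, whatever the line. -/
theorem Lift.sum_mul_crossing {Γ : TropCurve S V E} (L : Γ.Lift) (hS : S.det ≠ 0) (j : Fin 2)
    (ξ : ℝ) {c : E → ℝ} (hc : graphBoundary ℝ Γ.src Γ.tgt c = 0) :
    ∑ e, c e * L.crossing j ξ e = ∑ e, c e * L.shift e j := by
  have h1 : ∀ e, L.crossing j ξ e =
      ⌊L.coord (Γ.tgt e) j - ξ⌋ + L.shift e j - ⌊L.coord (Γ.src e) j - ξ⌋ := by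
    intro e
    rw [Lift.crossing, L.coord_src_add hS, add_sub_right_comm, Int.floor_add_intCast]
  have h2 := sum_cycle_smul hc fun v => (⌊L.coord v j - ξ⌋ : ℝ)
  simp only [smul_eq_mul] at h2
  simp_rw [h1]
  push_cast
  simp_rw [mul_sub, mul_add]
  rw [Finset.sum_sub_distrib, Finset.sum_add_distrib, h2]
  ring

/-- The class `C` in the basis of `N_ℝ` given by the columns of `S`. -/
noncomputable def coordDegree (S : Matrix (Fin 2) (Fin 2) ℝ) (C : Matrix (Fin 2) (Fin 2) ℤ)
    (i j : Fin 2) : ℝ := ∑ k, S⁻¹ i k * C k j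

theorem coordSlope_apply (Γ : TropCurve S V E) (e : E) (i : Fin 2) :
    Γ.coordSlope e i = ∑ k, S⁻¹ i k * Γ.slope e k := rfl

theorem graphBoundary_coordSlope (Γ : TropCurve S V E) (i : Fin 2) :
    graphBoundary ℝ Γ.src Γ.tgt (fun e => Γ.coordSlope e i) = 0 := by
  have : (fun e => Γ.coordSlope e i) = ∑ k, S⁻¹ i k • fun e => (Γ.slope e k : ℝ) := by
    ext e
    simp [coordSlope_apply]
  rw [this, map_sum]
  refine Finset.sum_eq_zero fun k _ => ?_
  rw [map_smul, graphBoundary_slope, smul_zero]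

theorem Lift.sum_coordSlope_mul_shift {Γ : TropCurve S V E} (L : Γ.Lift) (hS : S.det ≠ 0)
    {C : Matrix (Fin 2) (Fin 2) ℤ} (hC : Γ.HasDegree C) (i j : Fin 2) :
    ∑ e, Γ.coordSlope e i * L.shift e j = coordDegree S C i j := by
  simp_rw [coordSlope_apply, Finset.sum_mul]
  rw [Finset.sum_comm]
  refine Finset.sum_congr rfl fun k _ => ?_
  rw [← L.sum_slope_mul_shift hS hC k j, Finset.mul_sum]
  exact Finset.sum_congr rfl fun e _ => mul_assoc _ _ _

theorem Lift.coordSlope_mul_crossing_nonneg {Γ : TropCurve S V E} (L : Γ.Lift) (j : Fin 2) (ξ : ℝ)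
    (e : E) : 0 ≤ Γ.coordSlope e j * L.crossing j ξ e := by
  rcases le_total 0 (Γ.coordSlope e j) with h | h
  · refine mul_nonneg h ?_
    have : ⌊L.coord (Γ.src e) j - ξ⌋ ≤
        ⌊L.coord (Γ.src e) j + Γ.length e * Γ.coordSlope e j - ξ⌋ :=
      Int.floor_mono (by nlinarith [mul_nonneg (Γ.length_pos e).le h])
    exact_mod_cast sub_nonneg.2 this
  · refine mul_nonneg_of_nonpos_of_nonpos h ?_
    have : ⌊L.coord (Γ.src e) j + Γ.length e * Γ.coordSlope e j - ξ⌋ ≤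
        ⌊L.coord (Γ.src e) j - ξ⌋ :=
      Int.floor_mono (by nlinarith [mul_nonneg (Γ.length_pos e).le (neg_nonneg.2 h)])
    exact_mod_cast sub_nonpos.2 this

/-- All the crossings with a line count positively once weighted by the slope, so a single edge
contributes at most the total, which depends only on `C`. -/
theorem Lift.coordSlope_mul_crossing_le {Γ : TropCurve S V E} (L : Γ.Lift) (hS : S.det ≠ 0)
    {C : Matrix (Fin 2) (Fin 2) ℤ} (hC : Γ.HasDegree C) (j : Fin 2) (ξ : ℝ) (e : E) :
    Γ.coordSlope e j * L.crossing j ξ e ≤ coordDegree S C j j := by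
  rw [← L.sum_coordSlope_mul_shift hS hC, ← L.sum_mul_crossing hS j ξ
    (Γ.graphBoundary_coordSlope j)]
  exact Finset.single_le_sum (f := fun e => Γ.coordSlope e j * L.crossing j ξ e)
    (fun f _ => L.coordSlope_mul_crossing_nonneg j ξ f) (Finset.mem_univ e)

/-- A line through an end of the edge is used: the source when the slope is negative, the target
when it is positive. With the half-open convention of the floor, the edge then crosses the line at
least once. -/
theorem abs_coordSlope_le (Γ : TropCurve S V E) (hS : S.det ≠ 0)
    {C : Matrix (Fin 2) (Fin 2) ℤ} (hC : Γ.HasDegree C) (j : Fin 2) (e : E) :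
    |Γ.coordSlope e j| ≤ coordDegree S C j j := by
  obtain ⟨_, _, h⟩ := exists_bounded_lift hS
  obtain ⟨L, -⟩ := h Γ
  have hl := Γ.length_pos e
  rcases lt_trichotomy (Γ.coordSlope e j) 0 with h | h | h
  · have h1 := L.coordSlope_mul_crossing_le hS hC j (L.coord (Γ.src e) j) e
    have h2 : L.crossing j (L.coord (Γ.src e) j) e ≤ -1 := by
      rw [Lift.crossing, sub_self, Int.floor_zero, sub_zero]
      have : ⌊L.coord (Γ.src e) j + Γ.length e * Γ.coordSlope e j - L.coord (Γ.src e) j⌋ < 0 := by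
        rw [Int.floor_lt]; push_cast; nlinarith [mul_pos hl (neg_pos.2 h)]
      omega
    have h3 : (L.crossing j (L.coord (Γ.src e) j) e : ℝ) ≤ -1 := by exact_mod_cast h2
    rw [abs_of_neg h]
    nlinarith
  · have h1 := L.coordSlope_mul_crossing_le hS hC j 0 e
    rw [h, zero_mul] at h1
    rwa [h, abs_zero]
  · set ξ := L.coord (Γ.src e) j + Γ.length e * Γ.coordSlope e j with hξ
    have h1 := L.coordSlope_mul_crossing_le hS hC j ξ e
    have h2 : 1 ≤ L.crossing j ξ e := by
      rw [Lift.crossing, ← hξ, sub_self, Int.floor_zero]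
      have : ⌊L.coord (Γ.src e) j - ξ⌋ < 0 := by
        rw [Int.floor_lt]; push_cast; nlinarith [mul_pos hl h]
      omega
    have h3 : (1 : ℝ) ≤ L.crossing j ξ e := by exact_mod_cast h2
    rw [abs_of_pos h]
    nlinarith

theorem exists_slope_bound (hS : S.det ≠ 0) (C : Matrix (Fin 2) (Fin 2) ℤ) :
    ∃ B : ℤ, ∀ {V E : Type} [Fintype V] [DecidableEq V] [Fintype E] (Γ : TropCurve S V E),
      Γ.HasDegree C → ∀ e i, |Γ.slope e i| ≤ B := by
  obtain ⟨K, hK, h⟩ := exists_norm_mulVec_le S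
  set D : ℝ := ∑ j, |coordDegree S C j j| with hD
  have hD0 : 0 ≤ D := Finset.sum_nonneg fun _ _ => abs_nonneg _
  refine ⟨⌈K * D⌉, fun Γ hC e i => ?_⟩
  have h1 : ‖Γ.coordSlope e‖ ≤ D := by
    rw [pi_norm_le_iff_of_nonneg hD0]
    intro j
    rw [Real.norm_eq_abs]
    refine (Γ.abs_coordSlope_le hS hC j e).trans ((le_abs_self _).trans ?_)
    exact Finset.single_le_sum (f := fun j => |coordDegree S C j j|)
      (fun _ _ => abs_nonneg _) (Finset.mem_univ j)
  have h2 : |(Γ.slope e i : ℝ)| ≤ K * D := calc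
    |(Γ.slope e i : ℝ)| = ‖toReal (Γ.slope e) i‖ := rfl
    _ ≤ ‖toReal (Γ.slope e)‖ := norm_le_pi_norm _ i
    _ = ‖S.mulVec (Γ.coordSlope e)‖ := by rw [coordSlope, mulVec_inv_mulVec hS]
    _ ≤ K * ‖Γ.coordSlope e‖ := h _
    _ ≤ K * D := by gcongr
  have h3 := h2.trans (Int.le_ceil _)
  exact_mod_cast h3

end TropCurve

/-! ### Recovering a piecewise affine function of one variable from its corners -/

theorem eventually_second_difference_posPart (t x : ℝ) :
    ∀ᶠ s in 𝓝[>] (0 : ℝ), max (x + s - t) 0 + max (x - s - t) 0 - 2 * max (x - t) 0 =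
      s * if t = x then 1 else 0 := by
  have hpos : ∀ᶠ s in 𝓝[>] (0 : ℝ), 0 < s := eventually_mem_nhdsWithin
  rcases lt_trichotomy t x with h | h | h
  · have h2 : ∀ᶠ s in 𝓝[>] (0 : ℝ), s < x - t :=
      mem_nhdsWithin_of_mem_nhds (Iio_mem_nhds (sub_pos.2 h))
    filter_upwards [hpos, h2] with s h0 h1
    rw [max_eq_left (by linarith), max_eq_left (by linarith), max_eq_left (by linarith),
      if_neg h.ne]
    ring
  · filter_upwards [hpos] with s h0
    rw [max_eq_left (by linarith), max_eq_right (by linarith), max_eq_left (by linarith),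
      if_pos h, h]
    ring
  · have h2 : ∀ᶠ s in 𝓝[>] (0 : ℝ), s < t - x :=
      mem_nhdsWithin_of_mem_nhds (Iio_mem_nhds (sub_pos.2 h))
    filter_upwards [hpos, h2] with s h0 h1
    rw [max_eq_right (by linarith), max_eq_right (by linarith), max_eq_right (by linarith),
      if_neg h.ne']
    ring

/-- A continuous function that vanishes to the right of `0` and all of whose symmetric second
differences vanish locally is zero. -/
theorem eq_zero_of_second_difference {f : ℝ → ℝ} (hf : Continuous f) (h00 : f 0 = 0)
    (h0 : ∀ᶠ s in 𝓝[>] (0 : ℝ), f s = 0)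
    (h : ∀ x ∈ Ioo (0 : ℝ) 1, ∀ᶠ s in 𝓝[>] (0 : ℝ), f (x + s) + f (x - s) - 2 * f x = 0) :
    f 1 = 0 := by
  have key : Icc (0 : ℝ) 1 ⊆ {x | f x = 0} := by
    refine IsClosed.Icc_subset_of_forall_mem_nhdsGT_of_Icc_subset ?_ h00 ?_
    · exact (isClosed_eq hf continuous_const).inter isClosed_Icc
    · intro x hx hsub
      rcases hx.1.eq_or_lt with rfl | hx0
      · exact h0
      · have h1 := h x ⟨hx0, hx.2⟩
        have h2 : ∀ᶠ s in 𝓝[>] (0 : ℝ), s < x := mem_nhdsWithin_of_mem_nhds (Iio_mem_nhds hx0)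
        have hpos : ∀ᶠ s in 𝓝[>] (0 : ℝ), 0 < s := eventually_mem_nhdsWithin
        -- Reflection at `x`: the vanishing second difference carries zeros from the left of `x` to
        -- the right.
        have h3 : ∀ᶠ s in 𝓝[>] (0 : ℝ), f (x + s) = 0 := by
          filter_upwards [h1, h2, hpos] with s h1 h2 h3
          have e1 : f (x - s) = 0 := hsub ⟨by linarith, by linarith⟩
          have e2 : f x = 0 := hsub ⟨by linarith, le_rfl⟩
          rw [e1, e2] at h1
          linarith
        have h4 : Tendsto (fun y => y - x) (𝓝[>] x) (𝓝[>] 0) := by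
          refine tendsto_nhdsWithin_iff.2 ⟨?_, ?_⟩
          · have : Tendsto (fun y : ℝ => y - x) (𝓝 x) (𝓝 (x - x)) :=
              (continuous_id.sub continuous_const).tendsto x
            rw [sub_self] at this
            exact this.mono_left nhdsWithin_le_nhds
          · filter_upwards [self_mem_nhdsWithin] with y hy
            exact sub_pos.2 (mem_Ioi.1 hy)
        filter_upwards [h4.eventually h3] with y hy
        simpa using hy
  exact key ⟨zero_le_one, le_rfl⟩

/-- Subtracting the initial affine function and the functions `w i * max (x - t i) 0` removes all
the corners, which reduces the claim to `eq_zero_of_second_difference`. -/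
theorem eq_add_sum_of_second_difference {g : ℝ → ℝ} (hg : Continuous g) {ι : Type} [Fintype ι]
    (w t : ι → ℝ) (ht : ∀ i, 0 < t i ∧ t i < 1) (d : ℝ)
    (h0 : ∀ᶠ s in 𝓝[>] (0 : ℝ), g s = g 0 + s * d)
    (h : ∀ x ∈ Ioo (0 : ℝ) 1, ∀ᶠ s in 𝓝[>] (0 : ℝ),
      g (x + s) + g (x - s) - 2 * g x = s * ∑ i, if t i = x then w i else 0) :
    g 1 = g 0 + d + ∑ i, w i * (1 - t i) := by
  have key := eq_zero_of_second_difference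
    (f := fun x => g x - g 0 - x * d - ∑ i, w i * max (x - t i) 0) (by fun_prop) ?_ ?_ ?_
  · have h1 : ∀ i, max (1 - t i) 0 = 1 - t i := fun i => max_eq_left (by linarith [(ht i).2])
    simp only [h1] at key
    linarith
  · have h1 : ∀ i, max (0 - t i) 0 = 0 := fun i => max_eq_right (by linarith [(ht i).1])
    simp only [h1, mul_zero, Finset.sum_const_zero, zero_mul, sub_self]
  · have h1 : ∀ᶠ s in 𝓝[>] (0 : ℝ), ∀ i, s < t i :=
      eventually_all.2 fun i => mem_nhdsWithin_of_mem_nhds (Iio_mem_nhds (ht i).1)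
    filter_upwards [h0, h1] with s h0 h1
    have h2 : ∀ i, max (s - t i) 0 = 0 := fun i => max_eq_right (by linarith [h1 i])
    simp [h2, h0]
  · intro x hx
    have h1 := eventually_all.2 fun i => eventually_second_difference_posPart (t i) x
    filter_upwards [h x hx, h1] with s h2 h3
    have h4 : ∑ i, w i * max (x + s - t i) 0 + ∑ i, w i * max (x - s - t i) 0 -
        2 * ∑ i, w i * max (x - t i) 0 = s * ∑ i, if t i = x then w i else 0 := by
      rw [Finset.mul_sum, Finset.mul_sum, ← Finset.sum_add_distrib, ← Finset.sum_sub_distrib]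
      refine Finset.sum_congr rfl fun i _ => ?_
      have := h3 i
      split_ifs at this ⊢ <;> linear_combination w i * this
    linear_combination h2 - h4

/-! ### Theta functions along a period -/

namespace TropCurve

variable {S : Matrix (Fin 2) (Fin 2) ℝ} {V E : Type} [Fintype V] [DecidableEq V] [Fintype E]

theorem Lift.edgeMap_eq_iff {Γ : TropCurve S V E} (L : Γ.Lift) (hS : S.det ≠ 0) (e : E) (a : ℝ)
    (y : Fin 2 → ℝ) : Γ.edgeMap e a = torusMk S (S.mulVec y) ↔
      ∃ z : Fin 2 → ℤ, ∀ i, L.coord (Γ.src e) i + a * Γ.coordSlope e i = y i + z i := by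
  rw [edgeMap, ← L.torusMk_pos, ← torusMk_add, torusMk_eq_iff]
  refine exists_congr fun z => ?_
  have : L.pos (Γ.src e) + a • toReal (Γ.slope e) =
      S.mulVec (L.coord (Γ.src e) + a • Γ.coordSlope e) := by
    rw [Matrix.mulVec_add, Matrix.mulVec_smul, coord, coordSlope, mulVec_inv_mulVec hS,
      mulVec_inv_mulVec hS]
  rw [this, ← Matrix.mulVec_add]
  constructor
  · intro h i
    have h1 := congrArg S⁻¹.mulVec h
    rw [inv_mulVec_mulVec hS, inv_mulVec_mulVec hS] at h1
    exact congrFun h1 i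
  · intro h
    congr 1
    exact funext h

/-- The point `S ξ` is not on the curve, and the lines through it in the directions of the columns
of `S` do not meet the vertices. -/
structure Lift.IsGeneric {Γ : TropCurve S V E} (L : Γ.Lift) (ξ : Fin 2 → ℝ) : Prop where
  coord_sub_ne : ∀ v i (k : ℤ), L.coord v i - ξ i ≠ k
  edgeMap_ne : ∀ e, ∀ a, Γ.edgeMap e a ≠ torusMk S (S.mulVec ξ)

theorem Lift.exists_countable_generic {Γ : TropCurve S V E} (L : Γ.Lift) (hS : S.det ≠ 0) :
    ∃ (A₀ : Set ℝ) (A₁ : ℝ → Set ℝ), A₀.Countable ∧ (∀ u, (A₁ u).Countable) ∧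
      ∀ u v, u ∉ A₀ → v ∉ A₁ u → L.IsGeneric ![u, v] := by
  -- Given the first coordinate `u`, the second must avoid the vertices and the countably many
  -- points where translates of edges meet the line of abscissa `u`. Edges parallel to this line,
  -- for which the quotient is meaningless, are already avoided through their source by the choice
  -- of `u`.
  refine ⟨⋃ (w : V) (k : ℤ), {L.coord w 0 - k},
    fun u => (⋃ (w : V) (k : ℤ), {L.coord w 1 - k}) ∪ ⋃ (e : E) (k : ℤ) (k' : ℤ),
      {L.coord (Γ.src e) 1 + (u + k - L.coord (Γ.src e) 0) / Γ.coordSlope e 0 *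
        Γ.coordSlope e 1 - k'}, ?_, ?_, ?_⟩
  · exact countable_iUnion fun w => countable_iUnion fun k => countable_singleton _
  · intro u
    refine (countable_iUnion fun w => countable_iUnion fun k => countable_singleton _).union ?_
    exact countable_iUnion fun w => countable_iUnion fun k => countable_iUnion fun k' =>
      countable_singleton _
  · intro u v hu hv
    simp only [mem_iUnion, mem_singleton_iff, not_exists, mem_union, not_or] at hu hv
    refine ⟨fun w i k h => ?_, fun e a h => ?_⟩
    · fin_cases i
      · exact hu w k (by simp at h; linarith)
      · exact hv.1 w k (by simp at h; linarith)
    · obtain ⟨z, hz⟩ := (L.edgeMap_eq_iff hS e a _).1 h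
      have z0 : L.coord (Γ.src e) 0 + a * Γ.coordSlope e 0 = u + z 0 := hz 0
      have z1 : L.coord (Γ.src e) 1 + a * Γ.coordSlope e 1 = v + z 1 := hz 1
      by_cases h0 : Γ.coordSlope e 0 = 0
      · rw [h0, mul_zero, add_zero] at z0
        exact hu (Γ.src e) (z 0) (by linarith)
      · refine hv.2 e (z 0) (z 1) ?_
        have : (u + z 0 - L.coord (Γ.src e) 0) / Γ.coordSlope e 0 = a := by
          rw [div_eq_iff h0]; linarith
        rw [this]; linarith

theorem exists_generic {V₀ E₀ : Type} [Fintype V₀] [DecidableEq V₀] [Fintype E₀]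
    {Γ : TropCurve S V E} (L : Γ.Lift) {Γ₀ : TropCurve S V₀ E₀} (L₀ : Γ₀.Lift) (hS : S.det ≠ 0) :
    ∃ ξ : Fin 2 → ℝ, (∀ i, ξ i ∈ Ioo (0 : ℝ) 1) ∧ L.IsGeneric ξ ∧ L₀.IsGeneric ξ := by
  obtain ⟨A, B, hA, hB, h⟩ := L.exists_countable_generic hS
  obtain ⟨A', B', hA', hB', h'⟩ := L₀.exists_countable_generic hS
  obtain ⟨u, hu, hu'⟩ := ((hA.union hA').dense_compl ℝ).exists_between (zero_lt_one (α := ℝ))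
  obtain ⟨v, hv, hv'⟩ := (((hB u).union (hB' u)).dense_compl ℝ).exists_between
    (zero_lt_one (α := ℝ))
  simp only [mem_compl_iff, mem_union, not_or] at hu hv
  refine ⟨![u, v], ?_, h u v hu.1 hv.1, h' u v hu.2 hv.2⟩
  intro i
  fin_cases i
  · exact hu'
  · exact hv'

/-- The lines `x j = ξ + k` that are crossed by the lift of the edge `e`. -/
noncomputable def Lift.crossed {Γ : TropCurve S V E} (L : Γ.Lift) (j : Fin 2) (ξ : ℝ) (e : E) :
    Finset ℤ :=
  Finset.Ioc
    (min ⌊L.coord (Γ.src e) j - ξ⌋ ⌊L.coord (Γ.src e) j + Γ.length e * Γ.coordSlope e j - ξ⌋)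
    (max ⌊L.coord (Γ.src e) j - ξ⌋ ⌊L.coord (Γ.src e) j + Γ.length e * Γ.coordSlope e j - ξ⌋)

/-- The parameter at which the edge `e` crosses the line `x j = ξ + k`. -/
noncomputable def Lift.crossParam {Γ : TropCurve S V E} (L : Γ.Lift) (j : Fin 2) (ξ : ℝ) (e : E)
    (k : ℤ) : ℝ :=
  (ξ + k - L.coord (Γ.src e) j) / Γ.coordSlope e j

/-- Genericity keeps both ends of the edge off the lines, so the half-open interval of floors
records exactly the crossings at interior points. -/
theorem Lift.mem_crossed_iff {Γ : TropCurve S V E} (L : Γ.Lift) (hS : S.det ≠ 0) {ξ : Fin 2 → ℝ}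
    (hξ : L.IsGeneric ξ) (j : Fin 2) (e : E) (k : ℤ) : k ∈ L.crossed j (ξ j) e ↔
      Γ.coordSlope e j ≠ 0 ∧ L.crossParam j (ξ j) e k ∈ Ioo 0 (Γ.length e) := by
  have hA := hξ.coord_sub_ne (Γ.src e) j k
  have hB : L.coord (Γ.src e) j + Γ.length e * Γ.coordSlope e j - ξ j ≠ k := by
    rw [L.coord_src_add hS]
    intro h
    refine hξ.coord_sub_ne (Γ.tgt e) j (k - L.shift e j) ?_
    push_cast
    linarith
  have hl := Γ.length_pos e
  rw [crossed, Finset.mem_Ioc, min_lt_iff, le_max_iff, Int.floor_lt, Int.floor_lt, Int.le_floor,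
    Int.le_floor, crossParam, mem_Ioo]
  rcases lt_trichotomy (Γ.coordSlope e j) 0 with h | h | h
  · have h1 := mul_pos hl (neg_pos.2 h)
    rw [lt_div_iff_of_neg h, zero_mul, div_lt_iff_of_neg h]
    constructor
    · rintro ⟨h2, h3⟩
      refine ⟨h.ne, ?_, ?_⟩
      · have : (k : ℝ) < L.coord (Γ.src e) j - ξ j := by
          rcases h3 with h3 | h3
          · exact lt_of_le_of_ne h3 (Ne.symm hA)
          · linarith
        linarith
      · rcases h2 with h2 | h2 <;> linarith
    · rintro ⟨-, h2, h3⟩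
      exact ⟨Or.inr (by linarith), Or.inl (by linarith)⟩
  · simp only [h, ne_eq, not_true_eq_false, false_and, iff_false, mul_zero, add_zero, or_self,
      not_and, not_le]
    exact fun h => h
  · have h1 := mul_pos hl h
    rw [div_pos_iff_of_pos_right h, div_lt_iff₀ h]
    constructor
    · rintro ⟨h2, h3⟩
      refine ⟨h.ne', ?_, ?_⟩
      · rcases h2 with h2 | h2 <;> linarith
      · have : (k : ℝ) < L.coord (Γ.src e) j + Γ.length e * Γ.coordSlope e j - ξ j := by
          rcases h3 with h3 | h3
          · linarith
          · exact lt_of_le_of_ne h3 (Ne.symm hB)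
        linarith
    · rintro ⟨-, h2, h3⟩
      exact ⟨Or.inl (by linarith), Or.inr (by linarith)⟩

/-- The time at which the line `ξ + t e_i` meets a translate of the `k`-th crossing point of the
edge `e`. -/
noncomputable def Lift.crossTime {Γ : TropCurve S V E} (L : Γ.Lift) (i j : Fin 2) (ξ : Fin 2 → ℝ)
    (e : E) (k : ℤ) : ℝ :=
  Int.fract (L.coord (Γ.src e) i + L.crossParam j (ξ j) e k * Γ.coordSlope e i - ξ i)

theorem fin_two_eq_or {i j : Fin 2} (hij : i ≠ j) (k : Fin 2) : k = i ∨ k = j := by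
  fin_cases i <;> fin_cases j <;> fin_cases k <;> simp_all

/-- A crossing at time `0` would place `S ξ` itself on the curve. -/
theorem Lift.crossTime_pos {Γ : TropCurve S V E} (L : Γ.Lift) (hS : S.det ≠ 0) {ξ : Fin 2 → ℝ}
    (hξ : L.IsGeneric ξ) {i j : Fin 2} (hij : i ≠ j) {e : E} {k : ℤ}
    (hk : k ∈ L.crossed j (ξ j) e) : 0 < L.crossTime i j ξ e k := by
  refine lt_of_le_of_ne (Int.fract_nonneg _) fun h => ?_
  obtain ⟨h0, h1⟩ := (L.mem_crossed_iff hS hξ j e k).1 hk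
  rw [crossTime, eq_comm, Int.fract_eq_iff] at h
  obtain ⟨-, -, z, hz⟩ := h
  refine hξ.edgeMap_ne e (L.crossParam j (ξ j) e k) ((L.edgeMap_eq_iff hS _ _ _).2
    ⟨fun l => if l = i then z else k, fun l => ?_⟩)
  rcases fin_two_eq_or hij l with rfl | rfl
  · simp only [if_true]; linarith
  · simp only [if_neg hij.symm, crossParam]
    field_simp
    ring

/-- A point of the edge over the line is a crossing, and the index `k` determines its parameter
because the edge is transverse to the line. The fractional part records which translate of the
segment is met. -/
theorem Lift.ncard_preimage_line {Γ : TropCurve S V E} (L : Γ.Lift) (hS : S.det ≠ 0)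
    {ξ : Fin 2 → ℝ} (hξ : L.IsGeneric ξ) {i j : Fin 2} (hij : i ≠ j) (e : E)
    (h0 : Γ.coordSlope e j ≠ 0) {x : ℝ} (hx : x ∈ Ioo (0 : ℝ) 1) :
    {s : ℝ | s ∈ Ioo 0 (Γ.length e) ∧
      Γ.edgeMap e s = torusMk S (S.mulVec (ξ + x • Pi.single i 1))}.ncard =
      ((L.crossed j (ξ j) e).filter fun k => L.crossTime i j ξ e k = x).card := by
  have hset : {s : ℝ | s ∈ Ioo 0 (Γ.length e) ∧
      Γ.edgeMap e s = torusMk S (S.mulVec (ξ + x • Pi.single i 1))} =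
      L.crossParam j (ξ j) e ''
        ((L.crossed j (ξ j) e).filter fun k => L.crossTime i j ξ e k = x : Finset ℤ) := by
    ext s
    simp only [mem_ofPred_eq, mem_image, Finset.coe_filter]
    rw [L.edgeMap_eq_iff hS]
    constructor
    · rintro ⟨hs, z, hz⟩
      have hzi := hz i
      have hzj := hz j
      simp only [Pi.add_apply, Pi.smul_apply, Pi.single_eq_same, smul_eq_mul, mul_one,
        Pi.single_eq_of_ne hij.symm, mul_zero, add_zero] at hzi hzj
      have hp : L.crossParam j (ξ j) e (z j) = s := by
        rw [crossParam, div_eq_iff h0]; linarith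
      refine ⟨z j, ⟨(L.mem_crossed_iff hS hξ j e _).2 ⟨h0, hp ▸ hs⟩, ?_⟩, hp⟩
      rw [crossTime, hp, Int.fract_eq_iff]
      exact ⟨hx.1.le, hx.2, z i, by linarith⟩
    · rintro ⟨k, ⟨hk, ht⟩, rfl⟩
      refine ⟨((L.mem_crossed_iff hS hξ j e _).1 hk).2, ?_⟩
      rw [crossTime, Int.fract_eq_iff] at ht
      obtain ⟨-, -, z, hz⟩ := ht
      refine ⟨fun l => if l = i then z else k, fun l => ?_⟩
      rcases fin_two_eq_or hij l with rfl | rfl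
      · simp only [Pi.add_apply, Pi.smul_apply, Pi.single_eq_same, smul_eq_mul, mul_one, if_true]
        linarith
      · simp only [if_neg hij.symm, crossParam, Pi.add_apply, Pi.smul_apply,
          Pi.single_eq_of_ne hij.symm, smul_eq_mul, mul_zero, add_zero]
        field_simp
        ring
  rw [hset, ncard_image_of_injective, ncard_coe_finset]
  intro k k' hkk
  simp only [crossParam] at hkk
  rw [div_left_inj' h0] at hkk
  have : (k : ℝ) = k' := by linarith
  exact_mod_cast this

theorem abs_planeDet_mulVec_single (Γ : TropCurve S V E) (hS : S.det ≠ 0) {i j : Fin 2}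
    (hij : i ≠ j) (e : E) :
    |planeDet (toReal (Γ.slope e)) (S.mulVec (Pi.single i 1))| =
      |S.det| * |Γ.coordSlope e j| := by
  conv_lhs => rw [← mulVec_inv_mulVec hS (toReal (Γ.slope e))]
  rw [planeDet_mulVec, abs_mul]
  congr 1
  change |planeDet (Γ.coordSlope e) _| = _
  fin_cases i <;> fin_cases j <;> simp_all [planeDet]

/-- At a point that is not on the curve, `Θ` is locally given by one affine function. -/
theorem IsThetaOf.exists_gradient {Γ : TropCurve S V E} {Θ : (Fin 2 → ℝ) → ℝ}
    (hΘ : Γ.IsThetaOf Θ) {x : Fin 2 → ℝ} (hx : ∀ e a, Γ.edgeMap e a ≠ torusMk S x)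
    (hx' : torusMk S x ∉ range Γ.pos) : ∃ n : Fin 2 → ℤ, ∀ v : Fin 2 → ℝ,
      ∀ᶠ s in 𝓝[>] (0 : ℝ), Θ (x + s • v) = Θ x + s * dotProduct (toReal n) v := by
  obtain ⟨F, hF⟩ := hΘ.piecewise_affine x
  obtain ⟨⟨n, b⟩, hnF, hn⟩ := hF.self_of_nhds.1
  refine ⟨n, fun v => ?_⟩
  have h1 := hΘ.corner_locus x hx' v
  have ht : ∀ σ : ℝ, Tendsto (fun s : ℝ => x + (σ * s) • v) (𝓝[>] 0) (𝓝 x) := by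
    intro σ
    have : Tendsto (fun s : ℝ => x + (σ * s) • v) (𝓝 0) (𝓝 (x + (σ * 0) • v)) :=
      Continuous.tendsto (by fun_prop) 0
    rw [mul_zero, zero_smul, add_zero] at this
    exact this.mono_left nhdsWithin_le_nhds
  filter_upwards [h1, (ht 1).eventually hF, (ht (-1)).eventually hF] with s h1 h2 h3
  -- The affine piece active at `x` bounds `Θ` from below on both sides. The corner formula makes
  -- the symmetric second difference vanish, so both bounds are equalities.
  have h4 := h2.2 ⟨(n, b), hnF, rfl⟩
  have h5 := h3.2 ⟨(n, b), hnF, rfl⟩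
  simp only [one_mul, neg_mul, neg_smul, ← sub_eq_add_neg] at h4 h5
  simp only [dotProduct_add, dotProduct_sub, dotProduct_smul, smul_eq_mul] at h4 h5 hn
  have h6 : ∀ e, {s : ℝ | s ∈ Ioo 0 (Γ.length e) ∧ Γ.edgeMap e s = torusMk S x} = ∅ := by
    intro e
    ext a
    simp [hx e a]
  simp only [h6, ncard_empty, Nat.cast_zero, zero_mul, Finset.sum_const_zero, mul_zero] at h1
  linarith

theorem Lift.torusMk_line_notMem {Γ : TropCurve S V E} (L : Γ.Lift) (hS : S.det ≠ 0)
    {ξ : Fin 2 → ℝ} (hξ : L.IsGeneric ξ) {i j : Fin 2} (hij : i ≠ j) (t : ℝ) :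
    torusMk S (S.mulVec (ξ + t • Pi.single i 1)) ∉ range Γ.pos := by
  rintro ⟨v, hv⟩
  rw [← L.torusMk_pos, torusMk_eq_iff] at hv
  obtain ⟨z, hz⟩ := hv
  have h1 := congrArg S⁻¹.mulVec hz
  rw [Matrix.mulVec_add, inv_mulVec_mulVec hS, inv_mulVec_mulVec hS] at h1
  have h2 := congrFun h1 j
  simp only [Pi.add_apply, Pi.smul_apply, Pi.single_eq_of_ne hij.symm, smul_eq_mul, mul_zero,
    add_zero] at h2
  refine hξ.coord_sub_ne v j (z j) ?_
  rw [coord, h2]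
  simp [toReal]

theorem IsThetaOf.continuous {Γ : TropCurve S V E} {Θ : (Fin 2 → ℝ) → ℝ}
    (hΘ : Γ.IsThetaOf Θ) : Continuous Θ := by
  rw [← continuousOn_univ]
  exact hΘ.convex.continuousOn isOpen_univ

/-- Along the segment from `S ξ` to its translate, `Θ` starts with the gradient `n`, and a crossing
at time `t` raises its derivative by `|det S| * |slope coordinate|`, which contributes `1 - t` times
that amount at the end. The same `n` serves for both periods. -/
theorem Lift.theta_add_period {Γ : TropCurve S V E} (L : Γ.Lift) (hS : S.det ≠ 0)
    {Θ : (Fin 2 → ℝ) → ℝ} (hΘ : Γ.IsThetaOf Θ) {ξ : Fin 2 → ℝ} (hξ : L.IsGeneric ξ) :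
    ∃ n : Fin 2 → ℤ, ∀ i j, i ≠ j →
      Θ (S.mulVec ξ + S.mulVec (Pi.single i 1)) = Θ (S.mulVec ξ) +
        dotProduct (toReal n) (S.mulVec (Pi.single i 1)) +
        ∑ e, ∑ k ∈ L.crossed j (ξ j) e,
          |S.det| * |Γ.coordSlope e j| * (1 - L.crossTime i j ξ e k) := by
  have hx' : torusMk S (S.mulVec ξ) ∉ range Γ.pos := by
    have := L.torusMk_line_notMem hS hξ (i := 0) (j := 1) (by decide) 0
    rwa [zero_smul, add_zero] at this
  obtain ⟨n, hn⟩ := hΘ.exists_gradient hξ.edgeMap_ne hx'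
  refine ⟨n, fun i j hij => ?_⟩
  have hline : ∀ t : ℝ, S.mulVec (ξ + t • Pi.single i 1) =
      S.mulVec ξ + t • S.mulVec (Pi.single i 1) := by
    intro t
    rw [Matrix.mulVec_add, Matrix.mulVec_smul]
  have key := eq_add_sum_of_second_difference
    (g := fun t => Θ (S.mulVec ξ + t • S.mulVec (Pi.single i 1)))
    (hΘ.continuous.comp (by fun_prop))
    (ι := Σ e, {k // k ∈ L.crossed j (ξ j) e})
    (fun q => |S.det| * |Γ.coordSlope q.1 j|) (fun q => L.crossTime i j ξ q.1 q.2)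
    (fun q => ⟨L.crossTime_pos hS hξ hij q.2.2, Int.fract_lt_one _⟩)
    (dotProduct (toReal n) (S.mulVec (Pi.single i 1)))
    (by simpa using hn (S.mulVec (Pi.single i 1))) ?_
  · simp only [one_smul, zero_smul, add_zero] at key
    rw [key, Fintype.sum_sigma]
    congr 1
    refine Finset.sum_congr rfl fun e _ => ?_
    exact Finset.sum_coe_sort (L.crossed j (ξ j) e)
      (fun k => |S.det| * |Γ.coordSlope e j| * (1 - L.crossTime i j ξ e k))
  · intro x hx
    have h1 := hΘ.corner_locus _ (L.torusMk_line_notMem hS hξ hij x) (S.mulVec (Pi.single i 1))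
    filter_upwards [h1] with s h1
    rw [hline, add_assoc, ← add_smul, add_sub_assoc (S.mulVec ξ), ← sub_smul] at h1
    rw [h1, Fintype.sum_sigma]
    congr 1
    refine Finset.sum_congr rfl fun e _ => ?_
    rw [Finset.sum_coe_sort (L.crossed j (ξ j) e)
      (fun k => if L.crossTime i j ξ e k = x then |S.det| * |Γ.coordSlope e j| else 0),
      Γ.abs_planeDet_mulVec_single hS hij]
    by_cases h0 : Γ.coordSlope e j = 0
    · simp [h0]
    · have := L.ncard_preimage_line hS hξ hij e h0 hx
      rw [hline] at this
      rw [this, ← Finset.sum_filter, Finset.sum_const, nsmul_eq_mul]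

end TropCurve

/-! ### Linear equivalence leaves finitely many moments -/

theorem finite_setOf_abs_le (M : ℤ) : {y : Fin 2 → ℤ | ∀ i, |y i| ≤ M}.Finite := by
  refine (Set.finite_Icc (fun _ : Fin 2 => -M) (fun _ => M)).subset fun y hy => ?_
  exact ⟨fun i => (abs_le.1 (hy i)).1, fun i => (abs_le.1 (hy i)).2⟩

theorem abs_floor_sub_le {x ξ : ℝ} {M : ℤ} (hx : |x| ≤ M) (hξ : ξ ∈ Ioo (0 : ℝ) 1) :
    |⌊x - ξ⌋| ≤ M + 1 := by
  obtain ⟨h1, h2⟩ := abs_le.1 hx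
  rw [abs_le]
  constructor
  · rw [Int.le_floor]; push_cast; linarith [hξ.2]
  · have : ⌊x - ξ⌋ ≤ M := by
      have h3 : (⌊x - ξ⌋ : ℝ) ≤ M := (Int.floor_le _).trans (by linarith [hξ.1])
      exact_mod_cast h3
    linarith

theorem abs_sum_le_card_mul {ι : Type} (s : Finset ι) (f : ι → ℤ) {M : ℤ}
    (h : ∀ k ∈ s, |f k| ≤ M) : |∑ k ∈ s, f k| ≤ s.card * M := by
  refine (Finset.abs_sum_le_sum_abs _ _).trans ?_
  rw [← nsmul_eq_mul]
  exact Finset.sum_le_card_nsmul _ _ _ h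

namespace TropCurve

variable {S : Matrix (Fin 2) (Fin 2) ℝ} {V E : Type} [Fintype V] [DecidableEq V] [Fintype E]

/-- A common bound for the discrete and continuous data of a lift. -/
structure Lift.BoundedBy {Γ : TropCurve S V E} (L : Γ.Lift) (M : ℤ) : Prop where
  coord_le : ∀ v i, |L.coord v i| ≤ M
  shift_le : ∀ e i, |L.shift e i| ≤ M
  slope_le : ∀ e i, |Γ.slope e i| ≤ M
  card_le : (Fintype.card E : ℤ) ≤ M

theorem Lift.BoundedBy.mono {Γ : TropCurve S V E} {L : Γ.Lift} {M M' : ℤ} (h : L.BoundedBy M)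
    (hM : M ≤ M') : L.BoundedBy M' where
  coord_le v i := (h.coord_le v i).trans (by exact_mod_cast hM)
  shift_le e i := (h.shift_le e i).trans hM
  slope_le e i := (h.slope_le e i).trans hM
  card_le := h.card_le.trans hM

theorem Lift.BoundedBy.abs_coord_add_le {Γ : TropCurve S V E} {L : Γ.Lift} {M : ℤ}
    (h : L.BoundedBy M) (hS : S.det ≠ 0) (e : E) (i : Fin 2) :
    |L.coord (Γ.src e) i + Γ.length e * Γ.coordSlope e i| ≤ (2 * M : ℤ) := by
  rw [L.coord_src_add hS]
  have h1 := h.coord_le (Γ.tgt e) i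
  have h2 : |(L.shift e i : ℝ)| ≤ M := by exact_mod_cast h.shift_le e i
  have := abs_add_le (L.coord (Γ.tgt e) i) (L.shift e i)
  push_cast
  linarith

/-- Write the fractional part as the number minus its floor. Multiplication by the slope coordinate
`j` clears the denominator of `crossParam`, so each crossing contributes one common expression plus
an integral combination of the two slope coordinates. The sign of the slope turns the number of
crossings into `crossing`. The bounds are crude: it only matters that they depend on `M` alone. -/
theorem Lift.exists_sum_crossed_eq {Γ : TropCurve S V E} (L : Γ.Lift) (hS : S.det ≠ 0)
    {ξ : Fin 2 → ℝ} (hξ : L.IsGeneric ξ) (hξ' : ∀ i, ξ i ∈ Ioo (0 : ℝ) 1) {M : ℤ}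
    (hM : L.BoundedBy M) {i j : Fin 2} (e : E) :
    ∃ z z' : ℤ, |z| ≤ (8 * M + 8) * (2 * M + 2) ∧ |z'| ≤ (8 * M + 8) * (2 * M + 2) ∧
      ∑ k ∈ L.crossed j (ξ j) e, |Γ.coordSlope e j| * (1 - L.crossTime i j ξ e k) =
        L.crossing j (ξ j) e * (Γ.coordSlope e j * ξ i - Γ.coordSlope e i * ξ j -
          (L.coord (Γ.src e) i * Γ.coordSlope e j - L.coord (Γ.src e) j * Γ.coordSlope e i)) +
        Γ.coordSlope e j * z + Γ.coordSlope e i * z' := by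
  have hM0 : 0 ≤ M := le_trans (by positivity) hM.card_le
  have hA : ∀ i, |⌊L.coord (Γ.src e) i - ξ i⌋| ≤ M + 1 := fun i =>
    abs_floor_sub_le (hM.coord_le _ _) (hξ' i)
  have hB : ∀ i, |⌊L.coord (Γ.src e) i + Γ.length e * Γ.coordSlope e i - ξ i⌋| ≤ 2 * M + 1 :=
    fun i => abs_floor_sub_le (hM.abs_coord_add_le hS e i) (hξ' i)
  have hk : ∀ k ∈ L.crossed j (ξ j) e, |k| ≤ 2 * M + 2 := by
    intro k hk
    rw [crossed, Finset.mem_Ioc] at hk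
    have h1 := abs_le.1 (hA j)
    have h2 := abs_le.1 (hB j)
    rw [abs_le]
    omega
  have hcard : ((L.crossed j (ξ j) e).card : ℤ) ≤ 8 * M + 8 := by
    have h1 := abs_le.1 (hA j)
    have h2 := abs_le.1 (hB j)
    rw [crossed, Int.card_Ioc]
    omega
  have hfl : ∀ k ∈ L.crossed j (ξ j) e, |1 + ⌊L.coord (Γ.src e) i +
      L.crossParam j (ξ j) e k * Γ.coordSlope e i - ξ i⌋| ≤ 2 * M + 2 := by
    intro k hk
    obtain ⟨-, h1, h2⟩ := (L.mem_crossed_iff hS hξ j e k).1 hk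
    have h3 : |L.coord (Γ.src e) i + L.crossParam j (ξ j) e k * Γ.coordSlope e i| ≤
        (2 * M : ℤ) := by
      have h4 := abs_le.1 (hM.coord_le (Γ.src e) i)
      have h5 := abs_le.1 (hM.abs_coord_add_le hS e i)
      have h6 : (0 : ℝ) ≤ M := by exact_mod_cast hM0
      push_cast at h5 ⊢
      rw [abs_le]
      rcases le_total 0 (Γ.coordSlope e i) with h | h
      · constructor <;> nlinarith [mul_nonneg h1.le h, mul_le_mul_of_nonneg_right h2.le h]
      · constructor <;> nlinarith [mul_nonneg h1.le (neg_nonneg.2 h),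
          mul_le_mul_of_nonneg_right h2.le (neg_nonneg.2 h)]
    have h7 := abs_le.1 (abs_floor_sub_le h3 (hξ' i))
    rw [abs_le]
    omega
  have hz := (abs_sum_le_card_mul _ _ hfl).trans
    (mul_le_mul_of_nonneg_right hcard (by positivity))
  have hz' := (abs_sum_le_card_mul _ _ hk).trans
    (mul_le_mul_of_nonneg_right hcard (by positivity))
  -- The factor `ε` is the sign of the slope coordinate, kept abstract so that both orientations
  -- share the computation.
  have hterm : ∀ k ∈ L.crossed j (ξ j) e, ∀ ε : ℝ, |Γ.coordSlope e j| = ε * Γ.coordSlope e j →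
      |Γ.coordSlope e j| * (1 - L.crossTime i j ξ e k) =
      ε * (Γ.coordSlope e j * ξ i - Γ.coordSlope e i * ξ j -
          (L.coord (Γ.src e) i * Γ.coordSlope e j - L.coord (Γ.src e) j * Γ.coordSlope e i) +
        Γ.coordSlope e j * (1 + ⌊L.coord (Γ.src e) i +
          L.crossParam j (ξ j) e k * Γ.coordSlope e i - ξ i⌋ : ℤ) - Γ.coordSlope e i * k) := by
    intro k hk ε hε
    obtain ⟨h0, -⟩ := (L.mem_crossed_iff hS hξ j e k).1 hk
    rw [crossTime, ← Int.self_sub_floor, hε]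
    have h1 : Γ.coordSlope e j * L.crossParam j (ξ j) e k = ξ j + k - L.coord (Γ.src e) j := by
      rw [crossParam]; field_simp
    push_cast
    linear_combination (-ε * Γ.coordSlope e i) * h1
  have hsum : ∀ ε : ℝ, |Γ.coordSlope e j| = ε * Γ.coordSlope e j →
      ∑ k ∈ L.crossed j (ξ j) e, |Γ.coordSlope e j| * (1 - L.crossTime i j ξ e k) =
      ε * ((L.crossed j (ξ j) e).card *
        (Γ.coordSlope e j * ξ i - Γ.coordSlope e i * ξ j -
          (L.coord (Γ.src e) i * Γ.coordSlope e j - L.coord (Γ.src e) j * Γ.coordSlope e i)) +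
        Γ.coordSlope e j * (∑ k ∈ L.crossed j (ξ j) e, (1 + ⌊L.coord (Γ.src e) i +
          L.crossParam j (ξ j) e k * Γ.coordSlope e i - ξ i⌋) : ℤ) -
        Γ.coordSlope e i * (∑ k ∈ L.crossed j (ξ j) e, k : ℤ)) := by
    intro ε hε
    rw [Finset.sum_congr rfl fun k hk => hterm k hk ε hε, ← Finset.mul_sum,
      Finset.sum_sub_distrib, Finset.sum_add_distrib, Finset.sum_const, nsmul_eq_mul,
      ← Finset.mul_sum, ← Finset.mul_sum]
    push_cast
    ring
  rcases lt_trichotomy (Γ.coordSlope e j) 0 with h | h | h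
  · refine ⟨_, _, (abs_neg _).le.trans hz, hz', ?_⟩
    rw [hsum (-1) (by rw [abs_of_neg h]; ring)]
    have h1 : ((L.crossed j (ξ j) e).card : ℤ) = -L.crossing j (ξ j) e := by
      have h2 : ⌊L.coord (Γ.src e) j + Γ.length e * Γ.coordSlope e j - ξ j⌋ ≤
          ⌊L.coord (Γ.src e) j - ξ j⌋ :=
        Int.floor_mono (by nlinarith [mul_nonneg (Γ.length_pos e).le (neg_nonneg.2 h.le)])
      rw [crossed, Int.card_Ioc, max_eq_left h2, min_eq_right h2, crossing,
        Int.toNat_of_nonneg (by omega)]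
      ring
    have h2 : ((L.crossed j (ξ j) e).card : ℝ) = -L.crossing j (ξ j) e := by exact_mod_cast h1
    rw [h2]
    push_cast
    ring
  · refine ⟨0, 0, by simp; positivity, by simp; positivity, ?_⟩
    rw [crossing]
    simp [h]
  · refine ⟨_, _, hz, (abs_neg _).le.trans hz', ?_⟩
    rw [hsum 1 (by rw [abs_of_pos h]; ring)]
    have h1 : ((L.crossed j (ξ j) e).card : ℤ) = L.crossing j (ξ j) e := by
      have h2 : ⌊L.coord (Γ.src e) j - ξ j⌋ ≤
          ⌊L.coord (Γ.src e) j + Γ.length e * Γ.coordSlope e j - ξ j⌋ :=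
        Int.floor_mono (by nlinarith [mul_nonneg (Γ.length_pos e).le h.le])
      rw [crossed, Int.card_Ioc, max_eq_right h2, min_eq_left h2, crossing,
        Int.toNat_of_nonneg (by omega)]
    have h2 : ((L.crossed j (ξ j) e).card : ℝ) = L.crossing j (ξ j) e := by exact_mod_cast h1
    rw [h2]
    push_cast
    ring

/-- The `j`-th coordinate of the first moment of the curve. -/
noncomputable def Lift.coordMoment {Γ : TropCurve S V E} (L : Γ.Lift) (i j : Fin 2) : ℝ :=
  ∑ e, (L.coord (Γ.src e) i * Γ.coordSlope e j - L.coord (Γ.src e) j * Γ.coordSlope e i) *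
    L.shift e j

/-- Replacing crossings by shifts produces floor terms at both ends of each edge. Balancing moves
those at the sources to the targets, where the determinant of position and slope has changed only by
the integral shift. -/
theorem Lift.sum_crossing_mul {Γ : TropCurve S V E} (L : Γ.Lift) (hS : S.det ≠ 0) (i j : Fin 2)
    (ξ : ℝ) :
    ∑ e, L.crossing j ξ e *
        (L.coord (Γ.src e) i * Γ.coordSlope e j - L.coord (Γ.src e) j * Γ.coordSlope e i) =
      L.coordMoment i j + ∑ e, (⌊L.coord (Γ.tgt e) j - ξ⌋ : ℝ) *
        (L.shift e i * Γ.coordSlope e j - L.shift e j * Γ.coordSlope e i) := by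
  have h1 : ∀ e, L.crossing j ξ e =
      ⌊L.coord (Γ.tgt e) j - ξ⌋ + L.shift e j - ⌊L.coord (Γ.src e) j - ξ⌋ := by
    intro e
    rw [crossing, L.coord_src_add hS, add_sub_right_comm, Int.floor_add_intCast]
  have h2 : ∀ k l, ∑ e, Γ.coordSlope e k * (⌊L.coord (Γ.src e) j - ξ⌋ * L.coord (Γ.src e) l) =
      ∑ e, Γ.coordSlope e k * (⌊L.coord (Γ.tgt e) j - ξ⌋ * L.coord (Γ.tgt e) l) := fun k l =>
    sum_cycle_smul (Γ.graphBoundary_coordSlope k) fun v => ⌊L.coord v j - ξ⌋ * L.coord v l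
  have h3 := h2 j i
  have h4 := h2 i j
  rw [← sub_eq_zero, ← Finset.sum_sub_distrib] at h3 h4
  rw [coordMoment, ← Finset.sum_add_distrib, ← sub_eq_zero, ← Finset.sum_sub_distrib]
  have h5 : ∀ e, L.crossing j ξ e *
        (L.coord (Γ.src e) i * Γ.coordSlope e j - L.coord (Γ.src e) j * Γ.coordSlope e i) -
      ((L.coord (Γ.src e) i * Γ.coordSlope e j - L.coord (Γ.src e) j * Γ.coordSlope e i) *
        L.shift e j + (⌊L.coord (Γ.tgt e) j - ξ⌋ : ℝ) *
        (L.shift e i * Γ.coordSlope e j - L.shift e j * Γ.coordSlope e i)) =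
      (Γ.coordSlope e i * (⌊L.coord (Γ.src e) j - ξ⌋ * L.coord (Γ.src e) j) -
        Γ.coordSlope e i * (⌊L.coord (Γ.tgt e) j - ξ⌋ * L.coord (Γ.tgt e) j)) -
      (Γ.coordSlope e j * (⌊L.coord (Γ.src e) j - ξ⌋ * L.coord (Γ.src e) i) -
        Γ.coordSlope e j * (⌊L.coord (Γ.tgt e) j - ξ⌋ * L.coord (Γ.tgt e) i)) := by
    intro e
    have hi := L.coord_src_add hS e i
    have hj := L.coord_src_add hS e j
    rw [h1]
    push_cast
    linear_combination (⌊L.coord (Γ.tgt e) j - ξ⌋ : ℝ) *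
      (Γ.coordSlope e j * hi - Γ.coordSlope e i * hj)
  rw [Finset.sum_congr rfl fun e _ => h5 e, Finset.sum_sub_distrib, h3, h4, sub_zero]

/-- Collecting the contributions of all edges, the base point `ξ` enters the bracket only through
`C`, hence identically for two curves of the same class. The curve itself enters through its moment
and through integral vectors that range over a finite set depending on `M`. -/
theorem Lift.theta_add_period_eq {Γ : TropCurve S V E} (L : Γ.Lift) (hS : S.det ≠ 0)
    {C : Matrix (Fin 2) (Fin 2) ℤ} (hC : Γ.HasDegree C)
    {Θ : (Fin 2 → ℝ) → ℝ} (hΘ : Γ.IsThetaOf Θ) {ξ : Fin 2 → ℝ} (hξ : L.IsGeneric ξ)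
    (hξ' : ∀ i, ξ i ∈ Ioo (0 : ℝ) 1) {M : ℤ} (hM : L.BoundedBy M) :
    ∃ n : Fin 2 → ℤ, ∀ i j, i ≠ j → ∃ y y' : Fin 2 → ℤ,
      (∀ k, |y k| ≤ M * (((8 * M + 8) * (2 * M + 2) + (M + 1) * M) * M)) ∧
      (∀ k, |y' k| ≤ M * (((8 * M + 8) * (2 * M + 2) + (M + 1) * M) * M)) ∧
      Θ (S.mulVec ξ + S.mulVec (Pi.single i 1)) = Θ (S.mulVec ξ) +
        dotProduct (toReal n) (S.mulVec (Pi.single i 1)) +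
        |S.det| * (coordDegree S C j j * ξ i - coordDegree S C i j * ξ j - L.coordMoment i j +
          S⁻¹.mulVec (toReal y) j + S⁻¹.mulVec (toReal y') i) := by
  have hM0 : 0 ≤ M := le_trans (by positivity) hM.card_le
  obtain ⟨n, hn⟩ := L.theta_add_period hS hΘ hξ
  refine ⟨n, fun i j hij => ?_⟩
  choose z z' hz hz' hzz using fun e => L.exists_sum_crossed_eq hS hξ hξ' hM (i := i) (j := j) e
  have hf : ∀ e, |⌊L.coord (Γ.tgt e) j - ξ j⌋| ≤ M + 1 := fun e =>
    abs_floor_sub_le (hM.coord_le _ _) (hξ' j)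
  have hfa : ∀ e l, |⌊L.coord (Γ.tgt e) j - ξ j⌋ * L.shift e l| ≤ (M + 1) * M := by
    intro e l
    rw [abs_mul]
    exact mul_le_mul (hf e) (hM.shift_le e l) (abs_nonneg _) (by positivity)
  have hbound : ∀ x : E → ℤ, (∀ e, |x e| ≤ (8 * M + 8) * (2 * M + 2) + (M + 1) * M) → ∀ k,
      |(∑ e, x e • Γ.slope e) k| ≤ M * (((8 * M + 8) * (2 * M + 2) + (M + 1) * M) * M) := by
    intro x hx k
    rw [Finset.sum_apply]
    refine (abs_sum_le_card_mul _ _ fun e _ => ?_).trans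
      (mul_le_mul_of_nonneg_right ((Finset.card_univ (α := E)).symm ▸ hM.card_le) (by positivity))
    rw [Pi.smul_apply, smul_eq_mul, abs_mul]
    exact mul_le_mul (hx e) (hM.slope_le e k) (abs_nonneg _) (by positivity)
  have hcoord : ∀ (x : E → ℤ) l, S⁻¹.mulVec (toReal (∑ e, x e • Γ.slope e)) l =
      ∑ e, Γ.coordSlope e l * x e := by
    intro x l
    simp only [Matrix.mulVec, dotProduct, toReal, Finset.sum_apply, Pi.smul_apply, smul_eq_mul,
      coordSlope_apply, Int.cast_sum, Int.cast_mul, Finset.mul_sum, Finset.sum_mul]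
    rw [Finset.sum_comm]
    exact Finset.sum_congr rfl fun e _ => Finset.sum_congr rfl fun k _ => by ring
  refine ⟨∑ e, (z e - ⌊L.coord (Γ.tgt e) j - ξ j⌋ * L.shift e i) • Γ.slope e,
    ∑ e, (z' e + ⌊L.coord (Γ.tgt e) j - ξ j⌋ * L.shift e j) • Γ.slope e,
    hbound _ fun e => ?_, hbound _ fun e => ?_, ?_⟩
  · exact (abs_sub _ _).trans (add_le_add (hz e) (hfa e i))
  · exact (abs_add_le _ _).trans (add_le_add (hz' e) (hfa e j))
  · rw [hn i j hij, hcoord, hcoord]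
    congr 1
    have h1 : ∀ e, ∑ k ∈ L.crossed j (ξ j) e,
        |S.det| * |Γ.coordSlope e j| * (1 - L.crossTime i j ξ e k) =
        |S.det| * ∑ k ∈ L.crossed j (ξ j) e,
          |Γ.coordSlope e j| * (1 - L.crossTime i j ξ e k) := by
      intro e
      rw [Finset.mul_sum]
      exact Finset.sum_congr rfl fun k _ => mul_assoc _ _ _
    rw [Finset.sum_congr rfl fun e _ => (h1 e).trans (congrArg (|S.det| * ·) (hzz e)),
      ← Finset.mul_sum]
    congr 1
    have h2 := L.sum_crossing_mul hS i j (ξ j)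
    have h3 := (L.sum_mul_crossing hS j (ξ j) (Γ.graphBoundary_coordSlope j)).trans
      (L.sum_coordSlope_mul_shift hS hC j j)
    have h4 := (L.sum_mul_crossing hS j (ξ j) (Γ.graphBoundary_coordSlope i)).trans
      (L.sum_coordSlope_mul_shift hS hC i j)
    rw [← h3, ← h4, show L.coordMoment i j = _ from eq_sub_of_add_eq h2.symm]
    simp only [Finset.sum_mul, ← Finset.sum_sub_distrib, ← Finset.sum_add_distrib]
    refine Finset.sum_congr rfl fun e _ => ?_
    push_cast
    ring

theorem Lift.exists_boundedBy {Γ : TropCurve S V E} (L : Γ.Lift) : ∃ M, L.BoundedBy M := by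
  have h1 : ∃ M : ℤ, ∀ q : V × Fin 2, |L.coord q.1 q.2| ≤ M := by
    obtain ⟨B, hB⟩ := Set.Finite.bddAbove (Set.finite_range fun q : V × Fin 2 => |L.coord q.1 q.2|)
    exact ⟨⌈B⌉, fun q => (hB ⟨q, rfl⟩).trans (Int.le_ceil _)⟩
  obtain ⟨M₁, h1⟩ := h1
  obtain ⟨M₂, h2⟩ := Set.Finite.bddAbove
    (Set.finite_range fun q : E × Fin 2 => |L.shift q.1 q.2|)
  obtain ⟨M₃, h3⟩ := Set.Finite.bddAbove
    (Set.finite_range fun q : E × Fin 2 => |Γ.slope q.1 q.2|)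
  refine ⟨max (max M₁ M₂) (max M₃ (Fintype.card E)), ⟨fun v i => (h1 (v, i)).trans ?_,
    fun e i => (h2 ⟨(e, i), rfl⟩).trans ?_, fun e i => (h3 ⟨(e, i), rfl⟩).trans ?_, ?_⟩⟩
  · exact_mod_cast (le_max_left _ _).trans (le_max_left _ _)
  · exact (le_max_right _ _).trans (le_max_left _ _)
  · exact (le_max_left _ _).trans (le_max_right _ _)
  · exact (le_max_right _ _).trans (le_max_right _ _)

theorem Lift.exists_coordMoment_bound (S : Matrix (Fin 2) (Fin 2) ℝ) (M : ℤ) :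
    ∃ B : ℝ, ∀ {V E : Type} [Fintype V] [DecidableEq V] [Fintype E]
      (Γ : TropCurve S V E) (L : Γ.Lift), L.BoundedBy M → ∀ i j, |L.coordMoment i j| ≤ B := by
  obtain ⟨K, hK, hK'⟩ := exists_norm_mulVec_le S⁻¹
  refine ⟨M * ((M * (K * M) + M * (K * M)) * M), fun {V E} _ _ _ Γ L hM i j => ?_⟩
  have hM0 : (0 : ℝ) ≤ M := by exact_mod_cast le_trans (by positivity) hM.card_le
  have hσ : ∀ e l, |Γ.coordSlope e l| ≤ K * M := by
    intro e l
    calc |Γ.coordSlope e l| ≤ ‖Γ.coordSlope e‖ := norm_le_pi_norm (Γ.coordSlope e) l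
      _ ≤ K * ‖toReal (Γ.slope e)‖ := hK' _
      _ ≤ K * M := by
        gcongr
        rw [pi_norm_le_iff_of_nonneg hM0]
        intro k
        rw [Real.norm_eq_abs]
        exact (by exact_mod_cast hM.slope_le e k : |(Γ.slope e k : ℝ)| ≤ M)
  have hterm : ∀ e ∈ Finset.univ, |(L.coord (Γ.src e) i * Γ.coordSlope e j -
      L.coord (Γ.src e) j * Γ.coordSlope e i) * L.shift e j| ≤
      (M * (K * M) + M * (K * M)) * M := by
    intro e _
    rw [abs_mul]
    refine mul_le_mul ((abs_sub _ _).trans (add_le_add ?_ ?_)) ?_ (abs_nonneg _) (by positivity)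
    · rw [abs_mul]
      exact mul_le_mul (hM.coord_le _ _) (hσ _ _) (abs_nonneg _) hM0
    · rw [abs_mul]
      exact mul_le_mul (hM.coord_le _ _) (hσ _ _) (abs_nonneg _) hM0
    · exact_mod_cast hM.shift_le e j
  refine (Finset.abs_sum_le_sum_abs _ _).trans ((Finset.sum_le_card_nsmul _ _ _ hterm).trans ?_)
  rw [nsmul_eq_mul]
  refine mul_le_mul_of_nonneg_right ?_ (by positivity)
  have := hM.card_le
  rw [Finset.card_univ]
  exact_mod_cast this

/-- The curves of a given class that are linearly equivalent to a given one have only finitely many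
moments, as long as their lifts remain bounded. -/
theorem exists_finite_coordMoment (hS : S.det ≠ 0) {C : Matrix (Fin 2) (Fin 2) ℤ}
    {V₀ E₀ : Type} [Fintype V₀] [DecidableEq V₀] [Fintype E₀] (Γ₀ : TropCurve S V₀ E₀)
    (hC₀ : Γ₀.HasDegree C) (M : ℤ) :
    ∃ F : Set ℝ, F.Finite ∧ ∀ {V E : Type} [Fintype V] [DecidableEq V] [Fintype E]
      (Γ : TropCurve S V E) (L : Γ.Lift), Γ.HasDegree C → L.BoundedBy M →
      Γ.LinearlyEquivalent Γ₀ → ∀ i j, i ≠ j → L.coordMoment i j ∈ F := by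
  obtain ⟨_, _, h⟩ := exists_bounded_lift hS
  obtain ⟨L₀, -⟩ := h Γ₀
  obtain ⟨M₀, hM₀⟩ := L₀.exists_boundedBy
  set M' := max M M₀
  set Y := M' * (((8 * M' + 8) * (2 * M' + 2) + (M' + 1) * M') * M')
  obtain ⟨B, hB⟩ := Lift.exists_coordMoment_bound S M'
  obtain ⟨K, hK, hK'⟩ := exists_norm_mulVec_le S⁻¹
  set R : ℝ := |S.det| * (B + B + 2 * (K * (2 * Y)))
  obtain ⟨T, hT⟩ := exists_abs_le_of_norm_mulVec_le (S := S.transpose)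
    (by rwa [Matrix.det_transpose]) R
  let A : ℤ → Set (Fin 2 → ℤ) := fun Y => {y | ∀ i, |y i| ≤ Y}
  let φ : Fin 2 × Fin 2 → ((Fin 2 → ℤ) × (Fin 2 → ℤ)) × (Fin 2 → ℤ) → ℝ := fun q r =>
    L₀.coordMoment q.1 q.2 + S⁻¹.mulVec (toReal r.1.1) q.2 + S⁻¹.mulVec (toReal r.1.2) q.1 -
      dotProduct (toReal r.2) (S.mulVec (Pi.single q.1 1)) / |S.det|
  refine ⟨⋃ q, φ q '' ((A (2 * Y) ×ˢ A (2 * Y)) ×ˢ A T), ?_, ?_⟩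
  · exact finite_iUnion fun q => ((((finite_setOf_abs_le _).prod (finite_setOf_abs_le _))).prod
      (finite_setOf_abs_le _)).image _
  · rintro V E _ _ _ Γ L hC hM ⟨Θ, Θ₀, hΘ, hΘ₀, m, hm⟩
    have hM' : L.BoundedBy M' := hM.mono (le_max_left _ _)
    have hM₀' : L₀.BoundedBy M' := hM₀.mono (le_max_right _ _)
    have hY0 : 0 ≤ Y := by
      have : 0 ≤ M' := le_trans (by positivity) hM'.card_le
      positivity
    obtain ⟨ξ, hξ, hξL, hξL₀⟩ := exists_generic L L₀ hS
    obtain ⟨n, hn⟩ := L.theta_add_period_eq hS hC hΘ hξL hξ hM'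
    obtain ⟨n₀, hn₀⟩ := L₀.theta_add_period_eq hS hC₀ hΘ₀ hξL₀ hξ hM₀'
    have hdet : |S.det| ≠ 0 := abs_ne_zero.2 hS
    -- Difference of the two period formulas at a common generic `ξ`: the terms in `ξ` cancel
    -- because both curves have class `C`.
    have key : ∀ i j, i ≠ j → ∃ y y' : Fin 2 → ℤ, y ∈ A (2 * Y) ∧ y' ∈ A (2 * Y) ∧
        dotProduct (toReal (m - n + n₀)) (S.mulVec (Pi.single i 1)) =
          |S.det| * (L₀.coordMoment i j - L.coordMoment i j + S⁻¹.mulVec (toReal y) j +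
            S⁻¹.mulVec (toReal y') i) := by
      intro i j hij
      obtain ⟨y, y', hy, hy', h1⟩ := hn i j hij
      obtain ⟨y₀, y₀', hy₀, hy₀', h2⟩ := hn₀ i j hij
      have h3 := hm (S.mulVec (Pi.single i 1)) ⟨Pi.single i 1, by
        congr 1
        ext l
        simp [toReal, Pi.single_apply]⟩ (S.mulVec ξ)
      refine ⟨y - y₀, y' - y₀', fun k => ?_, fun k => ?_, ?_⟩
      · exact (abs_sub _ _).trans (by linarith [hy k, hy₀ k])
      · exact (abs_sub _ _).trans (by linarith [hy' k, hy₀' k])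
      · rw [h1, h2] at h3
        rw [toReal_add, toReal_sub, toReal_sub, toReal_sub, Matrix.mulVec_sub, Matrix.mulVec_sub,
          add_dotProduct, sub_dotProduct, Pi.sub_apply, Pi.sub_apply]
        linear_combination -h3
    -- No bound is known for `m`, `n` and `n₀` separately. In `key` all other terms are bounded, so
    -- the pairings of this integral vector with the two periods are bounded, and it lies in a
    -- finite set.
    have hk : m - n + n₀ ∈ A T := by
      refine hT _ ((pi_norm_le_iff_of_nonneg ?_).2 fun i => ?_)
      · have : 0 ≤ B := (abs_nonneg _).trans (hB Γ L hM' 0 0)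
        have : (0 : ℝ) ≤ Y := by exact_mod_cast hY0
        positivity
      · obtain ⟨j, hij⟩ : ∃ j : Fin 2, i ≠ j := ⟨i + 1, by fin_cases i <;> decide⟩
        obtain ⟨y, y', hy, hy', h1⟩ := key i j hij
        have h2 : S.transpose.mulVec (toReal (m - n + n₀)) i =
            dotProduct (toReal (m - n + n₀)) (S.mulVec (Pi.single i 1)) := by
          rw [Matrix.mulVec_single_one, Matrix.mulVec, dotProduct_comm]
          rfl
        have h3 : ∀ z ∈ A (2 * Y), ∀ l, |S⁻¹.mulVec (toReal z) l| ≤ K * (2 * Y) := by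
          intro z hz l
          calc |S⁻¹.mulVec (toReal z) l| ≤ ‖S⁻¹.mulVec (toReal z)‖ :=
              norm_le_pi_norm (S⁻¹.mulVec (toReal z)) l
            _ ≤ K * ‖toReal z‖ := hK' _
            _ ≤ K * (2 * Y) := by
              gcongr
              refine (pi_norm_le_iff_of_nonneg ?_).2 fun i => ?_
              · exact_mod_cast (by positivity : 0 ≤ 2 * Y)
              · rw [Real.norm_eq_abs]
                exact (by exact_mod_cast hz i : |(z i : ℝ)| ≤ 2 * Y)
        rw [h2, h1, Real.norm_eq_abs, abs_mul, abs_abs]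
        refine mul_le_mul_of_nonneg_left ?_ (abs_nonneg _)
        have h4 := h3 y hy j
        have h5 := h3 y' hy' i
        have h6 := hB Γ L hM' i j
        have h7 := hB Γ₀ L₀ hM₀' i j
        rw [abs_le] at *
        constructor <;> linarith [h4.1, h4.2, h5.1, h5.2, h6.1, h6.2, h7.1, h7.2]
    intro i j hij
    obtain ⟨y, y', hy, hy', h1⟩ := key i j hij
    refine mem_iUnion.2 ⟨(i, j), ((y, y'), m - n + n₀), ⟨⟨hy, hy'⟩, hk⟩, ?_⟩
    simp only [φ, h1]
    field_simp
    ring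

/-- The moment of a lift; its variation along a deformation is the class in `H₁(𝕋A, ℝ)` of the
`1`-cycle of the displacements of the edges. -/
noncomputable def Lift.moment {Γ : TropCurve S V E} (L : Γ.Lift) (j : Fin 2) : ℝ :=
  ∑ e, planeDet (L.pos (Γ.src e)) (toReal (Γ.slope e)) * L.shift e j

theorem Lift.planeDet_pos_slope {Γ : TropCurve S V E} (L : Γ.Lift) (hS : S.det ≠ 0) (v : V)
    (e : E) : planeDet (L.pos v) (toReal (Γ.slope e)) =
      S.det * (L.coord v 0 * Γ.coordSlope e 1 - L.coord v 1 * Γ.coordSlope e 0) := by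
  rw [← mulVec_inv_mulVec hS (L.pos v), ← mulVec_inv_mulVec hS (toReal (Γ.slope e)),
    planeDet_mulVec]
  rfl

/-- The passage to the basis of periods multiplies determinants by `S.det`; the two coordinates get
opposite signs because `planeDet` fixes the order of the axes. -/
theorem exists_finite_moment (hS : S.det ≠ 0) {C : Matrix (Fin 2) (Fin 2) ℤ}
    {V₀ E₀ : Type} [Fintype V₀] [DecidableEq V₀] [Fintype E₀] (Γ₀ : TropCurve S V₀ E₀)
    (hC₀ : Γ₀.HasDegree C) (M : ℤ) :
    ∃ F : Set ℝ, F.Finite ∧ ∀ {V E : Type} [Fintype V] [DecidableEq V] [Fintype E]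
      (Γ : TropCurve S V E) (L : Γ.Lift), Γ.HasDegree C → L.BoundedBy M →
      Γ.LinearlyEquivalent Γ₀ → ∀ j, L.moment j ∈ F := by
  obtain ⟨F, hF, h⟩ := exists_finite_coordMoment hS Γ₀ hC₀ M
  refine ⟨(fun x => S.det * x) '' F ∪ (fun x => -S.det * x) '' F,
    (hF.image _).union (hF.image _), fun Γ L hC hM hl j => ?_⟩
  fin_cases j
  · refine Or.inr ⟨_, h Γ L hC hM hl 1 0 (by decide), ?_⟩
    simp only [Lift.moment, Lift.coordMoment, L.planeDet_pos_slope hS, Finset.mul_sum]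
    exact Finset.sum_congr rfl fun e _ => by simp; ring
  · refine Or.inl ⟨_, h Γ L hC hM hl 0 1 (by decide), ?_⟩
    simp only [Lift.moment, Lift.coordMoment, L.planeDet_pos_slope hS, Finset.mul_sum]
    exact Finset.sum_congr rfl fun e _ => by simp; ring

end TropCurve

/-! ### Deformations of marked curves and the evaluation map -/

/-- The image of the bounded part of an affine subspace under a linear map that does not map its
direction onto the target is compact and has measure zero. -/
theorem isCompact_and_volume_image_eq_zero {X Y Z : Type*} [NormedAddCommGroup X]
    [NormedSpace ℝ X] [FiniteDimensional ℝ X] [NormedAddCommGroup Y] [NormedSpace ℝ Y]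
    [NormedAddCommGroup Z] [NormedSpace ℝ Z] [FiniteDimensional ℝ Z]
    [MeasurableSpace Z] [BorelSpace Z] (μ : Measure Z) [μ.IsAddHaarMeasure]
    (c : X →ₗ[ℝ] Y) (ev : X →ₗ[ℝ] Z) (r : Y) (R : ℝ) (h : (LinearMap.ker c).map ev ≠ ⊤) :
    IsCompact (ev '' (Metric.closedBall 0 R ∩ c ⁻¹' {r})) ∧
      μ (ev '' (Metric.closedBall 0 R ∩ c ⁻¹' {r})) = 0 := by
  have := FiniteDimensional.proper_real X
  have hc : Continuous c := c.continuous_of_finiteDimensional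
  have hev : Continuous ev := ev.continuous_of_finiteDimensional
  refine ⟨((isCompact_closedBall 0 R).inter_right (isClosed_singleton.preimage hc)).image hev, ?_⟩
  rcases (Metric.closedBall (0 : X) R ∩ c ⁻¹' {r}).eq_empty_or_nonempty with h0 | ⟨x₀, -, hx₀⟩
  · rw [h0, image_empty, measure_empty]
  -- The image lies in a translate of the image of the direction space, a proper affine subspace.
  · have hne : AffineSubspace.mk' (ev x₀) ((LinearMap.ker c).map ev) ≠ ⊤ := by
      intro h1
      apply h
      rw [← AffineSubspace.direction_mk' (ev x₀) ((LinearMap.ker c).map ev), h1,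
        AffineSubspace.direction_top]
    refine measure_mono_null ?_ (Measure.addHaar_affineSubspace μ _ hne)
    rintro _ ⟨x, ⟨-, hx⟩, rfl⟩
    rw [SetLike.mem_coe, AffineSubspace.mem_mk', vsub_eq_sub, ← map_sub]
    refine Submodule.mem_map_of_mem ?_
    rw [LinearMap.mem_ker, map_sub, hx, hx₀, sub_self]

section Deformation

variable {V E : Type} [Fintype E] {n : ℕ}

/-- An infinitesimal deformation of a curve: the velocities `δ` of the vertices and `m` of the
edge lengths, such that the slopes and the linear equivalence class are preserved. -/
structure IsDeformation (src tgt : E → V) (s a : E → Fin 2 → ℤ) (δ : V → Fin 2 → ℝ)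
    (m : E → ℝ) : Prop where
  src_add : ∀ e, δ (src e) + m e • toReal (s e) = δ (tgt e)
  moment : ∀ j, ∑ e, planeDet (δ (src e)) (toReal (s e)) * a e j = 0

/-- The positions of marked points on a curve, given the vertices or edges that contain them, and
their parameters on the edges. -/
def markPos (src : E → V) (s : E → Fin 2 → ℤ) (ε : Fin n → V ⊕ E) (p : V → Fin 2 → ℝ)
    (τ : Fin n → ℝ) (i : Fin n) : Fin 2 → ℝ :=
  Sum.elim p (fun e => p (src e) + τ i • toReal (s e)) (ε i)

/-- The marked points can be moved independently in all directions. -/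
def IsRegularMarking (src tgt : E → V) (s a : E → Fin 2 → ℤ) (ε : Fin n → V ⊕ E) : Prop :=
  ∀ y : Fin n → Fin 2 → ℝ, ∃ δ m τ, IsDeformation src tgt s a δ m ∧ markPos src s ε δ τ = y

/-- The linear conditions on deformations. -/
def deformationConstraint (src tgt : E → V) (s a : E → Fin 2 → ℤ) (n : ℕ) :
    ((V → Fin 2 → ℝ) × (E → ℝ) × (Fin n → ℝ)) →ₗ[ℝ] (E → Fin 2 → ℝ) × (Fin 2 → ℝ) where
  toFun x := (fun e => x.1 (src e) + x.2.1 e • toReal (s e) - x.1 (tgt e),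
    fun j => ∑ e, planeDet (x.1 (src e)) (toReal (s e)) * a e j)
  map_add' x y := by
    ext
    · simp only [Prod.fst_add, Prod.snd_add, Pi.add_apply, Pi.sub_apply, Pi.smul_apply,
        smul_eq_mul]
      ring
    · simp only [Prod.fst_add, Prod.snd_add, Pi.add_apply, planeDet_add_left, add_mul,
        Finset.sum_add_distrib]
  map_smul' r x := by
    ext
    · simp only [Prod.smul_fst, Prod.smul_snd, Pi.add_apply, Pi.sub_apply, Pi.smul_apply,
        smul_eq_mul, RingHom.id_apply]
      ring
    · simp only [Prod.smul_fst, Prod.smul_snd, Pi.smul_apply, planeDet_smul_left, mul_assoc,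
        smul_eq_mul, RingHom.id_apply, Finset.mul_sum]

/-- The positions of the marked points, as a linear map. -/
def markPosLinear (src : E → V) (s : E → Fin 2 → ℤ) (ε : Fin n → V ⊕ E) :
    ((V → Fin 2 → ℝ) × (E → ℝ) × (Fin n → ℝ)) →ₗ[ℝ] (Fin n → Fin 2 → ℝ) where
  toFun x := markPos src s ε x.1 x.2.2
  map_add' x y := by
    ext i k
    rcases h : ε i with v | e
    · simp [markPos, h]
    · simp only [markPos, h, Sum.elim_inr, Prod.fst_add, Prod.snd_add, Pi.add_apply,
        Pi.smul_apply, smul_eq_mul]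
      ring
  map_smul' r x := by
    ext i k
    rcases h : ε i with v | e
    · simp [markPos, h]
    · simp only [markPos, h, Sum.elim_inr, Prod.smul_fst, Prod.smul_snd, Pi.add_apply,
        Pi.smul_apply, smul_eq_mul, RingHom.id_apply]
      ring

theorem isRegularMarking_of_map_ker_eq_top {src tgt : E → V} {s a : E → Fin 2 → ℤ}
    {ε : Fin n → V ⊕ E}
    (h : (LinearMap.ker (deformationConstraint src tgt s a n)).map (markPosLinear src s ε) = ⊤) :
    IsRegularMarking src tgt s a ε := by
  intro y
  have hy : y ∈ (LinearMap.ker (deformationConstraint src tgt s a n)).map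
    (markPosLinear src s ε) := h ▸ Submodule.mem_top
  obtain ⟨x, hx, rfl⟩ := hy
  have hx' := LinearMap.mem_ker.1 hx
  refine ⟨x.1, x.2.1, x.2.2, ⟨fun e => ?_, fun j => ?_⟩, rfl⟩
  · exact sub_eq_zero.1 (congrFun (congrArg Prod.fst hx') e)
  · exact congrFun (congrArg Prod.snd hx') j

/-- Relabelling vertices and edges by `Fin` allows the combinatorial types to be enumerated by a
finite set. -/
theorem IsRegularMarking.of_equiv {V' E' : Type} [Fintype E'] {src tgt : E → V}
    {s a : E → Fin 2 → ℤ} {ε : Fin n → V ⊕ E} (φ : V ≃ V') (ψ : E ≃ E')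
    (h : IsRegularMarking (φ ∘ src ∘ ψ.symm) (φ ∘ tgt ∘ ψ.symm) (s ∘ ψ.symm) (a ∘ ψ.symm)
      (fun i => Sum.map φ ψ (ε i))) : IsRegularMarking src tgt s a ε := by
  intro y
  obtain ⟨δ, m, τ, hδ, hy⟩ := h y
  refine ⟨δ ∘ φ, m ∘ ψ, τ, ⟨fun e => ?_, fun j => ?_⟩, ?_⟩
  · simpa using hδ.src_add (ψ e)
  · rw [← hδ.moment j]
    exact Fintype.sum_equiv ψ _ _ fun e => by simp
  · rw [← hy]
    ext i : 1
    rcases hε : ε i with v | e <;> simp [markPos, hε]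

end Deformation

/-! ### Generic configurations on the torus -/

theorem isClosed_periodLattice {S : Matrix (Fin 2) (Fin 2) ℝ} (hS : S.det ≠ 0) :
    IsClosed (periodLattice S : Set (Fin 2 → ℝ)) := by
  have h : (periodLattice S : Set (Fin 2 → ℝ)) =
      (fun x => S⁻¹.mulVec x) ⁻¹' (range fun z : Fin 2 → ℤ => toReal z) := by
    ext x
    constructor
    · rintro ⟨l, rfl⟩
      exact ⟨l, (inv_mulVec_mulVec hS _).symm⟩
    · rintro ⟨l, hl⟩
      refine ⟨l, ?_⟩
      change toReal l = _ at hl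
      rw [hl, mulVec_inv_mulVec hS]
  rw [h]
  refine IsClosed.preimage (by fun_prop) ?_
  have h2 : (range fun z : Fin 2 → ℤ => toReal z) =
      ⋂ i, (fun x : Fin 2 → ℝ => x i) ⁻¹' range ((↑) : ℤ → ℝ) := by
    ext x
    simp only [mem_range, mem_iInter, mem_preimage]
    constructor
    · rintro ⟨z, rfl⟩ i
      exact ⟨z i, rfl⟩
    · intro h
      choose z hz using h
      exact ⟨z, funext hz⟩
  rw [h2]
  exact isClosed_iInter fun i =>
    Int.isClosedEmbedding_coe_real.isClosed_range.preimage (continuous_apply i)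

theorem t2Space_tropTorus {S : Matrix (Fin 2) (Fin 2) ℝ} (hS : S.det ≠ 0) :
    T2Space (TropTorus S) := by
  have : IsClosed (periodLattice S : Set (Fin 2 → ℝ)) := isClosed_periodLattice hS
  infer_instance

/-- Generic configurations avoid the image in the torus of a compact set of measure zero. -/
theorem holdsGenerically_of_isCompact {S : Matrix (Fin 2) (Fin 2) ℝ} (hS : S.det ≠ 0) {n : ℕ}
    {B : Set (Fin n → Fin 2 → ℝ)} (hB : IsCompact B) (hB0 : volume B = 0)
    {Q : (Fin n → TropTorus S) → Prop}
    (hQ : ∀ P, (∀ p ∈ B, (fun i => torusMk S (p i)) ≠ P) → Q P) : HoldsGenerically S n Q := by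
  have := t2Space_tropTorus hS
  let π : (Fin n → Fin 2 → ℝ) → Fin n → TropTorus S := fun p i => torusMk S (p i)
  have hπ : Continuous π := continuous_pi fun i => continuous_torusMk.comp (continuous_apply i)
  have hsurj : Function.Surjective π := by
    intro P
    choose p hp using fun i => torusMk_surjective (P i)
    exact ⟨p, funext hp⟩
  have hnull : volume {p : Fin n → Fin 2 → ℝ | π p ∉ (π '' B)ᶜ} = 0 := by
    -- The preimage of the image of `B` is covered by the countably many lattice translates of `B`.
    have hsub : {p : Fin n → Fin 2 → ℝ | π p ∉ (π '' B)ᶜ} ⊆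
        ⋃ l : Fin n → Fin 2 → ℤ, (fun p => (fun i => S.mulVec (toReal (l i))) + p) ⁻¹' B := by
      intro p hp
      rw [mem_ofPred_eq, mem_compl_iff, not_not] at hp
      obtain ⟨q, hq, hqp⟩ := hp
      choose l hl using fun i => torusMk_eq_iff.1 (congrFun hqp i)
      refine mem_iUnion.2 ⟨l, ?_⟩
      have : q = (fun i => S.mulVec (toReal (l i))) + p := by
        ext i : 1
        rw [hl i, Pi.add_apply, add_comm]
      rwa [mem_preimage, ← this]
    refine measure_mono_null hsub (measure_iUnion_null fun l => ?_)
    rw [measure_preimage_add, hB0]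
  refine ⟨(π '' B)ᶜ, (hB.image hπ).isClosed.isOpen_compl, ?_, hnull, fun P hP => hQ P ?_⟩
  · have hd : Dense {p : Fin n → Fin 2 → ℝ | π p ∈ (π '' B)ᶜ} :=
      Measure.dense_of_ae (μ := volume) hnull
    refine (hsurj.denseRange.dense_image hπ hd).mono ?_
    rintro _ ⟨p, hp, rfl⟩
    exact hp
  · exact fun p hp h => hP ⟨p, hp, h⟩

theorem finrank_range_add_finrank_ker_int {A B : Type} [AddCommGroup A] [AddCommGroup B]
    [Module.Finite ℤ A] (f : A →ₗ[ℤ] B) :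
    Module.finrank ℤ (LinearMap.range f) + Module.finrank ℤ (LinearMap.ker f) =
      Module.finrank ℤ A := by
  rw [← f.quotKerEquivRange.finrank_eq]
  exact Submodule.finrank_quotient_add_finrank _

/-! ### Finitely many combinatorial types; regularity of generic markings -/

namespace TropCurve

variable {S : Matrix (Fin 2) (Fin 2) ℝ} {V E : Type} [Fintype V] [DecidableEq V] [Fintype E]

theorem three_mul_card_le (Γ : TropCurve S V E) : 3 * Fintype.card V ≤ 2 * Fintype.card E := by
  have h1 : ∀ f : E → V, ∑ v, (Finset.univ.filter fun e => f e = v).card = Fintype.card E := by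
    intro f
    exact (Finset.card_eq_sum_card_fiberwise fun _ _ => Finset.mem_univ _).symm
  calc 3 * Fintype.card V = ∑ _v : V, 3 := by simp [mul_comm]
    _ ≤ ∑ v, ((Finset.univ.filter fun e => Γ.src e = v).card +
      (Finset.univ.filter fun e => Γ.tgt e = v).card) :=
      Finset.sum_le_sum fun v _ => Γ.valence_ge v
    _ = 2 * Fintype.card E := by rw [Finset.sum_add_distrib, h1, h1, two_mul]

theorem genus_eq_finrank_ker (Γ : TropCurve S V E) :
    Γ.genus = Module.finrank ℤ (LinearMap.ker (graphBoundary ℤ Γ.src Γ.tgt)) := by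
  let f : Γ.H1 ≃+ LinearMap.ker (graphBoundary ℤ Γ.src Γ.tgt) :=
    { toFun := fun c => ⟨c.1, mem_H1_iff.1 c.2⟩
      invFun := fun c => ⟨c.1, mem_H1_iff.2 c.2⟩
      left_inv := fun _ => rfl
      right_inv := fun _ => rfl
      map_add' := fun _ _ => rfl }
  exact f.toIntLinearEquiv.finrank_eq

/-- Boundaries have coordinate sum zero, so the boundary map has rank at most one less than the
number of vertices. Connectedness is not needed for this inequality. -/
theorem card_edges_add_one_le [Nonempty V] (Γ : TropCurve S V E) :
    Fintype.card E + 1 ≤ Γ.genus + Fintype.card V := by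
  let σ : (V → ℤ) →ₗ[ℤ] ℤ := ∑ v, LinearMap.proj v
  have hσ : ∀ f, σ f = ∑ v, f v := fun f => by simp [σ]
  have hsub : LinearMap.range (graphBoundary ℤ Γ.src Γ.tgt) ≤ LinearMap.ker σ := by
    rintro _ ⟨c, rfl⟩
    rw [LinearMap.mem_ker, hσ]
    have := sum_graphBoundary_smul Γ.src Γ.tgt c fun _ => (1 : ℤ)
    simpa using this
  have h1 := finrank_range_add_finrank_ker_int (graphBoundary ℤ Γ.src Γ.tgt)
  have h2 := finrank_range_add_finrank_ker_int σ
  have hsurj : LinearMap.range σ = ⊤ := by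
    rw [LinearMap.range_eq_top]
    intro k
    obtain ⟨v⟩ := ‹Nonempty V›
    exact ⟨Pi.single v k, by rw [hσ]; simp⟩
  rw [hsurj, finrank_top, Module.finrank_self, Module.finrank_pi] at h2
  rw [← genus_eq_finrank_ker, Module.finrank_pi] at h1
  have h3 := Submodule.finrank_mono hsub
  omega

theorem card_edges_le (Γ : TropCurve S V E) : Fintype.card E ≤ 3 * Γ.genus := by
  rcases isEmpty_or_nonempty V with h | h
  · have : IsEmpty E := ⟨fun e => h.elim (Γ.src e)⟩
    simp
  · have h1 := Γ.card_edges_add_one_le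
    have h2 := Γ.three_mul_card_le
    omega

/-- The genus bounds the number of edges and the class bounds lengths and slopes. The relation
between the two ends of a lifted edge then bounds its shift. -/
theorem Lift.exists_uniform_bound (hS : S.det ≠ 0) (C : Matrix (Fin 2) (Fin 2) ℤ) (g : ℕ)
    (K : ℝ) : ∃ M : ℤ, ∀ {V E : Type} [Fintype V] [DecidableEq V] [Fintype E]
      (Γ : TropCurve S V E) (L : Γ.Lift), Γ.genus = g → Γ.HasDegree C →
      (∀ v, ‖L.pos v‖ ≤ K) → L.BoundedBy M := by
  obtain ⟨K', hK', h1⟩ := exists_norm_mulVec_le S⁻¹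
  obtain ⟨B, hB⟩ := exists_slope_bound hS C
  set T := ∑ j, S.mulVec (toReal (C j)) j with hT
  obtain ⟨A, hA⟩ := exists_abs_le_of_norm_mulVec_le hS (K + |T| * |(B : ℝ)| + K)
  refine ⟨max (max ⌈K' * K⌉ A) (max B (3 * g : ℕ)), fun Γ L hg hC hL => ⟨fun v i => ?_,
    fun e i => ?_, fun e i => ?_, ?_⟩⟩
  · have h2 : |L.coord v i| ≤ ⌈K' * K⌉ := calc
      |L.coord v i| ≤ ‖L.coord v‖ := norm_le_pi_norm (L.coord v) i
      _ ≤ K' * ‖L.pos v‖ := h1 _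
      _ ≤ K' * K := by gcongr; exact hL v
      _ ≤ _ := Int.le_ceil _
    refine h2.trans ?_
    exact_mod_cast (le_max_left _ _).trans (le_max_left _ _)
  · refine (hA _ ?_ i).trans ((le_max_right _ _).trans (le_max_left _ _))
    have h2 : S.mulVec (toReal (L.shift e)) =
        L.pos (Γ.src e) + Γ.length e • toReal (Γ.slope e) - L.pos (Γ.tgt e) := by
      rw [L.pos_src_add]; abel
    rw [h2]
    refine (norm_sub_le _ _).trans (add_le_add ((norm_add_le _ _).trans
      (add_le_add (hL _) ?_)) (hL _))
    rw [norm_smul, Real.norm_eq_abs]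
    refine mul_le_mul ?_ ?_ (norm_nonneg _) (abs_nonneg _)
    · rw [abs_of_pos (Γ.length_pos e)]
      exact (Γ.length_le hC e).trans (le_abs_self _)
    · refine (pi_norm_le_iff_of_nonneg (abs_nonneg _)).2 fun k => ?_
      refine le_trans ?_ (le_abs_self _)
      exact (by exact_mod_cast hB Γ hC e k : |(Γ.slope e k : ℝ)| ≤ B)
  · exact (hB Γ hC e i).trans ((le_max_left _ _).trans (le_max_right _ _))
  · refine le_trans ?_ ((le_max_right _ _).trans (le_max_right _ _))
    rw [← hg]
    exact_mod_cast Γ.card_edges_le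

/-- For a generic configuration, all marked curves through it are regular. -/
theorem holdsGenerically_isRegularMarking (hS : S.det ≠ 0) {C : Matrix (Fin 2) (Fin 2) ℤ}
    {V₀ E₀ : Type} [Fintype V₀] [DecidableEq V₀] [Fintype E₀] (Γ₀ : TropCurve S V₀ E₀)
    (hC₀ : Γ₀.HasDegree C) (g n : ℕ) (K : ℝ) :
    HoldsGenerically S n fun P => ∀ (V E : Type) [Fintype V] [DecidableEq V] [Fintype E]
      (Γ : TropCurve S V E) (L : Γ.Lift), Γ.genus = g → Γ.HasDegree C →
      Γ.LinearlyEquivalent Γ₀ → (∀ v, ‖L.pos v‖ ≤ K) → ∀ (ε : Fin n → V ⊕ E) (τ : Fin n → ℝ),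
      (∀ i, |τ i| ≤ ∑ j, S.mulVec (toReal (C j)) j) →
      (∀ i, torusMk S (markPos Γ.src Γ.slope ε L.pos τ i) = P i) →
      IsRegularMarking Γ.src Γ.tgt Γ.slope L.shift ε := by
  obtain ⟨M, hM⟩ := Lift.exists_uniform_bound hS C g K
  obtain ⟨F, hF, hFΓ⟩ := exists_finite_moment hS Γ₀ hC₀ M
  set T := ∑ j, S.mulVec (toReal (C j)) j with hT
  let R := max |K| |T|
  let A : (k : ℕ) → Set (Fin k → Fin 2 → ℤ) := fun k => Set.pi univ fun _ => {y | ∀ i, |y i| ≤ M}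
  have hA : ∀ k, (A k).Finite := fun k => Set.Finite.pi fun _ => finite_setOf_abs_le M
  let W : Set (Fin 2 → ℝ) := Set.pi univ fun _ => F
  have hW : W.Finite := Set.Finite.pi fun _ => hF
  -- The positions of the marked points for one irregular combinatorial type and one value `w` of
  -- the moment; the set is empty for regular types. The conditions on the data below make the union
  -- finite.
  let Bd : (nv ne : ℕ) → (Fin ne → Fin nv) → (Fin ne → Fin nv) → (Fin ne → Fin 2 → ℤ) →
      (Fin ne → Fin 2 → ℤ) → (Fin n → Fin nv ⊕ Fin ne) → (Fin 2 → ℝ) →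
      Set (Fin n → Fin 2 → ℝ) := fun nv ne src tgt s a ε w =>
    {y | ¬ IsRegularMarking src tgt s a ε ∧ y ∈ markPosLinear src s ε ''
      (Metric.closedBall 0 R ∩ deformationConstraint src tgt s a n ⁻¹'
        {(fun e => S.mulVec (toReal (a e)), w)})}
  have hBd : ∀ nv ne src tgt s a ε w, IsCompact (Bd nv ne src tgt s a ε w) ∧
      volume (Bd nv ne src tgt s a ε w) = 0 := by
    intro nv ne src tgt s a ε w
    by_cases h : IsRegularMarking src tgt s a ε
    · simp [Bd, h]
    · simp only [Bd, h, not_false_eq_true, true_and]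
      exact isCompact_and_volume_image_eq_zero volume _ _ _ _
        fun h' => h (isRegularMarking_of_map_ker_eq_top h')
  have hun : ∀ {ι : Type} (I : Set ι) (f : ι → Set (Fin n → Fin 2 → ℝ)), I.Finite →
      (∀ i, IsCompact (f i) ∧ volume (f i) = 0) →
      IsCompact (⋃ i ∈ I, f i) ∧ volume (⋃ i ∈ I, f i) = 0 := fun I f hI h =>
    ⟨hI.isCompact_biUnion fun i _ => (h i).1,
      (measure_biUnion_null_iff hI.countable).2 fun i _ => (h i).2⟩
  have hB := hun (Iic (3 * g)) _ (finite_Iic _) fun nv => hun (Iic (3 * g)) _ (finite_Iic _)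
    fun ne => hun univ _ finite_univ fun src => hun univ _ finite_univ fun tgt =>
    hun (A ne) _ (hA ne) fun s => hun (A ne) _ (hA ne) fun a => hun univ _ finite_univ fun ε =>
    hun W _ hW fun w => hBd nv ne src tgt s a ε w
  refine holdsGenerically_of_isCompact hS hB.1 hB.2 fun P hP V E _ _ _ Γ L hg hC hlin hL ε τ hτ
    hε => ?_
  have hLM := hM Γ L hg hC hL
  have hE : Fintype.card E ≤ 3 * g := hg ▸ Γ.card_edges_le
  have hV : Fintype.card V ≤ 3 * g := by have := Γ.three_mul_card_le; omega
  let φ := Fintype.equivFin V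
  let ψ := Fintype.equivFin E
  refine IsRegularMarking.of_equiv φ ψ ?_
  by_contra hreg
  refine hP (markPos Γ.src Γ.slope ε L.pos τ) ?_ (funext hε)
  simp only [mem_iUnion]
  refine ⟨_, hV, _, hE, φ ∘ Γ.src ∘ ψ.symm, mem_univ _, φ ∘ Γ.tgt ∘ ψ.symm, mem_univ _,
    Γ.slope ∘ ψ.symm, fun e _ i => hLM.slope_le _ i, L.shift ∘ ψ.symm,
    fun e _ i => hLM.shift_le _ i, fun i => Sum.map φ ψ (ε i), mem_univ _, L.moment,
    fun j _ => hFΓ Γ L hC hLM hlin j, hreg,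
    (L.pos ∘ φ.symm, Γ.length ∘ ψ.symm, τ), ⟨?_, ?_⟩, ?_⟩
  · rw [mem_closedBall_zero_iff, Prod.norm_def, Prod.norm_def]
    have hR : 0 ≤ R := (abs_nonneg K).trans (le_max_left _ _)
    refine max_le ?_ (max_le ?_ ?_)
    · refine (pi_norm_le_iff_of_nonneg hR).2 fun v => ?_
      exact (hL _).trans ((le_abs_self _).trans (le_max_left _ _))
    · refine (pi_norm_le_iff_of_nonneg hR).2 fun e => ?_
      refine (abs_of_pos (Γ.length_pos (ψ.symm e))).le.trans ?_
      exact (Γ.length_le hC _).trans ((le_abs_self _).trans (le_max_right _ _))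
    · refine (pi_norm_le_iff_of_nonneg hR).2 fun i => ?_
      exact (hτ i).trans ((le_abs_self _).trans (le_max_right _ _))
  · refine Prod.ext (funext fun e => ?_) (funext fun j => ?_)
    · simp [deformationConstraint, L.pos_src_add]
    · simp only [deformationConstraint, Lift.moment, LinearMap.coe_mk, AddHom.coe_mk]
      exact Fintype.sum_equiv ψ.symm _ _ fun e => by simp
  · ext i : 1
    rcases h : ε i with v | e <;> simp [markPosLinear, markPos, h]

end TropCurve

/-! ### Connectedness and cycles of the metric graph -/

namespace TropCurve

variable {S : Matrix (Fin 2) (Fin 2) ℝ} {V E : Type} [Fintype V] [DecidableEq V] [Fintype E]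

/-- The vertex `v` is an end point of the edge `e`. -/
def Incident (Γ : TropCurve S V E) (e : E) (v : V) : Prop := Γ.src e = v ∨ Γ.tgt e = v

theorem exists_incident (Γ : TropCurve S V E) (v : V) : ∃ e, Γ.Incident e v := by
  by_contra h
  simp only [Incident, not_exists, not_or] at h
  have := Γ.valence_ge v
  rw [Finset.filter_false_of_mem fun e _ => (h e).1,
    Finset.filter_false_of_mem fun e _ => (h e).2] at this
  simp at this

theorem exists_vertexPoint (Γ : TropCurve S V E) (v : V) : ∃ y : Γ.Space,
    (∀ e, Γ.src e = v → Quot.mk _ (Γ.start e) = y) ∧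
      ∀ e, Γ.tgt e = v → Quot.mk _ (Γ.finish e) = y := by
  obtain ⟨e, rfl | rfl⟩ := Γ.exists_incident v
  · refine ⟨Quot.mk _ (Γ.start e), fun f hf => Quot.sound (.start_start _ _ hf), fun f hf => ?_⟩
    exact (Quot.sound (.start_finish _ _ hf.symm)).symm
  · refine ⟨Quot.mk _ (Γ.finish e), fun f hf => Quot.sound (.start_finish _ _ hf), fun f hf => ?_⟩
    exact (Quot.sound (.finish_finish _ _ hf.symm)).symm

/-- The vertex `v` as a point of the metric graph. -/
noncomputable def vertexPoint (Γ : TropCurve S V E) (v : V) : Γ.Space :=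
  (Γ.exists_vertexPoint v).choose

theorem mk_start (Γ : TropCurve S V E) (e : E) :
    Quot.mk _ (Γ.start e) = Γ.vertexPoint (Γ.src e) :=
  (Γ.exists_vertexPoint _).choose_spec.1 e rfl

theorem mk_finish (Γ : TropCurve S V E) (e : E) :
    Quot.mk _ (Γ.finish e) = Γ.vertexPoint (Γ.tgt e) :=
  (Γ.exists_vertexPoint _).choose_spec.2 e rfl

/-- The point is a vertex in the set `D`. -/
def IsVertexIn (Γ : TropCurve S V E) (D : Set V) : Γ.Space → Prop :=
  Quot.lift (fun x => (x.2.1 = 0 ∧ Γ.src x.1 ∈ D) ∨ (x.2.1 = Γ.length x.1 ∧ Γ.tgt x.1 ∈ D)) (by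
    have hl := fun e => (Γ.length_pos e).ne
    have hl' := fun e => (Γ.length_pos e).ne'
    rintro _ _ (⟨e, f, h⟩ | ⟨e, f, h⟩ | ⟨e, f, h⟩) <;>
      simp [start, finish, h, hl, hl'])

theorem isVertexIn_mk (Γ : TropCurve S V E) (D : Set V) (x : Γ.PreSpace) :
    Γ.IsVertexIn D (Quot.mk _ x) ↔
      (x.2.1 = 0 ∧ Γ.src x.1 ∈ D) ∨ (x.2.1 = Γ.length x.1 ∧ Γ.tgt x.1 ∈ D) := Iff.rfl

theorem mk_eq_start (Γ : TropCurve S V E) {x : Γ.PreSpace} (h : x.2.1 = 0) :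
    x = Γ.start x.1 := by
  obtain ⟨e, t, ht⟩ := x
  simp only at h
  subst h
  rfl

theorem mk_eq_finish (Γ : TropCurve S V E) {x : Γ.PreSpace} (h : x.2.1 = Γ.length x.1) :
    x = Γ.finish x.1 := by
  obtain ⟨e, t, ht⟩ := x
  simp only at h
  subst h
  rfl

theorem isVertexIn_iff (Γ : TropCurve S V E) (D : Set V) (x : Γ.Space) :
    Γ.IsVertexIn D x ↔ ∃ v ∈ D, x = Γ.vertexPoint v := by
  constructor
  · obtain ⟨x, rfl⟩ := Quot.exists_rep x
    rintro (⟨h, hD⟩ | ⟨h, hD⟩)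
    · exact ⟨_, hD, by rw [← mk_start, ← Γ.mk_eq_start h]⟩
    · exact ⟨_, hD, by rw [← mk_finish, ← Γ.mk_eq_finish h]⟩
  · rintro ⟨v, hv, rfl⟩
    obtain ⟨e, rfl | rfl⟩ := Γ.exists_incident v
    · rw [← mk_start, isVertexIn_mk]
      exact Or.inl ⟨rfl, hv⟩
    · rw [← mk_finish, isVertexIn_mk]
      exact Or.inr ⟨rfl, hv⟩

theorem isOpen_space_iff (Γ : TropCurve S V E) {U : Set Γ.Space} :
    IsOpen U ↔ ∀ e, IsOpen {t : Icc (0 : ℝ) (Γ.length e) | Γ.point e t ∈ U} := by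
  rw [← isQuotientMap_quot_mk.isOpen_preimage, isOpen_sigma_iff]
  rfl

/-- The midpoint of an edge. -/
noncomputable def midpoint (Γ : TropCurve S V E) (e : E) : Γ.PreSpace :=
  ⟨e, Γ.length e / 2, by have := Γ.length_pos e; constructor <;> linarith⟩

theorem not_isVertexIn_midpoint (Γ : TropCurve S V E) (D : Set V) (e : E) :
    ¬ Γ.IsVertexIn D (Quot.mk _ (Γ.midpoint e)) := by
  have := Γ.length_pos e
  rintro (⟨h, -⟩ | ⟨h, -⟩)
  · simp only [midpoint] at h; linarith
  · simp only [midpoint] at h; linarith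

/-- If the complement of a set of vertices is connected, then a nonempty set of edges which contains
all the edges that share one of the remaining vertices with one of its edges is everything. -/
theorem edges_eq_univ_of_isPreconnected (Γ : TropCurve S V E) {D : Set V}
    (hD : IsPreconnected {x | ¬ Γ.IsVertexIn D x}) {A : Set E} (hA : A.Nonempty)
    (h : ∀ e f w, w ∉ D → Γ.Incident e w → Γ.Incident f w → e ∈ A → f ∈ A) : A = univ := by
  have hlift : ∀ B : Set E, (∀ e f w, w ∉ D → Γ.Incident e w → Γ.Incident f w → (e ∈ B → f ∈ B)) →
      ∃ U : Set Γ.Space, IsOpen U ∧ ∀ x : Γ.PreSpace, Quot.mk _ x ∈ U ↔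
        ¬ Γ.IsVertexIn D (Quot.mk _ x) ∧ x.1 ∈ B := by
    intro B hB
    have hB' : ∀ e f w, w ∉ D → Γ.Incident e w → Γ.Incident f w → (e ∈ B ↔ f ∈ B) :=
      fun e f w hw he hf => ⟨hB e f w hw he hf, hB f e w hw hf he⟩
    -- The points outside `D` on the edges of `B`. Membership respects the gluing because edges
    -- glued at a vertex outside `D` are both in `B` or both outside; the set is open since only
    -- finitely many points of each edge are removed.
    let L : Γ.Space → Prop := Quot.lift (fun x => ¬ Γ.IsVertexIn D (Quot.mk _ x) ∧ x.1 ∈ B) (by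
      intro x y hxy
      rw [Quot.sound hxy]
      refine propext (and_congr_right fun hy => ?_)
      rw [isVertexIn_iff] at hy
      push Not at hy
      rcases hxy with ⟨e, f, h⟩ | ⟨e, f, h⟩ | ⟨e, f, h⟩
      · refine hB' _ _ (Γ.src f) (fun hw => hy _ hw ?_) (Or.inl h) (Or.inl rfl)
        rw [← mk_start]
      · refine hB' _ _ (Γ.tgt f) (fun hw => hy _ hw ?_) (Or.inl h) (Or.inr rfl)
        rw [← mk_finish]
      · refine hB' _ _ (Γ.tgt f) (fun hw => hy _ hw ?_) (Or.inr h) (Or.inr rfl)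
        rw [← mk_finish])
    refine ⟨{x | L x}, Γ.isOpen_space_iff.2 fun e => ?_, fun x => Iff.rfl⟩
    have hset : {t : Icc (0 : ℝ) (Γ.length e) | Γ.point e t ∈ {x | L x}} =
        ({t | t.1 = 0} ∩ {_t | Γ.src e ∈ D} ∪ {t | t.1 = Γ.length e} ∩ {_t | Γ.tgt e ∈ D})ᶜ ∩
          {_t | e ∈ B} := rfl
    rw [hset]
    refine IsOpen.inter (IsClosed.isOpen_compl (self := ?_)) isOpen_const
    exact ((isClosed_eq continuous_subtype_val continuous_const).inter isClosed_const).union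
      ((isClosed_eq continuous_subtype_val continuous_const).inter isClosed_const)
  obtain ⟨U, hU, hU'⟩ := hlift A h
  obtain ⟨W, hW, hW'⟩ := hlift Aᶜ fun e f w hw he hf heA hfA => heA (h f e w hw hf he hfA)
  by_contra hne
  obtain ⟨f, hf⟩ := (ne_univ_iff_exists_notMem A).1 hne
  obtain ⟨e, he⟩ := hA
  have hsub : {x | ¬ Γ.IsVertexIn D x} ⊆ U ∪ W := by
    intro x hx
    obtain ⟨x, rfl⟩ := Quot.exists_rep x
    by_cases hxA : x.1 ∈ A
    · exact Or.inl ((hU' _).2 ⟨hx, hxA⟩)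
    · exact Or.inr ((hW' _).2 ⟨hx, hxA⟩)
  obtain ⟨x, -, hxU, hxW⟩ := hD U W hU hW hsub
    ⟨Quot.mk _ (Γ.midpoint e), Γ.not_isVertexIn_midpoint D e,
      (hU' _).2 ⟨Γ.not_isVertexIn_midpoint D e, he⟩⟩
    ⟨Quot.mk _ (Γ.midpoint f), Γ.not_isVertexIn_midpoint D f,
      (hW' _).2 ⟨Γ.not_isVertexIn_midpoint D f, hf⟩⟩
  obtain ⟨x, rfl⟩ := Quot.exists_rep x
  exact ((hW' _).1 hxW).2 ((hU' _).1 hxU).2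

theorem exists_chain_of_incident [DecidableEq E] (Γ : TropCurve S V E) {D : Set V} {e : E}
    {w w' : V} (hw : w ∉ D) (hw' : w' ∉ D) (h : Γ.Incident e w) (h' : Γ.Incident e w') :
    ∃ β : E → ℝ, (∀ f u, u ∈ D → Γ.Incident f u → β f = 0) ∧
      graphBoundary ℝ Γ.src Γ.tgt β = Pi.single w 1 - Pi.single w' 1 := by
  by_cases hww : w = w'
  · exact ⟨0, fun _ _ _ _ => rfl, by rw [hww, map_zero, sub_self]⟩
  have hsupp : ∀ f u, u ∈ D → Γ.Incident f u → f ≠ e := by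
    rintro f u hu hf rfl
    rcases h with rfl | rfl <;> rcases h' with rfl | rfl <;> rcases hf with rfl | rfl <;>
      contradiction
  rcases h with rfl | rfl <;> rcases h' with rfl | rfl
  · exact absurd rfl hww
  · refine ⟨Pi.single e 1, fun f u hu hf => Pi.single_eq_of_ne (hsupp f u hu hf) _, ?_⟩
    rw [graphBoundary_single]
  · refine ⟨-Pi.single e 1, fun f u hu hf => ?_, ?_⟩
    · rw [Pi.neg_apply, Pi.single_eq_of_ne (hsupp f u hu hf), neg_zero]
    · rw [map_neg, graphBoundary_single, neg_sub]
  · exact absurd rfl hww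

/-- The edges with an end outside `D` that can be joined to `w'` by a chain avoiding `D` are stable
under adjacency outside `D`, hence they are all the edges. -/
theorem exists_chain_of_isPreconnected (Γ : TropCurve S V E) {D : Set V}
    (hD : IsPreconnected {x | ¬ Γ.IsVertexIn D x}) {w w' : V} (hw : w ∉ D) (hw' : w' ∉ D) :
    ∃ β : E → ℝ, (∀ f u, u ∈ D → Γ.Incident f u → β f = 0) ∧
      graphBoundary ℝ Γ.src Γ.tgt β = Pi.single w 1 - Pi.single w' 1 := by
  classical
  let A : Set E := {e | ∃ u, u ∉ D ∧ Γ.Incident e u ∧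
    ∃ β : E → ℝ, (∀ f u, u ∈ D → Γ.Incident f u → β f = 0) ∧
      graphBoundary ℝ Γ.src Γ.tgt β = Pi.single u 1 - Pi.single w' 1}
  have hstep : ∀ e u, e ∈ A → u ∉ D → Γ.Incident e u →
      ∃ β : E → ℝ, (∀ f u, u ∈ D → Γ.Incident f u → β f = 0) ∧
        graphBoundary ℝ Γ.src Γ.tgt β = Pi.single u 1 - Pi.single w' 1 := by
    rintro e u ⟨u', hu', heu', β, hβ, hβ'⟩ hu heu
    obtain ⟨γ, hγ, hγ'⟩ := Γ.exists_chain_of_incident hu hu' heu heu'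
    refine ⟨γ + β, fun f x hx hf => ?_, ?_⟩
    · rw [Pi.add_apply, hβ f x hx hf, hγ f x hx hf, add_zero]
    · rw [map_add, hβ', hγ', sub_add_sub_cancel]
  have hA : A = univ := by
    refine Γ.edges_eq_univ_of_isPreconnected hD ?_ ?_
    · obtain ⟨e, he⟩ := Γ.exists_incident w'
      exact ⟨e, w', hw', he, 0, fun _ _ _ _ => rfl, by rw [map_zero, sub_self]⟩
    · intro e f u hu heu hfu he
      exact ⟨u, hu, hfu, hstep e u he hu heu⟩
  obtain ⟨e, he⟩ := Γ.exists_incident w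
  exact hstep e w (hA ▸ mem_univ e) hw he

theorem setOf_not_isVertexIn_empty (Γ : TropCurve S V E) :
    {x | ¬ Γ.IsVertexIn ∅ x} = univ := by
  ext x
  simp [isVertexIn_iff]

theorem setOf_not_isVertexIn_singleton (Γ : TropCurve S V E) (v : V) :
    {x | ¬ Γ.IsVertexIn {v} x} = {Γ.vertexPoint v}ᶜ := by
  ext x
  simp [isVertexIn_iff]

theorem IsIrreducible.isPreconnected_compl {Γ : TropCurve S V E} (h : Γ.IsIrreducible) (v : V) :
    IsPreconnected {x | ¬ Γ.IsVertexIn {v} x} := by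
  rw [setOf_not_isVertexIn_singleton]
  exact (h.2 _).isPreconnected

theorem isPreconnected_not_isVertexIn_empty (Γ : TropCurve S V E) [ConnectedSpace Γ.Space] :
    IsPreconnected {x | ¬ Γ.IsVertexIn ∅ x} := by
  rw [setOf_not_isVertexIn_empty]
  exact isPreconnected_univ

/-- Removing its vertex isolates a loop from the rest, so the loop would be the only edge, and its
vertex would have valence two. -/
theorem IsIrreducible.src_ne_tgt {Γ : TropCurve S V E} (h : Γ.IsIrreducible) (e : E) :
    Γ.src e ≠ Γ.tgt e := by
  intro he
  have hA := Γ.edges_eq_univ_of_isPreconnected (h.isPreconnected_compl (Γ.src e)) (A := {e})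
    (singleton_nonempty e) (by
      rintro f f' w hw (rfl | rfl) - hf
      · exact absurd (congrArg Γ.src hf) hw
      · exact absurd ((congrArg Γ.tgt hf).trans he.symm) hw)
  have hcard : Fintype.card E ≤ 1 := Fintype.card_le_one_iff.2 fun a b => by
    have ha : a ∈ ({e} : Set E) := hA ▸ mem_univ a
    have hb : b ∈ ({e} : Set E) := hA ▸ mem_univ b
    exact (mem_singleton_iff.1 ha).trans (mem_singleton_iff.1 hb).symm
  have h1 := Γ.valence_ge (Γ.src e)
  have h2 := (Finset.univ.filter fun f => Γ.src f = Γ.src e).card_le_univ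
  have h3 := (Finset.univ.filter fun f => Γ.tgt f = Γ.src e).card_le_univ
  omega

/-- The sign of an edge at a vertex: positive when the edge starts there. -/
def sign (Γ : TropCurve S V E) (v : V) (e : E) : ℝ := if Γ.src e = v then 1 else -1

theorem sign_mul_self (Γ : TropCurve S V E) (v : V) (e : E) : Γ.sign v e * Γ.sign v e = 1 := by
  unfold sign; split_ifs <;> norm_num

/-- In an irreducible curve, there is a cycle that goes through two given edges at a vertex, and
through no other edge at this vertex. -/
theorem IsIrreducible.exists_cycle {Γ : TropCurve S V E} (h : Γ.IsIrreducible) {v : V}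
    {e₁ e₂ : E} (h₁ : Γ.Incident e₁ v) (h₂ : Γ.Incident e₂ v) (hne : e₁ ≠ e₂) :
    ∃ c : E → ℝ, graphBoundary ℝ Γ.src Γ.tgt c = 0 ∧ c e₁ = Γ.sign v e₁ ∧ c e₂ = -Γ.sign v e₂ ∧
      ∀ f, Γ.Incident f v → f ≠ e₁ → f ≠ e₂ → c f = 0 := by
  classical
  have hother : ∀ e, Γ.Incident e v → ∃ w, w ≠ v ∧
      graphBoundary ℝ Γ.src Γ.tgt (Γ.sign v e • Pi.single e 1) =
        Pi.single v 1 - Pi.single w 1 := by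
    intro e he
    rw [map_smul, graphBoundary_single, sign]
    rcases he with rfl | rfl
    · exact ⟨Γ.tgt e, (h.src_ne_tgt e).symm, by rw [if_pos rfl, one_smul]⟩
    · exact ⟨Γ.src e, h.src_ne_tgt e, by rw [if_neg (h.src_ne_tgt e), neg_one_smul, neg_sub]⟩
  obtain ⟨w₁, hw₁, hb₁⟩ := hother e₁ h₁
  obtain ⟨w₂, hw₂, hb₂⟩ := hother e₂ h₂
  -- The other ends of the two edges differ from `v`, as there are no loops. A chain between them
  -- that avoids `v` closes the path into a cycle.
  obtain ⟨β, hβ, hb⟩ := Γ.exists_chain_of_isPreconnected (h.isPreconnected_compl v)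
    (w := w₁) (w' := w₂) hw₁ hw₂
  have hβ' : ∀ f, Γ.Incident f v → β f = 0 := fun f hf => hβ f v rfl hf
  refine ⟨Γ.sign v e₁ • Pi.single e₁ 1 - Γ.sign v e₂ • Pi.single e₂ 1 + β, ?_, ?_, ?_, ?_⟩
  · rw [map_add, map_sub, hb₁, hb₂, hb]
    abel
  · simp [hβ' e₁ h₁, hne]
  · simp [hβ' e₂ h₂, hne.symm]
  · intro f hf hf₁ hf₂
    simp [hβ' f hf, hf₁, hf₂]

/-- Connectedness gives the real boundary map corank at most one, so real cycles have dimension at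
most `|E| - |V| + 1`, which is at most the integral Betti number. -/
theorem finrank_cycles_le (Γ : TropCurve S V E) [ConnectedSpace Γ.Space] :
    Module.finrank ℝ (LinearMap.ker (graphBoundary ℝ Γ.src Γ.tgt)) ≤ Γ.genus := by
  obtain ⟨x⟩ := (inferInstance : Nonempty Γ.Space)
  obtain ⟨y, -⟩ := Quot.exists_rep x
  let v₀ : V := Γ.src y.1
  have : Nonempty V := ⟨v₀⟩
  have h1 := Γ.card_edges_add_one_le
  have h2 := LinearMap.finrank_range_add_finrank_ker (graphBoundary ℝ Γ.src Γ.tgt)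
  rw [Module.finrank_pi] at h2
  have htop : LinearMap.range (graphBoundary ℝ Γ.src Γ.tgt) ⊔
      Submodule.span ℝ {(Pi.single v₀ 1 : V → ℝ)} = ⊤ := by
    rw [eq_top_iff]
    intro f _
    rw [← Finset.univ_sum_single f]
    refine Submodule.sum_mem _ fun w _ => ?_
    obtain ⟨β, -, hβ⟩ := Γ.exists_chain_of_isPreconnected Γ.isPreconnected_not_isVertexIn_empty
      (w := w) (w' := v₀) (notMem_empty _) (notMem_empty _)
    have hw : (Pi.single w (f w) : V → ℝ) = f w • (graphBoundary ℝ Γ.src Γ.tgt β) +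
        f w • Pi.single v₀ 1 := by
      rw [hβ, ← smul_add, sub_add_cancel, ← Pi.single_smul, smul_eq_mul, mul_one]
    rw [hw]
    refine Submodule.add_mem _ (Submodule.mem_sup_left ?_) (Submodule.mem_sup_right ?_)
    · exact Submodule.smul_mem _ _ ⟨β, rfl⟩
    · exact Submodule.smul_mem _ _ (Submodule.mem_span_singleton_self _)
  have h3 := Submodule.finrank_add_le_finrank_add_finrank
    (LinearMap.range (graphBoundary ℝ Γ.src Γ.tgt)) (Submodule.span ℝ {(Pi.single v₀ 1 : V → ℝ)})
  rw [htop, finrank_top, Module.finrank_pi] at h3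
  have h4 : Module.finrank ℝ (Submodule.span ℝ {(Pi.single v₀ 1 : V → ℝ)}) ≤ 1 := by
    simpa using finrank_span_le_card (R := ℝ) {(Pi.single v₀ 1 : V → ℝ)}
  omega

end TropCurve

/-! ### Fluxes of variations and the consequences of regularity -/

theorem exists_planeDet_eq {b : Fin 2 → ℝ} (hb : b ≠ 0) (t : ℝ) : ∃ y, planeDet y b = t := by
  by_cases h0 : b 0 = 0
  · have h1 : b 1 ≠ 0 := fun h1 => hb (by ext i; fin_cases i <;> simp [h0, h1])
    exact ⟨![t / b 1, 0], by simp [planeDet, h1]⟩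
  · exact ⟨![0, -(t / b 0)], by simp [planeDet, h0]⟩

namespace TropCurve

variable {S : Matrix (Fin 2) (Fin 2) ℝ} {V E : Type} [Fintype V] [DecidableEq V] [Fintype E]
  {Γ : TropCurve S V E} {n : ℕ}

/-- The vertex velocities `δ` preserve the directions of the edges. -/
def IsVariation (Γ : TropCurve S V E) (δ : V → Fin 2 → ℝ) : Prop :=
  ∃ m : E → ℝ, ∀ e, δ (Γ.src e) + m e • toReal (Γ.slope e) = δ (Γ.tgt e)

/-- The normal displacement of an edge. -/
def edgeFlux (Γ : TropCurve S V E) (δ : V → Fin 2 → ℝ) (e : E) : ℝ :=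
  planeDet (δ (Γ.src e)) (toReal (Γ.slope e))

theorem IsVariation.edgeFlux_eq {δ : V → Fin 2 → ℝ} (h : Γ.IsVariation δ) {e : E} {v : V}
    (he : Γ.Incident e v) : Γ.edgeFlux δ e = planeDet (δ v) (toReal (Γ.slope e)) := by
  obtain ⟨m, hm⟩ := h
  rcases he with rfl | rfl
  · rfl
  · rw [← hm, planeDet_add_left, planeDet_smul_left, planeDet_self, mul_zero, add_zero, edgeFlux]

/-- The flux of an edge can be computed at either end, so the total flux out of `v` is the
determinant of `δ v` with the sum of the outgoing slopes, which is zero. -/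
theorem IsVariation.graphBoundary_edgeFlux {δ : V → Fin 2 → ℝ} (h : Γ.IsVariation δ) :
    graphBoundary ℝ Γ.src Γ.tgt (Γ.edgeFlux δ) = 0 := by
  ext v
  have h1 : ∀ e, (if Γ.src e = v then Γ.edgeFlux δ e else 0) =
      δ v 0 * (if Γ.src e = v then (Γ.slope e 1 : ℝ) else 0) -
        δ v 1 * (if Γ.src e = v then (Γ.slope e 0 : ℝ) else 0) := by
    intro e
    split_ifs with he
    · rw [h.edgeFlux_eq (Or.inl he)]; rfl
    · ring
  have h2 : ∀ e, (if Γ.tgt e = v then Γ.edgeFlux δ e else 0) =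
      δ v 0 * (if Γ.tgt e = v then (Γ.slope e 1 : ℝ) else 0) -
        δ v 1 * (if Γ.tgt e = v then (Γ.slope e 0 : ℝ) else 0) := by
    intro e
    split_ifs with he
    · rw [h.edgeFlux_eq (Or.inr he)]; rfl
    · ring
  have h3 := congrFun (Γ.graphBoundary_slope 0) v
  have h4 := congrFun (Γ.graphBoundary_slope 1) v
  rw [graphBoundary_apply, Pi.zero_apply] at *
  simp_rw [h1, h2, Finset.sum_sub_distrib, ← Finset.mul_sum]
  linear_combination δ v 0 * h4 - δ v 1 * h3

theorem IsVariation.add_const {δ : V → Fin 2 → ℝ} (h : Γ.IsVariation δ) (q : Fin 2 → ℝ) :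
    Γ.IsVariation fun v => δ v + q := by
  obtain ⟨m, hm⟩ := h
  refine ⟨m, fun e => ?_⟩
  simp only [← hm]
  abel

/-- The edge `η i` contains the marked point described by `ε i`. -/
def MarksEdges (Γ : TropCurve S V E) (ε : Fin n → V ⊕ E) (η : Fin n → E) : Prop :=
  ∀ i, ε i = Sum.inr (η i) ∨ ∃ v, ε i = Sum.inl v ∧ Γ.Incident (η i) v

theorem exists_marksEdges (Γ : TropCurve S V E) (ε : Fin n → V ⊕ E) :
    ∃ η, Γ.MarksEdges ε η := by
  have h : ∀ i, ∃ e, ε i = Sum.inr e ∨ ∃ v, ε i = Sum.inl v ∧ Γ.Incident e v := by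
    intro i
    rcases h : ε i with v | e
    · obtain ⟨e, he⟩ := Γ.exists_incident v
      exact ⟨e, Or.inr ⟨v, rfl, he⟩⟩
    · exact ⟨e, Or.inl rfl⟩
  choose η hη using h
  exact ⟨η, hη⟩

/-- Sliding along an edge does not affect its flux, so the velocity of a marked point determines the
flux of its edge. -/
theorem MarksEdges.edgeFlux_eq {ε : Fin n → V ⊕ E} {η : Fin n → E} (hη : Γ.MarksEdges ε η)
    {δ : V → Fin 2 → ℝ} (h : Γ.IsVariation δ) (τ : Fin n → ℝ) (i : Fin n) :
    Γ.edgeFlux δ (η i) =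
      planeDet (markPos Γ.src Γ.slope ε δ τ i) (toReal (Γ.slope (η i))) := by
  rcases hη i with hi | ⟨v, hi, hv⟩
  · rw [markPos, hi, Sum.elim_inr, planeDet_add_left, planeDet_smul_left, planeDet_self, mul_zero,
      add_zero, edgeFlux]
  · rw [markPos, hi, Sum.elim_inl, h.edgeFlux_eq hv]

/-- The data of a marked curve of a nondegenerate class whose marked points can be moved
independently. -/
structure IsRegularAt (Γ : TropCurve S V E) (L : Γ.Lift) (ε : Fin n → V ⊕ E) (η : Fin n → E) :
    Prop where
  regular : IsRegularMarking Γ.src Γ.tgt Γ.slope L.shift ε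
  marks : Γ.MarksEdges ε η
  irreducible : Γ.IsIrreducible
  genus_eq : Γ.genus = n + 2
  exists_translation : ∀ u : Fin 2 → ℝ, ∃ q : Fin 2 → ℝ,
    ∀ j, ∑ e, planeDet q (toReal (Γ.slope e)) * L.shift e j = u j

/-- A translation by `q` changes the moment by `q 0 * C 1 j - q 1 * C 0 j`. This system is
invertible because `det C ≠ 0`, and the witness is Cramer's rule. -/
theorem Lift.exists_translation (L : Γ.Lift) (hS : S.det ≠ 0) {C : Matrix (Fin 2) (Fin 2) ℤ}
    (hdet : C.det ≠ 0) (hC : Γ.HasDegree C) (u : Fin 2 → ℝ) : ∃ q : Fin 2 → ℝ,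
      ∀ j, ∑ e, planeDet q (toReal (Γ.slope e)) * L.shift e j = u j := by
  have hd : (C 0 0 : ℝ) * C 1 1 - C 0 1 * C 1 0 ≠ 0 := by
    rw [Matrix.det_fin_two] at hdet
    exact_mod_cast hdet
  set d := (C 0 0 : ℝ) * C 1 1 - C 0 1 * C 1 0 with hd'
  have h : ∀ q : Fin 2 → ℝ, ∀ j, ∑ e, planeDet q (toReal (Γ.slope e)) * L.shift e j =
      q 0 * C 1 j - q 1 * C 0 j := by
    intro q j
    rw [← L.sum_slope_mul_shift hS hC 1 j, ← L.sum_slope_mul_shift hS hC 0 j, Finset.mul_sum,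
      Finset.mul_sum, ← Finset.sum_sub_distrib]
    refine Finset.sum_congr rfl fun e _ => ?_
    simp only [planeDet, toReal]
    ring
  refine ⟨![(C 0 0 * u 1 - C 0 1 * u 0) / d, (C 1 0 * u 1 - C 1 1 * u 0) / d], fun j => ?_⟩
  rw [h]
  simp only [Matrix.cons_val_zero, Matrix.cons_val_one]
  fin_cases j
  · simp only [Fin.zero_eta]; field_simp; rw [hd']; ring
  · simp only [Fin.mk_one]; field_simp; rw [hd']; ring

namespace IsRegularAt

variable {L : Γ.Lift} {ε : Fin n → V ⊕ E} {η : Fin n → E}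

/-- A translation accounts for the moment `u`. Regular deformations have zero moment, and one of
them adjusts the fluxes of the marked edges by what the translation leaves to be corrected. -/
theorem exists_variation (h : Γ.IsRegularAt L ε η) (t : Fin n → ℝ) (u : Fin 2 → ℝ) :
    ∃ δ, Γ.IsVariation δ ∧ (∀ i, Γ.edgeFlux δ (η i) = t i) ∧
      ∀ j, ∑ e, Γ.edgeFlux δ e * L.shift e j = u j := by
  obtain ⟨q, hq⟩ := h.exists_translation u
  choose y hy using fun i => exists_planeDet_eq (toReal_ne_zero (Γ.slope_ne (η i)))
    (t i - planeDet q (toReal (Γ.slope (η i))))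
  obtain ⟨δ, m, τ, hδ, hyδ⟩ := h.regular y
  have hvar : Γ.IsVariation δ := ⟨m, hδ.src_add⟩
  have hflux : ∀ e, Γ.edgeFlux (fun v => δ v + q) e =
      Γ.edgeFlux δ e + planeDet q (toReal (Γ.slope e)) := fun e => planeDet_add_left _ _ _
  refine ⟨fun v => δ v + q, hvar.add_const q, fun i => ?_, fun j => ?_⟩
  · rw [hflux, h.marks.edgeFlux_eq hvar τ, hyδ, hy, sub_add_cancel]
  · simp_rw [hflux, add_mul, Finset.sum_add_distrib, hq]
    rw [show ∑ e, Γ.edgeFlux δ e * L.shift e j = 0 from hδ.moment j, zero_add]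

/-- Fluxes already map onto `ℝ^n × ℝ²`, while the space of cycles has dimension at most `n + 2`: the
evaluation of cycles is an isomorphism. -/
theorem cycle_eq_zero (h : Γ.IsRegularAt L ε η) {c : E → ℝ}
    (hc : graphBoundary ℝ Γ.src Γ.tgt c = 0) (hcη : ∀ i, c (η i) = 0)
    (hcL : ∀ j, ∑ e, c e * L.shift e j = 0) : c = 0 := by
  let Ψ₀ : (E → ℝ) →ₗ[ℝ] (Fin n → ℝ) × (Fin 2 → ℝ) :=
    (LinearMap.pi fun i => LinearMap.proj (η i)).prod
      (LinearMap.pi fun j => ∑ e, (L.shift e j : ℝ) • LinearMap.proj e)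
  have hΨ₁ : ∀ c i, (Ψ₀ c).1 i = c (η i) := fun c i => rfl
  have hΨ₂ : ∀ c j, (Ψ₀ c).2 j = ∑ e, c e * L.shift e j := by
    intro c j
    change (∑ e, (L.shift e j : ℝ) • LinearMap.proj e : (E → ℝ) →ₗ[ℝ] ℝ) c = _
    simp [mul_comm]
  let Ψ := Ψ₀.domRestrict (LinearMap.ker (graphBoundary ℝ Γ.src Γ.tgt))
  have hsurj : LinearMap.range Ψ = ⊤ := by
    rw [LinearMap.range_eq_top]
    rintro ⟨t, u⟩
    obtain ⟨δ, hδ, ht, hu⟩ := h.exists_variation t u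
    refine ⟨⟨Γ.edgeFlux δ, hδ.graphBoundary_edgeFlux⟩, Prod.ext (funext fun i => ?_)
      (funext fun j => ?_)⟩
    · exact (hΨ₁ _ i).trans (ht i)
    · exact (hΨ₂ _ j).trans (hu j)
  have h1 := LinearMap.finrank_range_add_finrank_ker Ψ
  rw [hsurj, finrank_top, Module.finrank_prod, Module.finrank_pi, Module.finrank_pi,
    Fintype.card_fin, Fintype.card_fin] at h1
  have := h.irreducible.1
  have h2 := Γ.finrank_cycles_le
  rw [h.genus_eq] at h2
  have h3 : LinearMap.ker Ψ = ⊥ := Submodule.finrank_eq_zero.1 (by omega)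
  have h4 : (⟨c, hc⟩ : LinearMap.ker (graphBoundary ℝ Γ.src Γ.tgt)) ∈ LinearMap.ker Ψ := by
    rw [LinearMap.mem_ker]
    refine Prod.ext (funext fun i => ?_) (funext fun j => ?_)
    · exact (hΨ₁ _ i).trans (hcη i)
    · exact (hΨ₂ _ j).trans (hcL j)
  rw [h3, Submodule.mem_bot] at h4
  exact congrArg Subtype.val h4

/-- A variation with the prescribed marked values and class exists, and its flux cannot differ from
the cycle by `cycle_eq_zero`. -/
theorem exists_variation_eq (h : Γ.IsRegularAt L ε η) {c : E → ℝ}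
    (hc : graphBoundary ℝ Γ.src Γ.tgt c = 0) : ∃ δ, Γ.IsVariation δ ∧ Γ.edgeFlux δ = c := by
  obtain ⟨δ, hδ, ht, hu⟩ := h.exists_variation (fun i => c (η i))
    (fun j => ∑ e, c e * L.shift e j)
  refine ⟨δ, hδ, sub_eq_zero.1 (h.cycle_eq_zero ?_ (fun i => ?_) fun j => ?_)⟩
  · rw [map_sub, hδ.graphBoundary_edgeFlux, hc, sub_zero]
  · rw [Pi.sub_apply, ht, sub_self]
  · simp_rw [Pi.sub_apply, sub_mul, Finset.sum_sub_distrib]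
    rw [hu, sub_self]

end IsRegularAt

open Classical in
theorem IsIrreducible.card_incident (h : Γ.IsIrreducible) (v : V) :
    (Finset.univ.filter fun e => Γ.Incident e v).card =
      (Finset.univ.filter fun e => Γ.src e = v).card +
        (Finset.univ.filter fun e => Γ.tgt e = v).card := by
  rw [← Finset.card_union_of_disjoint]
  · congr 1
    ext e
    simp only [Finset.mem_union, Finset.mem_filter, Finset.mem_univ, true_and]
    exact Iff.rfl
  · rw [Finset.disjoint_filter]
    rintro e - h1 h2
    exact h.src_ne_tgt e (h1.trans h2.symm)

namespace IsRegularAt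

variable {L : Γ.Lift} {ε : Fin n → V ⊕ E} {η : Fin n → E}

/-- The cycle through `e₁` and `e₂` is the flux of a variation; `p` is the velocity of `v`. -/
theorem exists_vector (h : Γ.IsRegularAt L ε η) {v : V} {e₁ e₂ : E} (h₁ : Γ.Incident e₁ v)
    (h₂ : Γ.Incident e₂ v) (hne : e₁ ≠ e₂) : ∃ p : Fin 2 → ℝ,
      planeDet p (toReal (Γ.slope e₁)) ≠ 0 ∧
      ∀ f, Γ.Incident f v → f ≠ e₁ → f ≠ e₂ → planeDet p (toReal (Γ.slope f)) = 0 := by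
  obtain ⟨c, hc, hc₁, -, hcf⟩ := h.irreducible.exists_cycle h₁ h₂ hne
  obtain ⟨δ, hδ, rfl⟩ := h.exists_variation_eq hc
  refine ⟨δ v, ?_, fun f hf hf₁ hf₂ => ?_⟩
  · rw [← hδ.edgeFlux_eq h₁, hc₁]
    intro h0
    have := Γ.sign_mul_self v e₁
    rw [h0, mul_zero] at this
    exact zero_ne_one this
  · rw [← hδ.edgeFlux_eq hf, hcf f hf hf₁ hf₂]

/-- Take a third edge `e₃` at `v`. The velocity attached to the pair `e₁, e₃` is parallel to `e₂`
but not to `e₁`. -/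
theorem planeDet_slope_ne_zero (h : Γ.IsRegularAt L ε η) {v : V} {e₁ e₂ : E}
    (h₁ : Γ.Incident e₁ v) (h₂ : Γ.Incident e₂ v) (hne : e₁ ≠ e₂) :
    planeDet (toReal (Γ.slope e₁)) (toReal (Γ.slope e₂)) ≠ 0 := by
  classical
  have hcard : ({e₁, e₂} : Finset E).card < (Finset.univ.filter fun e => Γ.Incident e v).card := by
    rw [h.irreducible.card_incident]
    exact Finset.card_le_two.trans_lt (Γ.valence_ge v)
  obtain ⟨e₃, he₃, hne₃⟩ := Finset.exists_mem_notMem_of_card_lt_card hcard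
  simp only [Finset.mem_filter, Finset.mem_univ, true_and, Finset.mem_insert,
    Finset.mem_singleton, not_or] at he₃ hne₃
  obtain ⟨p, hp₁, hpf⟩ := h.exists_vector h₁ he₃ (Ne.symm hne₃.1)
  intro h0
  obtain ⟨r, hr⟩ := exists_smul_of_planeDet_eq_zero (toReal_ne_zero (Γ.slope_ne e₂)) h0
  apply hp₁
  have h2 := hpf e₂ h₂ hne.symm (Ne.symm hne₃.2)
  rw [hr]
  simp only [planeDet, Pi.smul_apply, smul_eq_mul] at h2 ⊢
  linear_combination r * h2

/-- With four edges, the velocity attached to two of them would be parallel to the two others, which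
are independent, so it would vanish. -/
theorem isTrivalent (h : Γ.IsRegularAt L ε η) : Γ.IsTrivalent := by
  classical
  intro v
  refine le_antisymm ?_ (Γ.valence_ge v)
  by_contra hlt
  rw [← h.irreducible.card_incident, not_le] at hlt
  obtain ⟨a, ha, b, hb, c, hc, d, hd, hab, hac, had, hbc, hbd, hcd⟩ := Finset.three_lt_card.1 hlt
  simp only [Finset.mem_filter, Finset.mem_univ, true_and] at ha hb hc hd
  obtain ⟨p, hp, hpf⟩ := h.exists_vector ha hb hab
  apply hp
  rw [eq_zero_of_planeDet_eq_zero (h.planeDet_slope_ne_zero hc hd hcd)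
    (hpf c hc hac.symm hbc.symm) (hpf d hd had.symm hbd.symm)]
  simp [planeDet]

/-- The flux is a cycle that vanishes on the marked edges and has class zero. Once all fluxes
vanish, each vertex velocity is parallel to two independent edges. -/
theorem variation_eq_zero (h : Γ.IsRegularAt L ε η) {δ : V → Fin 2 → ℝ} (hδ : Γ.IsVariation δ)
    (hδη : ∀ i, Γ.edgeFlux δ (η i) = 0)
    (hδL : ∀ j, ∑ e, Γ.edgeFlux δ e * L.shift e j = 0) : δ = 0 := by
  classical
  have h0 := h.cycle_eq_zero hδ.graphBoundary_edgeFlux hδη hδL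
  ext1 v
  have hcard : 1 < (Finset.univ.filter fun e => Γ.Incident e v).card := by
    rw [h.irreducible.card_incident]
    have := Γ.valence_ge v
    omega
  obtain ⟨e₁, he₁, e₂, he₂, hne⟩ := Finset.one_lt_card.1 hcard
  simp only [Finset.mem_filter, Finset.mem_univ, true_and] at he₁ he₂
  refine eq_zero_of_planeDet_eq_zero (h.planeDet_slope_ne_zero he₁ he₂ hne) ?_ ?_
  · rw [← hδ.edgeFlux_eq he₁, h0, Pi.zero_apply]
  · rw [← hδ.edgeFlux_eq he₂, h0, Pi.zero_apply]

/-- The marked points of a regular marking are not vertices. -/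
theorem eq_inr (h : Γ.IsRegularAt L ε η) (i : Fin n) : ε i = Sum.inr (η i) := by
  rcases h.marks i with hi | ⟨v, hi, hv⟩
  · exact hi
  · exfalso
    -- The marked point at the vertex is asked to move along its edge while the others stay. All
    -- marked fluxes then vanish, so no vertex moves at all.
    obtain ⟨δ, m, τ, hδ, hy⟩ := h.regular (Pi.single i (toReal (Γ.slope (η i))))
    have hvar : Γ.IsVariation δ := ⟨m, hδ.src_add⟩
    have h0 : δ = 0 := by
      refine h.variation_eq_zero hvar (fun k => ?_) hδ.moment
      rw [h.marks.edgeFlux_eq hvar τ, hy]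
      by_cases hk : k = i
      · subst hk; rw [Pi.single_eq_same, planeDet_self]
      · rw [Pi.single_eq_of_ne hk]; simp [planeDet]
    have h1 := congrFun hy i
    rw [markPos, hi, Sum.elim_inl, h0, Pi.single_eq_same] at h1
    exact toReal_ne_zero (Γ.slope_ne _) h1.symm

/-- Fluxes on the marked edges can be prescribed independently. -/
theorem injective (h : Γ.IsRegularAt L ε η) : Function.Injective η := by
  intro i k hik
  by_contra hne
  obtain ⟨δ, -, ht, -⟩ := h.exists_variation (Pi.single i 1) 0
  have h1 := ht i
  have h2 := ht k
  rw [Pi.single_eq_same] at h1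
  rw [Pi.single_eq_of_ne (Ne.symm hne), ← hik, h1] at h2
  exact one_ne_zero h2

end IsRegularAt

end TropCurve

/-! ### Local injectivity and the position of marked points -/

namespace TropCurve

variable {S : Matrix (Fin 2) (Fin 2) ℝ} {V E : Type} [Fintype V] [DecidableEq V] [Fintype E]
  {Γ : TropCurve S V E} {n : ℕ}

open Classical in
/-- The edge and the parameter of a point that is not a vertex. -/
noncomputable def interiorCoord (Γ : TropCurve S V E) : Γ.Space → Option (E × ℝ) :=
  Quot.lift (fun x => if x.2.1 ∈ Ioo 0 (Γ.length x.1) then some (x.1, x.2.1) else none) (by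
    rintro _ _ (⟨e, f, h⟩ | ⟨e, f, h⟩ | ⟨e, f, h⟩) <;> simp [start, finish])

theorem interiorCoord_point {e : E} {t : Icc (0 : ℝ) (Γ.length e)}
    (ht : t.1 ∈ Ioo 0 (Γ.length e)) : Γ.interiorCoord (Γ.point e t) = some (e, t.1) :=
  if_pos ht

theorem interiorCoord_point_of_notMem {e : E} {t : Icc (0 : ℝ) (Γ.length e)}
    (ht : t.1 ∉ Ioo 0 (Γ.length e)) : Γ.interiorCoord (Γ.point e t) = none :=
  if_neg ht

theorem point_eq_point {e f : E} {t : Icc (0 : ℝ) (Γ.length e)} {s : Icc (0 : ℝ) (Γ.length f)}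
    (ht : t.1 ∈ Ioo 0 (Γ.length e)) (h : Γ.point f s = Γ.point e t) : f = e ∧ s.1 = t.1 := by
  have h1 := congrArg Γ.interiorCoord h
  rw [interiorCoord_point ht] at h1
  by_cases hs : s.1 ∈ Ioo 0 (Γ.length f)
  · rw [interiorCoord_point hs] at h1
    exact Prod.ext_iff.1 (Option.some.inj h1)
  · rw [interiorCoord_point_of_notMem hs] at h1
    exact absurd h1 (by simp)

theorem map_point (e : E) (t : Icc (0 : ℝ) (Γ.length e)) :
    Γ.map (Γ.point e t) = Γ.edgeMap e t := rfl

theorem Lift.edgeMap_eq (L : Γ.Lift) (e : E) (t : ℝ) :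
    Γ.edgeMap e t = torusMk S (L.pos (Γ.src e) + t • toReal (Γ.slope e)) := by
  rw [torusMk_add, L.torusMk_pos, edgeMap]

theorem continuous_point (e : E) : Continuous (Γ.point e) :=
  continuous_quot_mk.comp continuous_sigmaMk

theorem exists_injOn_nhds_interior (hS : S.det ≠ 0) (L : Γ.Lift) {e : E}
    {t : Icc (0 : ℝ) (Γ.length e)} (ht : t.1 ∈ Ioo 0 (Γ.length e)) :
    ∃ U ∈ 𝓝 (Γ.point e t), InjOn Γ.map U := by
  obtain ⟨ρ, hρ, hgap⟩ := exists_lattice_gap hS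
  have hs : toReal (Γ.slope e) ≠ 0 := toReal_ne_zero (Γ.slope_ne e)
  obtain ⟨r, hr, hrρ⟩ : ∃ r > 0, 2 * r * ‖toReal (Γ.slope e)‖ < ρ :=
    ⟨ρ / (4 * ‖toReal (Γ.slope e)‖), by positivity, by field_simp; norm_num⟩
  let A : Set (Icc (0 : ℝ) (Γ.length e)) := {u | u.1 ∈ Ioo 0 (Γ.length e) ∧ |u.1 - t.1| < r}
  have hA : IsOpen A :=
    (isOpen_Ioo.preimage continuous_subtype_val).inter
      (isOpen_lt (continuous_subtype_val.sub continuous_const).abs continuous_const)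
  refine ⟨Γ.point e '' A, ?_, ?_⟩
  · refine IsOpen.mem_nhds (Γ.isOpen_space_iff.2 fun f => ?_) ⟨t, ⟨ht, by simpa using hr⟩, rfl⟩
    by_cases hf : f = e
    · subst hf
      convert hA using 1
      ext s
      constructor
      · rintro ⟨u, hu, hus⟩
        have := (point_eq_point hu.1 hus.symm).2
        rwa [Subtype.ext this]
      · exact fun hs => ⟨s, hs, rfl⟩
    · convert isOpen_empty
      ext s
      simp only [mem_ofPred_eq, mem_empty_iff_false, iff_false]
      rintro ⟨u, hu, hus⟩
      exact hf (point_eq_point hu.1 hus.symm).1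
  · rintro _ ⟨u, hu, rfl⟩ _ ⟨u', hu', rfl⟩ h
    rw [map_point, map_point, L.edgeMap_eq, L.edgeMap_eq, torusMk_eq_iff] at h
    obtain ⟨l, hl⟩ := h
    have h1 : S.mulVec (toReal l) = (u.1 - u'.1) • toReal (Γ.slope e) := by
      rw [sub_smul]
      linear_combination (exp := 1) -hl
    have h2 : l = 0 := by
      refine hgap l (lt_of_le_of_lt ?_ hrρ)
      rw [h1, norm_smul, Real.norm_eq_abs]
      refine mul_le_mul_of_nonneg_right ?_ (norm_nonneg _)
      have h3 := abs_lt.1 hu.2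
      have h4 := abs_lt.1 hu'.2
      exact abs_le.2 ⟨by linarith, by linarith⟩
    rw [h2, toReal_zero, Matrix.mulVec_zero, eq_comm, smul_eq_zero] at h1
    rw [Subtype.ext (sub_eq_zero.1 (h1.resolve_right hs))]

/-- Near `v`, two points with the same image have lifts that differ by a lattice vector shorter than
the lattice gap, so the lifts coincide. Independent edges meet only at `v`. -/
theorem exists_injOn_nhds_vertex (hS : S.det ≠ 0) (L : Γ.Lift) (v : V)
    (hloop : ∀ e, Γ.src e ≠ Γ.tgt e)
    (hdet : ∀ e f, Γ.Incident e v → Γ.Incident f v → e ≠ f →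
      planeDet (toReal (Γ.slope e)) (toReal (Γ.slope f)) ≠ 0) :
    ∃ U ∈ 𝓝 (Γ.vertexPoint v), InjOn Γ.map U := by
  obtain ⟨ρ, hρ, hgap⟩ := exists_lattice_gap hS
  obtain ⟨r, hr, hrl, hrρ⟩ : ∃ r > 0, (∀ e, r < Γ.length e) ∧
      ∀ e, 2 * (r * ‖toReal (Γ.slope e)‖) < ρ := by
    have h1 : ∀ᶠ r in 𝓝[>] (0 : ℝ), ∀ e, r < Γ.length e :=
      eventually_all.2 fun e => mem_nhdsWithin_of_mem_nhds (Iio_mem_nhds (Γ.length_pos e))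
    have h2 : ∀ᶠ r in 𝓝[>] (0 : ℝ), ∀ e, 2 * (r * ‖toReal (Γ.slope e)‖) < ρ := by
      refine eventually_all.2 fun e => mem_nhdsWithin_of_mem_nhds ?_
      refine ContinuousAt.eventually_lt (by fun_prop) continuousAt_const ?_
      simpa using hρ
    have h3 : ∀ᶠ r in 𝓝[>] (0 : ℝ), 0 < r := eventually_mem_nhdsWithin
    obtain ⟨r, h1, h2, h3⟩ := (h1.and (h2.and h3)).exists
    exact ⟨r, h3, h1, h2⟩
  have hl1 : ∀ e, ¬ Γ.length e < r := fun e => (hrl e).not_gt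
  -- The star of radius `r` at `v`. As `r` is less than every length, an edge end is in it only when
  -- it is glued to `v`, which makes the condition compatible with the gluing.
  let Lb : Γ.Space → Prop := Quot.lift (fun x => (Γ.src x.1 = v ∧ x.2.1 < r) ∨
    (Γ.tgt x.1 = v ∧ Γ.length x.1 - x.2.1 < r)) (by
      rintro _ _ (⟨e, f, h⟩ | ⟨e, f, h⟩ | ⟨e, f, h⟩) <;>
        simp [start, finish, h, hl1, hr])
  have hrep : ∀ x : Γ.PreSpace, Lb (Quot.mk _ x) → ∃ τ : ℝ, 0 ≤ τ ∧ τ < r ∧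
      Γ.Incident x.1 v ∧ x.2.1 = (if Γ.src x.1 = v then τ else Γ.length x.1 - τ) ∧
      Γ.edgeMap x.1 x.2.1 = torusMk S (L.pos v + (Γ.sign v x.1 * τ) • toReal (Γ.slope x.1)) := by
    rintro ⟨e, t, ht0, ht1⟩ (⟨he, ht⟩ | ⟨he, ht⟩)
    · refine ⟨t, ht0, ht, Or.inl he, (if_pos he).symm, ?_⟩
      rw [L.edgeMap_eq, sign, if_pos he, one_mul]
      simp only at he
      rw [he]
    · have hne : Γ.src e ≠ v := fun h => hloop e (h.trans he.symm)
      refine ⟨Γ.length e - t, by linarith, ht, Or.inr he, ?_, ?_⟩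
      · rw [if_neg hne]; ring
      · rw [L.edgeMap_eq, sign, if_neg hne, torusMk_eq_iff]
        refine ⟨L.shift e, ?_⟩
        have h1 := L.pos_src_add e
        simp only at he
        rw [he] at h1
        have h2 : L.pos (Γ.src e) =
            L.pos v + S.mulVec (toReal (L.shift e)) - Γ.length e • toReal (Γ.slope e) :=
          eq_sub_of_add_eq h1
        simp only [h2]
        module
  refine ⟨{x | Lb x}, IsOpen.mem_nhds (Γ.isOpen_space_iff.2 fun f => ?_) ?_, ?_⟩
  · have hset : {t : Icc (0 : ℝ) (Γ.length f) | Γ.point f t ∈ {x | Lb x}} =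
        ({_t | Γ.src f = v} ∩ {t | t.1 < r}) ∪
          ({_t | Γ.tgt f = v} ∩ {t | Γ.length f - t.1 < r}) := rfl
    rw [hset]
    exact (isOpen_const.inter (isOpen_lt (by fun_prop) (by fun_prop))).union
      (isOpen_const.inter (isOpen_lt (by fun_prop) (by fun_prop)))
  · obtain ⟨e, rfl | rfl⟩ := Γ.exists_incident v
    · rw [← mk_start]
      exact Or.inl ⟨rfl, hr⟩
    · rw [← mk_finish]
      refine Or.inr ⟨rfl, ?_⟩
      simpa [finish] using hr
  · intro x hx y hy h
    obtain ⟨x, rfl⟩ := Quot.exists_rep x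
    obtain ⟨y, rfl⟩ := Quot.exists_rep y
    obtain ⟨τ, hτ0, hτr, hxv, hxτ, hxm⟩ := hrep x hx
    obtain ⟨σ, hσ0, hσr, hyv, hyσ, hym⟩ := hrep y hy
    have h' : Γ.edgeMap x.1 x.2.1 = Γ.edgeMap y.1 y.2.1 := h
    rw [hxm, hym, torusMk_eq_iff] at h'
    obtain ⟨l, hl⟩ := h'
    have h1 : S.mulVec (toReal l) = (Γ.sign v x.1 * τ) • toReal (Γ.slope x.1) -
        (Γ.sign v y.1 * σ) • toReal (Γ.slope y.1) := by
      linear_combination (exp := 1) -hl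
    have hsign : ∀ e, |Γ.sign v e| = 1 := by
      intro e; unfold sign; split_ifs <;> norm_num
    have h2 : l = 0 := by
      refine hgap l ?_
      rw [h1]
      refine (norm_sub_le _ _).trans_lt ?_
      rw [norm_smul, norm_smul, Real.norm_eq_abs, Real.norm_eq_abs, abs_mul, abs_mul, hsign, hsign,
        one_mul, one_mul, abs_of_nonneg hτ0, abs_of_nonneg hσ0]
      have h3 := mul_le_mul_of_nonneg_right hτr.le (norm_nonneg (toReal (Γ.slope x.1)))
      have h4 := mul_le_mul_of_nonneg_right hσr.le (norm_nonneg (toReal (Γ.slope y.1)))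
      linarith [hrρ x.1, hrρ y.1]
    rw [h2, toReal_zero, Matrix.mulVec_zero, eq_comm, sub_eq_zero] at h1
    have hsign0 : ∀ e, Γ.sign v e ≠ 0 := fun e h0 => by simpa [h0] using hsign e
    by_cases hxy : x.1 = y.1
    · obtain ⟨e, t⟩ := x
      obtain ⟨f, s⟩ := y
      simp only at hxy
      subst hxy
      have h3 := smul_left_injective ℝ (toReal_ne_zero (Γ.slope_ne e)) h1
      have h4 := mul_left_cancel₀ (hsign0 e) h3
      have h5 : t = s := Subtype.ext (by
        simp only at hxτ hyσ
        rw [hxτ, hyσ, h4])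
      rw [h5]
    · have hd := hdet x.1 y.1 hxv hyv hxy
      have hτ : τ = 0 := by
        have h3 := congrArg (fun z => planeDet z (toReal (Γ.slope y.1))) h1
        simp only [planeDet_smul_left, planeDet_self, mul_zero] at h3
        exact (mul_eq_zero.1 ((mul_eq_zero.1 h3).resolve_right hd)).resolve_left (hsign0 _)
      have hσ : σ = 0 := by
        have h3 := congrArg (fun z => planeDet (toReal (Γ.slope x.1)) z) h1
        have h4 : planeDet (toReal (Γ.slope x.1)) ((Γ.sign v y.1 * σ) • toReal (Γ.slope y.1)) =
            (Γ.sign v y.1 * σ) * planeDet (toReal (Γ.slope x.1)) (toReal (Γ.slope y.1)) := by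
          simp only [planeDet, Pi.smul_apply, smul_eq_mul]; ring
        have h5 : planeDet (toReal (Γ.slope x.1)) ((Γ.sign v x.1 * τ) • toReal (Γ.slope x.1)) =
            0 := by
          simp only [planeDet, Pi.smul_apply, smul_eq_mul]; ring
        simp only [h4, h5] at h3
        exact (mul_eq_zero.1 ((mul_eq_zero.1 h3.symm).resolve_right hd)).resolve_left (hsign0 _)
      have hvert : ∀ z : Γ.PreSpace, Γ.Incident z.1 v →
          z.2.1 = (if Γ.src z.1 = v then (0 : ℝ) else Γ.length z.1 - 0) →
          Quot.mk Γ.Glue z = Γ.vertexPoint v := by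
        intro z hz hz'
        by_cases hs : Γ.src z.1 = v
        · rw [if_pos hs] at hz'
          rw [Γ.mk_eq_start hz', mk_start, hs]
        · rw [if_neg hs, sub_zero] at hz'
          rw [Γ.mk_eq_finish hz', mk_finish, hz.resolve_left hs]
      rw [hτ] at hxτ
      rw [hσ] at hyσ
      rw [hvert x hxv hxτ, hvert y hyv hyσ]

theorem IsRegularAt.isSimple {L : Γ.Lift} {ε : Fin n → V ⊕ E} {η : Fin n → E}
    (h : Γ.IsRegularAt L ε η) (hS : S.det ≠ 0) : Γ.IsSimple := by
  refine ⟨h.isTrivalent, fun x => ?_⟩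
  have hv := fun v => exists_injOn_nhds_vertex hS L v h.irreducible.src_ne_tgt
    fun e f he hf hne => h.planeDet_slope_ne_zero he hf hne
  obtain ⟨⟨e, t⟩, rfl⟩ := Quot.exists_rep x
  rcases t.2.1.eq_or_lt with h0 | h0
  · rw [Γ.mk_eq_start (x := ⟨e, t⟩) h0.symm, mk_start]
    exact hv _
  · rcases t.2.2.eq_or_lt with h1 | h1
    · rw [Γ.mk_eq_finish (x := ⟨e, t⟩) h1, mk_finish]
      exact hv _
    · exact exists_injOn_nhds_interior hS L ⟨h0, h1⟩

/-- Marked points on the curve, described by the vertices or the edges that contain them. -/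
theorem Lift.exists_marking (L : Γ.Lift) (x : Fin n → Γ.Space) :
    ∃ (ε : Fin n → V ⊕ E) (τ : Fin n → ℝ),
      (∀ i, torusMk S (markPos Γ.src Γ.slope ε L.pos τ i) = Γ.map (x i)) ∧
      (∀ i, ∃ e, τ i ∈ Icc 0 (Γ.length e)) ∧
      ∀ i e, ε i = Sum.inr e → ∃ t : Icc (0 : ℝ) (Γ.length e),
        t.1 ∈ Ioo 0 (Γ.length e) ∧ x i = Γ.point e t := by
  have key : ∀ y : Γ.Space, ∃ (ε : V ⊕ E) (τ : ℝ),
      torusMk S (Sum.elim L.pos (fun e => L.pos (Γ.src e) + τ • toReal (Γ.slope e)) ε) =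
        Γ.map y ∧ (∃ e, τ ∈ Icc 0 (Γ.length e)) ∧
      ∀ e, ε = Sum.inr e → ∃ t : Icc (0 : ℝ) (Γ.length e),
        t.1 ∈ Ioo 0 (Γ.length e) ∧ y = Γ.point e t := by
    intro y
    obtain ⟨⟨e, t⟩, rfl⟩ := Quot.exists_rep y
    have hmap : Γ.map (Quot.mk _ ⟨e, t⟩) = Γ.edgeMap e t := rfl
    by_cases ht : t.1 ∈ Ioo 0 (Γ.length e)
    · refine ⟨Sum.inr e, t, ?_, ⟨e, t.2⟩, ?_⟩
      · rw [hmap, L.edgeMap_eq, Sum.elim_inr]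
      · rintro f hf
        cases Sum.inr_injective hf
        exact ⟨t, ht, rfl⟩
    · rcases t.2.1.eq_or_lt with h0 | h0
      · refine ⟨Sum.inl (Γ.src e), t, ?_, ⟨e, t.2⟩, by simp⟩
        rw [hmap, ← h0, edgeMap_zero, Sum.elim_inl, L.torusMk_pos]
      · rcases t.2.2.eq_or_lt with h1 | h1
        · refine ⟨Sum.inl (Γ.tgt e), t, ?_, ⟨e, t.2⟩, by simp⟩
          rw [hmap, h1, edgeMap_length, Sum.elim_inl, L.torusMk_pos]
        · exact absurd ⟨h0, h1⟩ ht
  choose ε τ h1 h2 h3 using fun i => key (x i)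
  exact ⟨ε, τ, h1, h2, h3⟩

end TropCurve

namespace TropCurve

variable {S : Matrix (Fin 2) (Fin 2) ℝ} {V E : Type} [Fintype V] [DecidableEq V] [Fintype E]
  {Γ : TropCurve S V E} {n : ℕ}

/-! ### The complement of the marked points -/

/-- The points `x i` lie in the interior of the edges `η i`. -/
def AreInterior (Γ : TropCurve S V E) (η : Fin n → E) (x : Fin n → Γ.Space) : Prop :=
  ∀ i, ∃ t : Icc (0 : ℝ) (Γ.length (η i)), t.1 ∈ Ioo 0 (Γ.length (η i)) ∧ x i = Γ.point (η i) t

theorem AreInterior.exists_point_mem_iff {η : Fin n → E} {x : Fin n → Γ.Space}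
    (hx : Γ.AreInterior η x) (e : E) : (∃ t, Γ.point e t ∈ range x) ↔ e ∈ range η := by
  constructor
  · rintro ⟨t, i, hi⟩
    obtain ⟨s, hs, hxs⟩ := hx i
    exact ⟨i, (point_eq_point hs (hi.symm.trans hxs)).1.symm⟩
  · rintro ⟨i, rfl⟩
    obtain ⟨s, -, hxs⟩ := hx i
    exact ⟨s, i, hxs⟩

variable {L : Γ.Lift} {ε : Fin n → V ⊕ E} {η : Fin n → E}

theorem Lift.homologyMap_coe (L : Γ.Lift) (c : Γ.H1) :
    (Γ.homologyMap c : Fin 2 → ℝ) =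
      S.mulVec (toReal fun j => ∑ e, (c : E → ℤ) e * L.shift e j) := by
  have hc : graphBoundary ℝ Γ.src Γ.tgt (fun e => ((c : E → ℤ) e : ℝ)) = 0 := by
    rw [graphBoundary_intCast, mem_H1_iff.1 c.2]
    ext; simp
  refine (L.sum_displacement hc).trans (congrArg S.mulVec ?_)
  ext j
  simp [toReal, Finset.sum_apply]

theorem IsRegularAt.eq_zero_of_mem_H1Compl (h : Γ.IsRegularAt L ε η) {x : Fin n → Γ.Space}
    (hx : Γ.AreInterior η x) {c : E → ℤ} (hc : c ∈ Γ.H1Compl (range x))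
    (h0 : ∀ j, ∑ e, c e * L.shift e j = 0) : c = 0 := by
  have h1 : (fun e => (c e : ℝ)) = 0 := by
    refine h.cycle_eq_zero ?_ (fun i => ?_) fun j => ?_
    · rw [graphBoundary_intCast, mem_H1_iff.1 hc.1]
      ext; simp
    · rw [hc.2 _ ((hx.exists_point_mem_iff _).2 ⟨i, rfl⟩), Int.cast_zero]
    · exact_mod_cast h0 j
  ext e
  exact Int.cast_injective (α := ℝ) ((congrFun h1 e).trans Int.cast_zero.symm)

theorem IsRegularAt.injective_homologyMapCompl (h : Γ.IsRegularAt L ε η) (hS : S.det ≠ 0)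
    {x : Fin n → Γ.Space} (hx : Γ.AreInterior η x) :
    Function.Injective (Γ.homologyMapCompl (range x)) := by
  rw [injective_iff_map_eq_zero]
  rintro ⟨c, hc⟩ h0
  have h1 := (L.homologyMap_coe ⟨c, hc.1⟩).symm.trans (congrArg Subtype.val h0)
  have h2 := congrArg S⁻¹.mulVec h1
  rw [inv_mulVec_mulVec hS] at h2
  refine Subtype.ext (h.eq_zero_of_mem_H1Compl hx hc fun j => ?_)
  have h3 := congrFun h2 j
  simp only [toReal, ZeroMemClass.coe_zero, Matrix.mulVec_zero, Pi.zero_apply] at h3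
  exact_mod_cast h3

/-- The upper bound comes from the injection into `ℤ²` given by the shifts, the lower bound from
imposing `n` linear conditions on a group of rank `n + 2`. -/
theorem IsRegularAt.finrank_H1Compl (h : Γ.IsRegularAt L ε η) {x : Fin n → Γ.Space}
    (hx : Γ.AreInterior η x) : Module.finrank ℤ (Γ.H1Compl (range x)) = 2 := by
  apply le_antisymm
  · let f : Γ.H1Compl (range x) →ₗ[ℤ] (Fin 2 → ℤ) :=
      (AddMonoidHom.mk' (fun (c : Γ.H1Compl (range x)) j => ∑ e, c.1 e * L.shift e j) fun a b => by
        ext j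
        simp [add_mul, Finset.sum_add_distrib]).toIntLinearMap
    have hf : Function.Injective f := by
      rw [injective_iff_map_eq_zero]
      rintro ⟨c, hc⟩ h0
      exact Subtype.ext (h.eq_zero_of_mem_H1Compl hx hc fun j => congrFun h0 j)
    have := LinearMap.finrank_le_finrank_of_injective hf
    rwa [Module.finrank_pi, Fintype.card_fin] at this
  · let ker := LinearMap.ker (graphBoundary ℤ Γ.src Γ.tgt)
    let f : ker →ₗ[ℤ] (Fin n → ℤ) :=
      (LinearMap.pi fun i => LinearMap.proj (η i)).domRestrict ker
    have hf : ∀ (c : ker) i, f c i = (c : E → ℤ) (η i) := fun _ _ => rfl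
    have h1 := finrank_range_add_finrank_ker_int f
    have h2 : Module.finrank ℤ (LinearMap.range f) ≤ n := by
      have := Submodule.finrank_le (LinearMap.range f)
      rwa [Module.finrank_pi, Fintype.card_fin] at this
    have hmem : ∀ c : LinearMap.ker f, (c : ker).1 ∈ Γ.H1Compl (range x) := by
      rintro ⟨⟨c, hc⟩, hc'⟩
      refine ⟨mem_H1_iff.2 hc, fun e he => ?_⟩
      obtain ⟨i, rfl⟩ := (hx.exists_point_mem_iff e).1 he
      exact congrFun (LinearMap.mem_ker.1 hc') i
    let φ : LinearMap.ker f ≃+ Γ.H1Compl (range x) :=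
      { toFun := fun c => ⟨(c : ker).1, hmem c⟩
        invFun := fun c => ⟨⟨c.1, mem_H1_iff.1 c.2.1⟩, LinearMap.mem_ker.2 (funext fun i =>
          c.2.2 _ ((hx.exists_point_mem_iff _).2 ⟨i, rfl⟩))⟩
        left_inv := fun _ => rfl
        right_inv := fun _ => rfl
        map_add' := fun _ _ => rfl }
    have h3 := φ.toIntLinearEquiv.finrank_eq
    have h4 : n + 2 = Module.finrank ℤ ker := h.genus_eq.symm.trans Γ.genus_eq_finrank_ker
    omega

/-- Two points are joined by a connected set that avoids `Q`. -/
def JoinedAvoiding (Γ : TropCurve S V E) (Q : Set Γ.Space) (y z : Γ.Space) : Prop :=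
  ∃ T ⊆ Qᶜ, IsPreconnected T ∧ y ∈ T ∧ z ∈ T

theorem JoinedAvoiding.symm {Q : Set Γ.Space} {y z : Γ.Space} (h : Γ.JoinedAvoiding Q y z) :
    Γ.JoinedAvoiding Q z y := by
  obtain ⟨T, hT, hc, hy, hz⟩ := h
  exact ⟨T, hT, hc, hz, hy⟩

theorem JoinedAvoiding.trans {Q : Set Γ.Space} {y z w : Γ.Space} (h : Γ.JoinedAvoiding Q y z)
    (h' : Γ.JoinedAvoiding Q z w) : Γ.JoinedAvoiding Q y w := by
  obtain ⟨T, hT, hc, hy, hz⟩ := h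
  obtain ⟨T', hT', hc', hz', hw⟩ := h'
  exact ⟨T ∪ T', union_subset hT hT', hc.union z hz hz' hc', Or.inl hy, Or.inr hw⟩

theorem joinedAvoiding_of_segment {Q : Set Γ.Space} {e : E} {a b : Icc (0 : ℝ) (Γ.length e)}
    (hab : a.1 ≤ b.1)
    (h : ∀ u : Icc (0 : ℝ) (Γ.length e), a.1 ≤ u.1 → u.1 ≤ b.1 → Γ.point e u ∉ Q) :
    Γ.JoinedAvoiding Q (Γ.point e a) (Γ.point e b) := by
  have hl := (Γ.length_pos e).le
  refine ⟨(fun u : ℝ => Γ.point e (projIcc 0 (Γ.length e) hl u)) '' Icc a.1 b.1, ?_,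
    isPreconnected_Icc.image _ ((continuous_point e).comp continuous_projIcc).continuousOn,
    ⟨a, ⟨le_rfl, hab⟩, ?_⟩, ⟨b, ⟨hab, le_rfl⟩, ?_⟩⟩
  · rintro _ ⟨u, hu, rfl⟩
    have hu' : u ∈ Icc (0 : ℝ) (Γ.length e) := ⟨a.2.1.trans hu.1, hu.2.trans b.2.2⟩
    simp only [projIcc_of_mem hl hu']
    exact h ⟨u, hu'⟩ hu.1 hu.2
  · simp only [projIcc_val]
  · simp only [projIcc_val]

theorem vertexPoint_src (e : E) :
    Γ.point e ⟨0, left_mem_Icc.2 (Γ.length_pos e).le⟩ = Γ.vertexPoint (Γ.src e) := Γ.mk_start e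

theorem vertexPoint_tgt (e : E) :
    Γ.point e ⟨Γ.length e, right_mem_Icc.2 (Γ.length_pos e).le⟩ = Γ.vertexPoint (Γ.tgt e) :=
  Γ.mk_finish e

/-- Every edge leaving the set of vertices reachable from `v` is marked. A flux equal to `1` on one
such edge and `0` on the other marked edges would have a nonzero net flow out of this set, which is
impossible for a cycle. -/
theorem IsRegularAt.joinedAvoiding_vertexPoint (h : Γ.IsRegularAt L ε η) {x : Fin n → Γ.Space}
    (hx : Γ.AreInterior η x) (v w : V) :
    Γ.JoinedAvoiding (range x) (Γ.vertexPoint v) (Γ.vertexPoint w) := by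
  classical
  have hedge : ∀ e, e ∉ range η →
      Γ.JoinedAvoiding (range x) (Γ.vertexPoint (Γ.src e)) (Γ.vertexPoint (Γ.tgt e)) := by
    intro e he
    rw [← vertexPoint_src, ← vertexPoint_tgt]
    exact joinedAvoiding_of_segment (Γ.length_pos e).le fun u _ _ hu =>
      he ((hx.exists_point_mem_iff e).1 ⟨u, hu⟩)
  have hrefl : Γ.JoinedAvoiding (range x) (Γ.vertexPoint v) (Γ.vertexPoint v) := by
    refine ⟨{Γ.vertexPoint v}, ?_, isPreconnected_singleton, rfl, rfl⟩
    rintro _ rfl ⟨i, hi⟩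
    obtain ⟨t, ht, hxt⟩ := hx i
    obtain ⟨e, rfl | rfl⟩ := Γ.exists_incident v
    · rw [← vertexPoint_src] at hi
      have := (point_eq_point ht (hi.symm.trans hxt)).2
      exact ht.1.ne this
    · rw [← vertexPoint_tgt] at hi
      obtain ⟨h1, h2⟩ := point_eq_point ht (hi.symm.trans hxt)
      rw [h1] at h2
      exact ht.2.ne' h2
  let A : V → Prop := fun u => Γ.JoinedAvoiding (range x) (Γ.vertexPoint v) (Γ.vertexPoint u)
  have hcut : ∀ e, (A (Γ.src e) ↔ A (Γ.tgt e)) := by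
    by_contra hne
    push Not at hne
    obtain ⟨e, he⟩ := hne
    have hin : ∀ f, ¬ (A (Γ.src f) ↔ A (Γ.tgt f)) → f ∈ range η := by
      intro f hf
      by_contra hfη
      exact hf ⟨fun h1 => h1.trans (hedge f hfη), fun h1 => h1.trans (hedge f hfη).symm⟩
    have he' : ¬ (A (Γ.src e) ↔ A (Γ.tgt e)) := by tauto
    obtain ⟨i, rfl⟩ := hin e he'
    obtain ⟨δ, hδ, hδη, -⟩ := h.exists_variation (Pi.single i 1) 0
    have hsum := sum_graphBoundary_smul Γ.src Γ.tgt (Γ.edgeFlux δ)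
      fun u => if A u then (1 : ℝ) else 0
    rw [hδ.graphBoundary_edgeFlux, Finset.sum_eq_single (η i)] at hsum
    · rw [hδη, Pi.single_eq_same] at hsum
      by_cases h1 : A (Γ.src (η i)) <;> by_cases h2 : A (Γ.tgt (η i))
      · exact he' (iff_of_true h1 h2)
      · simp [h1, h2] at hsum
      · simp [h1, h2] at hsum
      · exact he' (iff_of_false h1 h2)
    · intro f _ hf
      by_cases h1 : A (Γ.src f) ↔ A (Γ.tgt f)
      · simp [h1]
      · obtain ⟨k, rfl⟩ := hin f h1
        rw [hδη, Pi.single_eq_of_ne (fun hk => hf (congrArg η hk)), zero_smul]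
    · intro h1; exact absurd (Finset.mem_univ _) h1
  have hA : ∀ e u u', Γ.Incident e u → Γ.Incident e u' → A u → A u' := by
    rintro e u u' (rfl | rfl) (rfl | rfl) h1
    · exact h1
    · exact (hcut e).1 h1
    · exact (hcut e).2 h1
    · exact h1
  have := h.irreducible.1
  have huniv := Γ.edges_eq_univ_of_isPreconnected Γ.isPreconnected_not_isVertexIn_empty
    (A := {e | ∀ u, Γ.Incident e u → A u}) (by
      obtain ⟨e, he⟩ := Γ.exists_incident v
      exact ⟨e, fun u hu => hA e v u he hu hrefl⟩) (by
      intro e f u _ he hf hE u' hu'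
      exact hA f u u' hf hu' (hE u he))
  obtain ⟨e, he⟩ := Γ.exists_incident w
  have : e ∈ {e | ∀ u, Γ.Incident e u → A u} := huniv ▸ mem_univ e
  exact this w he

theorem IsRegularAt.isConnected_compl (h : Γ.IsRegularAt L ε η) {x : Fin n → Γ.Space}
    (hx : Γ.AreInterior η x) : IsConnected ((range x)ᶜ) := by
  have hconn := h.irreducible.1
  obtain ⟨z⟩ := (inferInstance : Nonempty Γ.Space)
  obtain ⟨z, -⟩ := Quot.exists_rep z
  let v₀ := Γ.src z.1
  obtain ⟨T₀, hT₀, -, hv₀, -⟩ := h.joinedAvoiding_vertexPoint hx v₀ v₀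
  have hv₀' : Γ.vertexPoint v₀ ∈ (range x)ᶜ := hT₀ hv₀
  have hjoin : ∀ y ∈ (range x)ᶜ, Γ.JoinedAvoiding (range x) (Γ.vertexPoint v₀) y := by
    intro y hy
    obtain ⟨⟨e, s⟩, rfl⟩ := Quot.exists_rep y
    have hsrc : (∀ u : Icc (0 : ℝ) (Γ.length e), u.1 ≤ s.1 → Γ.point e u ∉ range x) →
        Γ.JoinedAvoiding (range x) (Γ.vertexPoint v₀) (Γ.point e s) := by
      intro hu
      refine (h.joinedAvoiding_vertexPoint hx v₀ (Γ.src e)).trans ?_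
      rw [← vertexPoint_src]
      exact joinedAvoiding_of_segment s.2.1 fun u _ hus => hu u hus
    have htgt : (∀ u : Icc (0 : ℝ) (Γ.length e), s.1 ≤ u.1 → Γ.point e u ∉ range x) →
        Γ.JoinedAvoiding (range x) (Γ.vertexPoint v₀) (Γ.point e s) := by
      intro hu
      refine (h.joinedAvoiding_vertexPoint hx v₀ (Γ.tgt e)).trans ?_
      rw [← vertexPoint_tgt]
      exact (joinedAvoiding_of_segment s.2.2 fun u hsu _ => hu u hsu).symm
    by_cases he : e ∈ range η
    · obtain ⟨i, rfl⟩ := he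
      obtain ⟨t, ht, hxt⟩ := hx i
      -- By injectivity of `η` a marked edge carries a single marked point, so any other point of it
      -- reaches one of its ends.
      have hpt : ∀ u : Icc (0 : ℝ) (Γ.length (η i)), Γ.point (η i) u ∈ range x → u = t := by
        rintro u ⟨k, hk⟩
        obtain ⟨t', ht', hxt'⟩ := hx k
        have h1 := (point_eq_point ht' (hk.symm.trans hxt')).1
        obtain rfl := h.injective h1
        exact Subtype.ext (point_eq_point ht (hk.symm.trans hxt)).2
      rcases lt_trichotomy s.1 t.1 with hst | hst | hst
      · exact hsrc fun u hu hux => by rw [hpt u hux] at hu; exact hu.not_gt hst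
      · exact absurd ⟨i, by rw [hxt, ← Subtype.ext hst]; rfl⟩ hy
      · exact htgt fun u hu hux => by rw [hpt u hux] at hu; exact hu.not_gt hst
    · exact hsrc fun u _ hu => he ((hx.exists_point_mem_iff e).1 ⟨u, hu⟩)
  refine ⟨⟨_, hv₀'⟩, isPreconnected_of_forall (Γ.vertexPoint v₀) fun y hy => ?_⟩
  obtain ⟨T, hT, hc, h1, h2⟩ := hjoin y hy
  exact ⟨T, hT, h1, h2, hc⟩

end TropCurve

/-! ### Rigidity and the main theorem -/

theorem Set.Finite.exists_gap {F : Set ℝ} (hF : F.Finite) (a : ℝ) :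
    ∃ r > 0, ∀ b ∈ F, |b - a| < r → b = a := by
  have h : ∀ᶠ b in 𝓝 a, b ∉ F \ {a} :=
    (hF.subset sdiff_subset).isClosed.isOpen_compl.mem_nhds (by simp)
  obtain ⟨r, hr, hb⟩ := Metric.eventually_nhds_iff.1 h
  refine ⟨r, hr, fun b hbF hba => ?_⟩
  by_contra hne
  exact hb hba ⟨hbF, hne⟩

namespace TropCurve

variable {S : Matrix (Fin 2) (Fin 2) ℝ} {V E : Type} [Fintype V] [DecidableEq V] [Fintype E]
  {Γ : TropCurve S V E} {n : ℕ}

theorem Lift.hasDegree (L : Γ.Lift) {C : Matrix (Fin 2) (Fin 2) ℤ}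
    (h : ∀ j i, ∑ e, (Γ.slope e j : ℝ) * L.shift e i = C j i) : Γ.HasDegree C := by
  intro j
  rw [L.homologyMap_coe]
  congr 1
  ext i
  rw [toReal, toReal, ← h j i]
  push_cast
  rfl

/-- A property of lengths and lifts that holds near a curve holds for the nearby curves. -/
theorem Lift.exists_nhds (L : Γ.Lift) {p : (E → ℝ) × (V → Fin 2 → ℝ) → Prop}
    (hp : ∀ᶠ z in 𝓝 (Γ.length, L.pos), p z) :
    ∃ U ∈ 𝓝 (Γ.length, Γ.pos), ∀ l' (pos' : V → TropTorus S), (l', pos') ∈ U →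
      ∃ q : V → Fin 2 → ℝ, (∀ v, torusMk S (q v) = pos' v) ∧ p (l', q) := by
  let φ : (E → ℝ) × (V → Fin 2 → ℝ) → (E → ℝ) × (V → TropTorus S) :=
    Prod.map id (Pi.map fun _ => torusMk S)
  have hφ : IsOpenMap φ :=
    IsOpenMap.id.prodMap (IsOpenQuotientMap.piMap fun _ => isOpenQuotientMap_torusMk).isOpenMap
  have hφL : φ (Γ.length, L.pos) = (Γ.length, Γ.pos) :=
    Prod.ext rfl (funext L.torusMk_pos)
  refine ⟨φ '' {z | p z}, hφL ▸ hφ.image_mem_nhds hp, ?_⟩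
  rintro l' pos' ⟨⟨l, q⟩, hq, h⟩
  obtain ⟨rfl, rfl⟩ := Prod.ext_iff.1 h
  exact ⟨q, fun v => rfl, hq⟩

/-- A closed edge that misses `P` still misses it after a small deformation. The parameter is
rescaled to `[0, 1]` so that a fixed compact interval serves for all nearby lengths. -/
theorem Lift.eventually_mem_edge (hS : S.det ≠ 0) (L : Γ.Lift) (P : TropTorus S) (e : E) :
    ∀ᶠ z : (E → ℝ) × (V → Fin 2 → ℝ) in 𝓝 (Γ.length, L.pos),
      (∃ u ∈ Icc (0 : ℝ) 1, torusMk S (z.2 (Γ.src e) + (u * z.1 e) • toReal (Γ.slope e)) = P) →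
      ∃ u ∈ Icc (0 : ℝ) 1,
        torusMk S (L.pos (Γ.src e) + (u * Γ.length e) • toReal (Γ.slope e)) = P := by
  have := t2Space_tropTorus hS
  by_cases h : ∃ u ∈ Icc (0 : ℝ) 1,
      torusMk S (L.pos (Γ.src e) + (u * Γ.length e) • toReal (Γ.slope e)) = P
  · exact Eventually.of_forall fun _ _ => h
  · push Not at h
    have h1 : ∀ᶠ z : (E → ℝ) × (V → Fin 2 → ℝ) in 𝓝 (Γ.length, L.pos), ∀ u ∈ Icc (0 : ℝ) 1,
        torusMk S (z.2 (Γ.src e) + (u * z.1 e) • toReal (Γ.slope e)) ≠ P := by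
      refine isCompact_Icc.eventually_forall_of_forall_eventually fun u hu => ?_
      refine (isOpen_ne_fun (continuous_torusMk.comp ?_) continuous_const).mem_nhds (h u hu)
      fun_prop
    filter_upwards [h1] with z hz
    rintro ⟨u, hu, hP⟩
    exact absurd hP (hz u hu)

/-- Regularity of the markings of a curve implies its rigidity. -/
theorem isRigid_of_isRegularAt (hS : S.det ≠ 0) {C : Matrix (Fin 2) (Fin 2) ℤ}
    {V₀ E₀ : Type} [Fintype V₀] [DecidableEq V₀] [Fintype E₀] {Γ₀ : TropCurve S V₀ E₀}
    (hC₀ : Γ₀.HasDegree C) (hC : Γ.HasDegree C) (L : Γ.Lift)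
    {P : Fin n → TropTorus S}
    (hreg : ∀ (η : Fin n → E) (t : Fin n → ℝ), (∀ i, t i ∈ Icc 0 (Γ.length (η i))) →
      (∀ i, torusMk S (L.pos (Γ.src (η i)) + t i • toReal (Γ.slope (η i))) = P i) →
      Γ.IsRegularAt L (fun i => Sum.inr (η i)) η) : Γ.IsRigid Γ₀ P := by
  obtain ⟨ρ, hρ, hgap⟩ := exists_lattice_gap hS
  set K := ‖L.pos‖
  obtain ⟨M, hM⟩ := Lift.exists_uniform_bound hS C Γ.genus (K + 1)
  obtain ⟨F, hF, hFΓ⟩ := exists_finite_moment hS Γ₀ hC₀ M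
  set T := ∑ j, S.mulVec (toReal (C j)) j
  choose r hr hrF using fun j => hF.exists_gap (L.moment j)
  -- The lifts of a marked point on two nearby curves may differ by a lattice vector. Bounded
  -- lattice vectors are finite in number, so their determinants with the slope have a gap at `0`.
  have hbd : ∀ e, ∃ d > 0, ∀ l : Fin 2 → ℤ,
      ‖S.mulVec (toReal l)‖ ≤ 2 * (K + 1) + 2 * (T * ‖toReal (Γ.slope e)‖) →
      |planeDet (S.mulVec (toReal l)) (toReal (Γ.slope e)) - 0| < d →
      planeDet (S.mulVec (toReal l)) (toReal (Γ.slope e)) = 0 := by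
    intro e
    obtain ⟨A, hA⟩ := exists_abs_le_of_norm_mulVec_le hS
      (2 * (K + 1) + 2 * (T * ‖toReal (Γ.slope e)‖))
    obtain ⟨d, hd, h⟩ := ((finite_setOf_abs_le A).image fun l =>
      planeDet (S.mulVec (toReal l)) (toReal (Γ.slope e))).exists_gap 0
    exact ⟨d, hd, fun l hl => h _ ⟨l, hA l hl, rfl⟩⟩
  choose d hd hdl using hbd
  have ev1 : ∀ᶠ z : (E → ℝ) × (V → Fin 2 → ℝ) in 𝓝 (Γ.length, L.pos), ‖z.2‖ < K + 1 :=
    ContinuousAt.eventually_lt (by fun_prop) continuousAt_const (lt_add_one K)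
  have ev2 : ∀ᶠ z : (E → ℝ) × (V → Fin 2 → ℝ) in 𝓝 (Γ.length, L.pos), ∀ e,
      ‖z.2 (Γ.src e) + z.1 e • toReal (Γ.slope e) - z.2 (Γ.tgt e) -
        S.mulVec (toReal (L.shift e))‖ < ρ := by
    refine eventually_all.2 fun e => ContinuousAt.eventually_lt (by fun_prop) continuousAt_const ?_
    simp only [L.pos_src_add, add_sub_cancel_left, sub_self, norm_zero]
    exact hρ
  have ev3 : ∀ᶠ z : (E → ℝ) × (V → Fin 2 → ℝ) in 𝓝 (Γ.length, L.pos), ∀ j,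
      |∑ e, planeDet (z.2 (Γ.src e)) (toReal (Γ.slope e)) * L.shift e j - L.moment j| < r j := by
    refine eventually_all.2 fun j => ContinuousAt.eventually_lt ?_ continuousAt_const ?_
    · unfold planeDet; fun_prop
    · simp only [Lift.moment, sub_self, abs_zero]
      exact hr j
  have ev4 : ∀ᶠ z : (E → ℝ) × (V → Fin 2 → ℝ) in 𝓝 (Γ.length, L.pos), ∀ e,
      |planeDet (z.2 (Γ.src e) - L.pos (Γ.src e)) (toReal (Γ.slope e))| < d e := by
    refine eventually_all.2 fun e => ContinuousAt.eventually_lt ?_ continuousAt_const ?_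
    · unfold planeDet; fun_prop
    · simp only [sub_self, planeDet, Pi.zero_apply, zero_mul, abs_zero]
      exact hd e
  have ev5 := eventually_all.2 fun q : Fin n × E => L.eventually_mem_edge hS (P q.1) q.2
  obtain ⟨U, hU, hUp⟩ := L.exists_nhds (ev1.and (ev2.and (ev3.and (ev4.and ev5))))
  refine ⟨U, hU, fun Γ' hsrc htgt hslope hΓ'U hpass hlin => ?_⟩
  obtain ⟨q, hq, h1, h2, h3, h4, h5⟩ := hUp _ _ hΓ'U
  obtain ⟨L', rfl⟩ := Γ'.exists_lift_of_pos q hq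
  -- Both shifts are integral and their images under `S` are closer than the lattice gap.
  have hshift : L'.shift = L.shift := by
    ext1 e
    rw [← sub_eq_zero]
    refine hgap _ ?_
    have h6 := h2 e
    have h7 := L'.pos_src_add e
    rw [hsrc, htgt, hslope] at h7
    rwa [h7, add_sub_cancel_left, ← Matrix.mulVec_sub, ← toReal_sub] at h6
  have hC' : Γ'.HasDegree C := L'.hasDegree fun j i => by
    rw [hshift, hslope]
    exact L.sum_slope_mul_shift hS hC j i
  have hgenus : Γ'.genus = Γ.genus := by
    rw [genus_eq_finrank_ker, genus_eq_finrank_ker, hsrc, htgt]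
  have hK' : ∀ v, ‖L'.pos v‖ ≤ K + 1 := fun v => (norm_le_pi_norm _ v).trans h1.le
  -- Linear equivalence confines both moments to the finite set `F` or its point at hand, and
  -- closeness turns this into equality.
  have hmoment : ∀ j, L'.moment j = L.moment j := by
    intro j
    refine hrF j _ (hFΓ Γ' L' hC' (hM Γ' L' hgenus hC' hK') hlin j) ?_
    rw [Lift.moment, hsrc, hslope, hshift]
    exact h3 j
  have hmark : ∀ i, ∃ (e : E) (t' : ℝ), t' ∈ Icc 0 (Γ'.length e) ∧
      torusMk S (L'.pos (Γ.src e) + t' • toReal (Γ.slope e)) = P i := by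
    intro i
    obtain ⟨y, hy⟩ := hpass i
    obtain ⟨⟨e, t⟩, rfl⟩ := Quot.exists_rep y
    refine ⟨e, t, t.2, ?_⟩
    rw [← hsrc, ← hslope, ← L'.edgeMap_eq]
    exact hy
  choose η t' ht' hP' using hmark
  have hmark2 : ∀ i, ∃ t ∈ Icc 0 (Γ.length (η i)),
      torusMk S (L.pos (Γ.src (η i)) + t • toReal (Γ.slope (η i))) = P i := by
    intro i
    have hl := Γ'.length_pos (η i)
    obtain ⟨u, hu, hP⟩ := h5 (i, η i) ⟨t' i / Γ'.length (η i),
      ⟨div_nonneg (ht' i).1 hl.le, (div_le_one hl).2 (ht' i).2⟩, by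
        rw [div_mul_cancel₀ _ hl.ne']; exact hP' i⟩
    refine ⟨_, ⟨mul_nonneg hu.1 (Γ.length_pos _).le, ?_⟩, hP⟩
    exact mul_le_of_le_one_left (Γ.length_pos _).le hu.2
  choose t ht hP using hmark2
  -- The points `P i` lie on the same edges of the undeformed curve, possibly at other parameters,
  -- and this marking is regular.
  have hR := hreg η t ht hP
  set δ : V → Fin 2 → ℝ := fun v => L'.pos v - L.pos v with hδ
  have hvar' : ∀ e, δ (Γ.src e) + (Γ'.length e - Γ.length e) • toReal (Γ.slope e) =
      δ (Γ.tgt e) := by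
    intro e
    have h6 := L'.pos_src_add e
    have h7 := L.pos_src_add e
    rw [hsrc, htgt, hslope, hshift] at h6
    simp only [hδ]
    rw [sub_smul]
    linear_combination (exp := 1) h6 - h7
  have hδ0 : δ = 0 := by
    refine hR.variation_eq_zero ⟨_, hvar'⟩ (fun i => ?_) fun j => ?_
    -- The flux of a marked edge is the determinant of a bounded lattice vector with the slope, and
    -- it is smaller than the gap.
    · obtain ⟨l, hl⟩ := torusMk_eq_iff.1 ((hP' i).trans (hP i).symm)
      have h6 : δ (Γ.src (η i)) = S.mulVec (toReal l) + (t i - t' i) • toReal (Γ.slope (η i)) := by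
        simp only [hδ]
        rw [sub_smul]
        linear_combination (exp := 1) hl
      have h7 : Γ.edgeFlux δ (η i) =
          planeDet (S.mulVec (toReal l)) (toReal (Γ.slope (η i))) := by
        rw [edgeFlux, h6, planeDet_add_left, planeDet_smul_left, planeDet_self, mul_zero, add_zero]
      rw [h7]
      refine hdl (η i) l ?_ ?_
      · have h8 : S.mulVec (toReal l) = (L'.pos (Γ.src (η i)) - L.pos (Γ.src (η i))) +
            (t' i - t i) • toReal (Γ.slope (η i)) := by
          rw [sub_smul]
          linear_combination (exp := 1) -hl
        have hT : |t' i - t i| ≤ 2 * T := by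
          have h9 := (ht' i).2.trans (Γ'.length_le hC' (η i))
          have h10 := (ht i).2.trans (Γ.length_le hC (η i))
          have h11 := (ht' i).1
          have h12 := (ht i).1
          rw [abs_le]
          constructor <;> linarith
        rw [h8]
        refine (norm_add_le _ _).trans (add_le_add ((norm_sub_le _ _).trans ?_) ?_)
        · have := norm_le_pi_norm L.pos (Γ.src (η i))
          linarith [hK' (Γ.src (η i))]
        · rw [norm_smul, Real.norm_eq_abs, ← mul_assoc]
          exact mul_le_mul_of_nonneg_right hT (norm_nonneg _)
      · rw [sub_zero, ← h7]
        exact h4 (η i)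
    · have h6 := hmoment j
      rw [Lift.moment, Lift.moment, hsrc, hslope, hshift, ← sub_eq_zero,
        ← Finset.sum_sub_distrib] at h6
      rw [← h6]
      refine Finset.sum_congr rfl fun e _ => ?_
      rw [← sub_mul, ← planeDet_sub_left]
      rfl
  constructor
  · ext e
    have h6 := hvar' e
    rw [hδ0, Pi.zero_apply, Pi.zero_apply, zero_add, smul_eq_zero, sub_eq_zero] at h6
    exact h6.resolve_right (toReal_ne_zero (Γ.slope_ne e))
  · ext1 v
    rw [← L'.torusMk_pos, ← L.torusMk_pos, sub_eq_zero.1 (congrFun hδ0 v)]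

end TropCurve

theorem mainTheorem7 (S : Matrix (Fin 2) (Fin 2) ℝ) (hS : S.det ≠ 0)
    (C : Matrix (Fin 2) (Fin 2) ℤ) (hC : C.det ≠ 0) (g : ℕ) (hg : 2 ≤ g)
    (V₀ E₀ : Type) [Fintype V₀] [DecidableEq V₀] [Fintype E₀] (Γ₀ : TropCurve S V₀ E₀)
    (hΓ₀ : ConnectedSpace Γ₀.Space) (hg₀ : Γ₀.genus = 2) (hC₀ : Γ₀.HasDegree C) :
    HoldsGenerically S (g - 2) fun P =>
      ∀ (V E : Type) [Fintype V] [DecidableEq V] [Fintype E] (Γ : TropCurve S V E),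
        Γ.IsIrreducible → Γ.genus = g → Γ.HasDegree C → Γ.PassesThrough P →
        Γ.LinearlyEquivalent Γ₀ →
        (Γ.IsSimple ∧ Γ.IsRigid Γ₀ P) ∧
        ∀ x : Fin (g - 2) → Γ.Space, (∀ i, Γ.map (x i) = P i) →
          IsConnected ((range x)ᶜ) ∧
          Module.finrank ℤ (Γ.H1Compl (range x)) = 2 ∧
          Function.Injective (Γ.homologyMapCompl (range x)) := by
  obtain ⟨K, hK, hlift⟩ := TropCurve.exists_bounded_lift hS
  obtain ⟨U, hUo, hUd, hU0, hU⟩ :=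
    TropCurve.holdsGenerically_isRegularMarking hS Γ₀ hC₀ g (g - 2) K
  refine ⟨U, hUo, hUd, hU0, fun P hP V E _ _ _ Γ hirr hgenus hdeg hpass hlin => ?_⟩
  -- The lift obeys the same bound `K` for which the open set `U` was built.
  obtain ⟨L, hL⟩ := hlift Γ
  have hreg : ∀ (ε : Fin (g - 2) → V ⊕ E) (τ : Fin (g - 2) → ℝ),
      (∀ i, ∃ e, τ i ∈ Icc 0 (Γ.length e)) →
      (∀ i, torusMk S (markPos Γ.src Γ.slope ε L.pos τ i) = P i) →
      ∀ η, Γ.MarksEdges ε η → Γ.IsRegularAt L ε η := by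
    intro ε τ hτ hε η hη
    refine ⟨hU P hP V E Γ L hgenus hdeg hlin hL ε τ (fun i => ?_) hε, hη, hirr, by omega,
      L.exists_translation hS hC hdeg⟩
    obtain ⟨e, he⟩ := hτ i
    rw [abs_of_nonneg he.1]
    exact he.2.trans (Γ.length_le hdeg e)
  have hpoints : ∀ x : Fin (g - 2) → Γ.Space, (∀ i, Γ.map (x i) = P i) →
      ∃ ε η, Γ.IsRegularAt L ε η ∧ Γ.AreInterior η x := by
    intro x hx
    obtain ⟨ε, τ, h1, h2, h3⟩ := L.exists_marking x
    obtain ⟨η, hη⟩ := Γ.exists_marksEdges ε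
    have h := hreg ε τ h2 (fun i => (h1 i).trans (hx i)) η hη
    exact ⟨ε, η, h, fun i => h3 i (η i) (h.eq_inr i)⟩
  refine ⟨⟨?_, ?_⟩, fun x hx => ?_⟩
  · choose x hx using hpass
    obtain ⟨ε, η, h, -⟩ := hpoints x hx
    exact h.isSimple hS
  -- Here `t i` may be an end of its edge; such markings are also covered by the choice of `U`,
  -- which allows all parameters in the closed edges.
  · refine TropCurve.isRigid_of_isRegularAt hS hC₀ hdeg L fun η t ht hPt => ?_
    exact hreg (fun i => Sum.inr (η i)) t (fun i => ⟨_, ht i⟩) hPt η fun i => Or.inl rfl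
  · obtain ⟨ε, η, h, hint⟩ := hpoints x hx
    exact ⟨h.isConnected_compl hint, h.finrank_H1Compl hint, h.injective_homologyMapCompl hS hint⟩
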